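/- **Setting.** Let $a<b$, $c<d$, $T>0$, $\Omega=(a,b)\times(c,d)$, $1<\alpha,\beta<2$, and let $K_1^x,K_2^x,K_1^y,K_2^y\ge 0$ with $(K_1^x)^2+(K_2^x)^2\ne0$ and $(K_1^y)^2+(K_2^y)^2\neq 0$. Let $u$ solve $$\partial_t u=K_1^x\,{}_aD_x^\alpha u+K_2^x\,{}_xD_b^\alpha u+K_1^y\,{}_cD_y^\beta u+K_2^y\,{}_yD_d^\beta u+f\quad\text{in }\Omega\times(0,T],$$ $u(\cdot,\cdot,0)=u_0$ on $\overline\Omega$, $u=\phi$ on $\partial\Omega\times(0,T]$, where ${}_aD_x^\alpha,{}_xD_b^\alpha$ (and likewise in $y$) are the left and right Riemann–Liouville derivatives, $f$ is continuous on $\overline\Omega\times(0,T]$, and $\phi$ vanishes on the side $x=a$ if $K_1^x\ne0$, $x=b$ if $K_2^x\neq0$, $y=c$ if $K_1^y\ne0$, $y=d$ if $K_2^y\ne0$. Assume that $u$ is sufficiently smooth: let $X\supseteq[a,b]$ be the interval obtained from $[a,b]$ by prolonging it to $-\infty$ if $K_1^x\ne0$ and to $+\infty$ if $K_2^x\neq0$,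 let $Y\supseteq[c,d]$ be obtained in the same way from $K_1^y,K_2^y$; then the extension of $u$ by zero from $\overline\Omega\times[0,T]$ to $X\times Y\times[0,T]$ is of class $C^7$. **Scheme.** For positive integers $M_x,M_y,N$ put $h_x=(b-a)/M_x$, $h_y=(d-c)/M_y$, $\tau=T/N$, $x_j=a+jh_x$, $y_s=c+sh_y$, $t_n=n\tau$, $t_{n+1/2}=(t_n+t_{n+1})/2$, $f_{j,s}^{n+1/2}=f(x_j,y_s,t_{n+1/2})$. Let $g_k^{(\alpha)}=\frac{\Gamma(k-\alpha)}{\Gamma(-\alpha)\Gamma(k+1)}$, $\mu_1=\frac{(1+\alpha)(2+\alpha)}{12}$, $\mu_0=-\frac{(\alpha-2)(\alpha+2)}{6}$, $\mu_{-1}=\frac{(\alpha-2)(\alpha-1)}{12}$, $b_2^\alpha=\frac{4+\alpha-\alpha^2}{24}$, and $w_k^{(\alpha)}=\mu_1g_k^{(\alpha)}+\mu_0g_{k-1}^{(\alpha)}+\mu_{-1}g_{k-2}^{(\alpha)}$ with $g_{-1}^{(\alpha)}=g_{-2}^{(\alpha)}=0$. In the index $j$ (for $1\le j\le M_x-1$)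 set $$P_xv_j=v_j+b_2^\alpha(v_{j-1}-2v_j+v_{j+1}),\qquad \delta_x^\alpha v_j=\frac{K_1^x}{h_x^\alpha}\sum_{k=0}^{j+1}w_k^{(\alpha)}v_{j-k+1}+\frac{K_2^x}{h_x^\alpha}\sum_{k=0}^{M_x-j+1}w_k^{(\alpha)}v_{j+k-1},$$ and define $P_y,\delta_y^\beta$ in the same way in the index $s$, with $\beta,K_1^y,K_2^y,h_y,M_y$. Let $U^n_{j,s}$ ($0\le j\le M_x$, $0\le s\le M_y$, $0\le n\le N$) satisfy the factored Crank–Nicolson quasi-compact scheme $$\Big(P_x-\tfrac\tau2\delta_x^\alpha\Big)\Big(P_y-\tfrac\tau2\delta_y^\beta\Big)U^{n+1}_{j,s}=\Big(P_x+\tfrac\tau2\delta_x^\alpha\Big)\Big(P_y+\tfrac\tau2\delta_y^\beta\Big)U^{n}_{j,s}+\tau P_xP_yf^{n+1/2}_{j,s}$$ for $1\le j\le M_x-1$, $1\le s\le M_y-1$, $0\le n\le N-1$, with $U^0_{j,s}=u_0(x_j,y_s)$ at all nodes and $U^n_{j,s}=\phi(x_j,y_s,t_n)$ at the boundary nodes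 for $1\le n\le N$. **Theorem.** There is a constant $C>0$, independent of $\tau,h_x,h_y$ (that is, of $M_x,M_y,N$) and of $n$, such that for all $0\le n\le N$ $$\Big(h_xh_y\sum_{j=1}^{M_x-1}\sum_{s=1}^{M_y-1}\big(u(x_j,y_s,t_n)-U^n_{j,s}\big)^2\Big)^{1/2}\le C\,(\tau^2+h_x^4+h_y^4).$$ -/

import Mathlib

open Set

noncomputable section

namespace FracDiffusion

/-! Riemann-Liouville derivatives. -/

/-- Left Riemann-Liouville derivative of order `α` with base point `a`. Here `n - 1 ≤ α < n` for
`n = ⌊α⌋₊ + 1`. -/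
def leftRL (a α : ℝ) (v : ℝ → ℝ) (x : ℝ) : ℝ :=
  1 / Real.Gamma (((⌊α⌋₊ + 1 : ℕ) : ℝ) - α) *
    iteratedDeriv (⌊α⌋₊ + 1)
      (fun z => ∫ s in a..z, (z - s) ^ (((⌊α⌋₊ + 1 : ℕ) : ℝ) - α - 1) * v s) x

/-- Right Riemann-Liouville derivative of order `α` with end point `b`. -/
def rightRL (b α : ℝ) (v : ℝ → ℝ) (x : ℝ) : ℝ :=
  (-1) ^ (⌊α⌋₊ + 1) / Real.Gamma (((⌊α⌋₊ + 1 : ℕ) : ℝ) - α) *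
    iteratedDeriv (⌊α⌋₊ + 1)
      (fun z => ∫ s in z..b, (s - z) ^ (((⌊α⌋₊ + 1 : ℕ) : ℝ) - α - 1) * v s) x

/-! The initial boundary value problem. -/

/-- Data of the two-dimensional two-sided problem on `(a, b) × (c, d) × (0, T]`. -/
structure Data where
  (a b c d T : ℝ)
  /-- order in the `x`-direction -/
  α : ℝ
  /-- order in the `y`-direction -/
  β : ℝ
  /-- left and right diffusion coefficients in the `x`- and `y`-direction -/
  (Kx₁ Kx₂ Ky₁ Ky₂ : ℝ)
  /-- source term `f x y t` -/
  f : ℝ → ℝ → ℝ → ℝ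
  /-- initial value `u₀ x y` -/
  u₀ : ℝ → ℝ → ℝ
  /-- boundary value `φ x y t` -/
  φ : ℝ → ℝ → ℝ → ℝ
  hab : a < b
  hcd : c < d
  hT : 0 < T
  hα₁ : 1 < α
  hα₂ : α < 2
  hβ₁ : 1 < β
  hβ₂ : β < 2
  hKx₁ : 0 ≤ Kx₁
  hKx₂ : 0 ≤ Kx₂
  hKy₁ : 0 ≤ Ky₁
  hKy₂ : 0 ≤ Ky₂
  hKx : Kx₁ ^ 2 + Kx₂ ^ 2 ≠ 0
  hKy : Ky₁ ^ 2 + Ky₂ ^ 2 ≠ 0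
  hφa : Kx₁ ≠ 0 → ∀ y ∈ Icc c d, ∀ t ∈ Ioc 0 T, φ a y t = 0
  hφb : Kx₂ ≠ 0 → ∀ y ∈ Icc c d, ∀ t ∈ Ioc 0 T, φ b y t = 0
  hφc : Ky₁ ≠ 0 → ∀ x ∈ Icc a b, ∀ t ∈ Ioc 0 T, φ x c t = 0
  hφd : Ky₂ ≠ 0 → ∀ x ∈ Icc a b, ∀ t ∈ Ioc 0 T, φ x d t = 0
  /-- the source term is continuous up to the lateral boundary (its boundary values enter the
  difference scheme) -/
  hf : ContinuousOn (fun p : ℝ × ℝ × ℝ => f p.1 p.2.1 p.2.2) (Icc a b ×ˢ Icc c d ×ˢ Ioc 0 T)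

/-- `u` is a (classical) solution of the initial boundary value problem. -/
structure IsSolution (D : Data) (u : ℝ → ℝ → ℝ → ℝ) : Prop where
  equation : ∀ x ∈ Ioo D.a D.b, ∀ y ∈ Ioo D.c D.d, ∀ t ∈ Ioc 0 D.T,
    HasDerivWithinAt (fun r => u x y r)
      (D.Kx₁ * leftRL D.a D.α (fun z => u z y t) x + D.Kx₂ * rightRL D.b D.α (fun z => u z y t) x
        + D.Ky₁ * leftRL D.c D.β (fun z => u x z t) y
        + D.Ky₂ * rightRL D.d D.β (fun z => u x z t) y
        + D.f x y t) (Icc 0 D.T) t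
  initial : ∀ x ∈ Icc D.a D.b, ∀ y ∈ Icc D.c D.d, u x y 0 = D.u₀ x y
  boundary : ∀ x ∈ Icc D.a D.b, ∀ y ∈ Icc D.c D.d, ∀ t ∈ Ioc 0 D.T,
    x = D.a ∨ x = D.b ∨ y = D.c ∨ y = D.d → u x y t = D.φ x y t

open Classical in
/-- Extension of `u` by zero in the space variables. -/
def zeroExt (D : Data) (u : ℝ → ℝ → ℝ → ℝ) (p : ℝ × ℝ × ℝ) : ℝ :=
  if p.1 ∈ Icc D.a D.b ∧ p.2.1 ∈ Icc D.c D.d then u p.1 p.2.1 p.2.2 else 0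

/-- The interval `[a, b]`, prolonged to `-∞` if the left derivative is present (`K₁ ≠ 0`) and
to `+∞` if the right derivative is present (`K₂ ≠ 0`). -/
def extInterval (K₁ K₂ a b : ℝ) : Set ℝ :=
  {x | (K₁ = 0 → a ≤ x) ∧ (K₂ = 0 → x ≤ b)}

/-- Sufficient smoothness: the zero extension of `u` across those sides of the rectangle on which
a fractional derivative is based is of class `C^7`, up to the remaining sides and up to
`t = 0` and `t = T`. -/
def SufficientlySmooth (D : Data) (u : ℝ → ℝ → ℝ → ℝ) : Prop :=
  ContDiffOn ℝ 7 (zeroExt D u)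
    (extInterval D.Kx₁ D.Kx₂ D.a D.b ×ˢ extInterval D.Ky₁ D.Ky₂ D.c D.d ×ˢ Icc 0 D.T)

/-! One-dimensional difference operators, on grid functions `v 0, …, v M`. -/

/-- Grünwald weights. -/
def g (α : ℝ) (k : ℕ) : ℝ :=
  Real.Gamma (k - α) / (Real.Gamma (-α) * Real.Gamma (k + 1))

def μ₁ (α : ℝ) : ℝ := (1 + α) * (2 + α) / 12

def μ₀ (α : ℝ) : ℝ := -((-2 + α) * (2 + α) / 6)

/-- The coefficient `μ_{-1}`. -/
def μm (α : ℝ) : ℝ := (-2 + α) * (-1 + α) / 12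

def b₂ (α : ℝ) : ℝ := (4 + α - α ^ 2) / 24

/-- The combined weights `w_k`. -/
def w (α : ℝ) : ℕ → ℝ
  | 0 => μ₁ α * g α 0
  | 1 => μ₀ α * g α 0 + μ₁ α * g α 1
  | k + 2 => μ₁ α * g α (k + 2) + μ₀ α * g α (k + 1) + μm α * g α k

/-- Discrete left derivative at an interior index `0 < j < M`. -/
def leftD (α h : ℝ) (v : ℕ → ℝ) (j : ℕ) : ℝ :=
  1 / h ^ α * ∑ k ∈ Finset.range (j + 2), w α k * v (j + 1 - k)

/-- Discrete right derivative at an interior index `0 < j < M`. -/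
def rightD (α h : ℝ) (M : ℕ) (v : ℕ → ℝ) (j : ℕ) : ℝ :=
  1 / h ^ α * ∑ k ∈ Finset.range (M - j + 2), w α k * v (j + k - 1)

/-- `δ^α = K₁ · leftD + K₂ · rightD`. -/
def deltaFrac (α K₁ K₂ h : ℝ) (M : ℕ) (v : ℕ → ℝ) (j : ℕ) : ℝ :=
  K₁ * leftD α h v j + K₂ * rightD α h M v j

/-- `P = 1 + h² b₂ δ²` at an interior index, with `δ²` the centered second difference. -/
def P (α h : ℝ) (v : ℕ → ℝ) (j : ℕ) : ℝ :=
  v j + h ^ 2 * b₂ α * ((v (j - 1) - 2 * v j + v (j + 1)) / h ^ 2)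

/-! The two-dimensional scheme. Grid functions are written `V j s`. -/

/-- A one-dimensional operator acting in the first index. -/
def inX (L : (ℕ → ℝ) → ℕ → ℝ) (V : ℕ → ℕ → ℝ) : ℕ → ℕ → ℝ :=
  fun j s => L (fun i => V i s) j

/-- A one-dimensional operator acting in the second index. -/
def inY (L : (ℕ → ℝ) → ℕ → ℝ) (V : ℕ → ℕ → ℝ) : ℕ → ℕ → ℝ :=
  fun j s => L (fun i => V j i) s

namespace Data

variable (D : Data) (Mx My N : ℕ)

def hx : ℝ := (D.b - D.a) / Mx

def hy : ℝ := (D.d - D.c) / My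

def τ : ℝ := D.T / N

def x (j : ℕ) : ℝ := D.a + j * D.hx Mx

def y (s : ℕ) : ℝ := D.c + s * D.hy My

def t (n : ℕ) : ℝ := n * D.τ N

/-- The operator `P_x + r δ_x^α`. -/
def opX (r : ℝ) : (ℕ → ℕ → ℝ) → ℕ → ℕ → ℝ :=
  inX fun v j => P D.α (D.hx Mx) v j + r * deltaFrac D.α D.Kx₁ D.Kx₂ (D.hx Mx) Mx v j

/-- The operator `P_y + r δ_y^β`. -/
def opY (r : ℝ) : (ℕ → ℕ → ℝ) → ℕ → ℕ → ℝ :=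
  inY fun v s => P D.β (D.hy My) v s + r * deltaFrac D.β D.Ky₁ D.Ky₂ (D.hy My) My v s

/-- The values `f_{j,s}^{n+1/2}`. -/
def fHalf (n : ℕ) : ℕ → ℕ → ℝ :=
  fun j s => D.f (D.x Mx j) (D.y My s) ((D.t N n + D.t N (n + 1)) / 2)

/-- The discrete `L²` norm over the interior nodes. -/
def gridNorm (V : ℕ → ℕ → ℝ) : ℝ :=
  √(D.hx Mx * D.hy My * ∑ j ∈ Finset.Ioo 0 Mx, ∑ s ∈ Finset.Ioo 0 My, V j s ^ 2)

end Data

/-- `U n j s`, `n ≤ N`, `j ≤ Mx`, `s ≤ My`, solves the factored Crank-Nicolson quasi-compact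
scheme. -/
structure IsSchemeSolution (D : Data) (Mx My N : ℕ) (U : ℕ → ℕ → ℕ → ℝ) : Prop where
  initial : ∀ j ≤ Mx, ∀ s ≤ My, U 0 j s = D.u₀ (D.x Mx j) (D.y My s)
  boundary : ∀ n, 1 ≤ n → n ≤ N → ∀ j ≤ Mx, ∀ s ≤ My, j = 0 ∨ j = Mx ∨ s = 0 ∨ s = My →
    U n j s = D.φ (D.x Mx j) (D.y My s) (D.t N n)
  step : ∀ n < N, ∀ j ∈ Finset.Ioo 0 Mx, ∀ s ∈ Finset.Ioo 0 My,
    D.opX Mx (-(D.τ N / 2)) (D.opY My (-(D.τ N / 2)) (U (n + 1))) j s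
      = D.opX Mx (D.τ N / 2) (D.opY My (D.τ N / 2) (U n)) j s
        + D.τ N * inX (P D.α (D.hx Mx)) (inY (P D.β (D.hy My)) (D.fHalf Mx My N n)) j s

end FracDiffusion

end

namespace FracDiffusion

/-! Grünwald weights. -/

/-! The error of the scheme satisfies the scheme itself, with zero initial and boundary values and
with the local residual in place of the source. The estimate therefore splits into stability of a
factored Crank–Nicolson step in a discrete energy, and a bound τ·O(τ² + h_x⁴ + h_y⁴) for the
residual.

Stability. In one index, δ is a Toeplitz operator plus a reflected one. The weights satisfy w_k ≥ 0
for k ≥ 3 and w_0 + w_2 ≥ 0, and their partial sums of at least three terms are ≤ 0.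
Autocorrelations of a vector are at most its squared norm, so ⟨δv, v⟩ ≤ 0 (`toeplitz_form_nonpos`).
The averaging operator P is symmetric, P ≥ 1/3, and its form is a nonnegative combination of sums of
squares (`P_form`), so signs survive tensoring with P in the other index (`tensor_form_le`). Put r =
τ/2 and Y = P_y⁻¹ δ_y E. The factored step is then a one-dimensional Crank–Nicolson step in x from E
+ rY to E' - rY'. Testing with the sum of the two shows that the root of the energy ⟨P_x P_y ·, ·⟩
grows by at most a multiple of the residual, and replacing E - rY by E + rY does not increase the
energy (`factored_crankNicolson_step`). No relation between τ and h is needed.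

Consistency in one variable. Smoothness of the zero extension makes the derivatives of v vanish at
the base point, so v is the sixfold integral of v⁽⁶⁾ and D^α v is the integral of order 6 - α of
v⁽⁶⁾. Hence the discrete derivative minus P D^α v is h^{5-α} times an integral of v⁽⁶⁾ against
K((x_{j+1} - s)/h), with K the `peanoKernel`. The bound |K(z)| ≤ C z^{1-α}, integrable at zero,
gives h^{5-α} h^{α-1} = h⁴.

The kernel bound rests on the asymptotics of Σ g_k (z - k)₊⁵. At an integer n the sum is a
polynomial times Γ(n+1-α)/Γ(n), and the relative expansion of this ratio in Z = n - α/2, up to a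
remainder O(Z⁻⁴), has no odd terms (`exists_Gamma_ratio_expansion`). Between integers one uses that
differentiation lowers the exponent, and climbs from exponent one to five (`gsum_five_bound`). The
μ's and b₂ are such that the four leading Taylor terms cancel (`peanoKernel_bound_of_ge`).

In two variables the residual splits into six terms (`residual_eq`), each a one-dimensional estimate
under averaging operators, except for the splitting term r² δ_x δ_y. That term costs three
derivatives in x, three in y and one in t, whence class C⁷. -/

theorem g_succ {α : ℝ} {k : ℕ} (h : (k : ℝ) - α ≠ 0) :
    g α (k + 1) = g α k * ((k - α) / (k + 1)) := by
  unfold g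
  have h1 : ((k + 1 : ℕ) : ℝ) - α = (k - α) + 1 := by push_cast; ring
  have h2 : (k : ℝ) + 1 ≠ 0 := by positivity
  rw [h1, Real.Gamma_add_one h, Nat.cast_succ, Real.Gamma_add_one h2]
  rw [div_mul_div_comm]
  congr 1 <;> ring

theorem g_zero {α : ℝ} (h : ∀ k : ℕ, (k : ℝ) ≠ α) : g α 0 = 1 := by
  unfold g
  have : Real.Gamma (-α) ≠ 0 := Real.Gamma_ne_zero fun m hm => h m (by linarith)
  simp [this]

theorem g_one {α : ℝ} (h : ∀ k : ℕ, (k : ℝ) ≠ α) : g α 1 = -α := by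
  have := g_succ (α := α) (k := 0) (sub_ne_zero.2 (h 0))
  rw [g_zero h] at this
  simpa using this

/-- The `g α k` are the coefficients of (1 - z)^α; this is the coefficient form of (1 - z)^α = (1 -
z)(1 - z)^{α-1}. -/
theorem g_sub_one_diff {α : ℝ} (h : ∀ k : ℕ, (k : ℝ) ≠ α) (n : ℕ) :
    g (α - 1) (n + 1) = g (α - 1) n + g α (n + 1) := by
  have h0 : -α ≠ 0 := by have := h 0; simpa [eq_comm] using this
  have h1 : g α (n + 1) = g (α - 1) n * (-α / (n + 1)) := by
    unfold g
    have e1 : ((n + 1 : ℕ) : ℝ) - α = n - (α - 1) := by push_cast; ring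
    have e2 : -(α - 1) = -α + 1 := by ring
    have h2 : (n : ℝ) + 1 ≠ 0 := by positivity
    rw [e1, e2, Real.Gamma_add_one h0, Nat.cast_succ, Real.Gamma_add_one h2]
    have : Real.Gamma (-α) ≠ 0 := Real.Gamma_ne_zero fun m hm => h m (by linarith)
    have h4 : α ≠ 0 := neg_ne_zero.1 h0
    have h3 : Real.Gamma ((n : ℝ) + 1) ≠ 0 := (Real.Gamma_pos_of_pos (by positivity)).ne'
    field_simp
  have h3 : (n : ℝ) - (α - 1) ≠ 0 := by
    have := h (n + 1); push_cast at this
    intro h'; apply this; linarith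
  rw [g_succ h3, h1]
  have h2 : (n : ℝ) + 1 ≠ 0 := by positivity
  field_simp
  ring

theorem ne_sub_one {α : ℝ} (h : ∀ k : ℕ, (k : ℝ) ≠ α) (k : ℕ) : (k : ℝ) ≠ α - 1 := by
  have := h (k + 1); push_cast at this
  intro h'; apply this; linarith

theorem sum_g {α : ℝ} (h : ∀ k : ℕ, (k : ℝ) ≠ α) (n : ℕ) :
    ∑ k ∈ Finset.range (n + 1), g α k = g (α - 1) n := by
  induction n with
  | zero => simp [g_zero h, g_zero (ne_sub_one h)]
  | succ n ih => rw [Finset.sum_range_succ, ih, g_sub_one_diff h]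

theorem natCast_ne_of_mem {α : ℝ} (h1 : 1 < α) (h2 : α < 2) (k : ℕ) : (k : ℝ) ≠ α := by
  rintro rfl
  have a : 1 < k := by exact_mod_cast h1
  have b : k < 2 := by exact_mod_cast h2
  omega

theorem g_nonneg {α : ℝ} (h1 : 1 < α) (h2 : α < 2) (k : ℕ) : 0 ≤ g α (k + 2) := by
  have hn := natCast_ne_of_mem h1 h2
  induction k with
  | zero =>
    have : g α (0 + 2) = g α 1 * (((1 : ℕ) - α) / ((1 : ℕ) + 1)) :=
      g_succ (k := 1) (sub_ne_zero.2 (hn 1))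
    rw [this, g_one hn]; push_cast
    have : -α * ((1 - α) / (1 + 1)) = α * (α - 1) / 2 := by ring
    rw [this]; have := sub_pos.2 h1; positivity
  | succ k ih =>
    have : g α (k + 1 + 2) = g α (k + 2) * (((k + 2 : ℕ) - α) / ((k + 2 : ℕ) + 1)) :=
      g_succ (k := k + 2) (sub_ne_zero.2 (hn _))
    rw [this]
    refine mul_nonneg ih (div_nonneg ?_ (by positivity))
    push_cast; linarith [(Nat.cast_nonneg k : (0:ℝ) ≤ k)]

theorem g_sub_one_nonpos {α : ℝ} (h1 : 1 < α) (h2 : α < 2) (k : ℕ) : g (α - 1) (k + 1) ≤ 0 := by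
  have hn := ne_sub_one (natCast_ne_of_mem h1 h2)
  induction k with
  | zero => rw [g_one hn]; linarith
  | succ k ih =>
    rw [g_succ (k := k + 1) (sub_ne_zero.2 (hn _))]
    refine mul_nonpos_of_nonpos_of_nonneg ih (div_nonneg ?_ (by positivity))
    push_cast; linarith [(Nat.cast_nonneg k : (0:ℝ) ≤ k)]

/-- The three Grünwald weights involved share a nonnegative factor, which leaves the sign of a
polynomial in the index. The first case is separate because g_1 = -α is negative; there it is
compensated by μ_{-1} ≤ 0. -/
theorem w_nonneg {α : ℝ} (h1 : 1 < α) (h2 : α < 2) (k : ℕ) : 0 ≤ w α (k + 3) := by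
  have hn := natCast_ne_of_mem h1 h2
  cases k with
  | zero =>
    show 0 ≤ μ₁ α * g α 3 + μ₀ α * g α 2 + μm α * g α 1
    have := g_nonneg h1 h2 0
    have := g_nonneg h1 h2 1
    rw [g_one hn]
    have a1 : 0 ≤ μ₁ α := by unfold μ₁; positivity
    have a2 : 0 ≤ μ₀ α := by unfold μ₀; nlinarith
    have a3 : μm α ≤ 0 := by unfold μm; nlinarith
    have := mul_nonneg a1 (g_nonneg h1 h2 1)
    have := mul_nonneg a2 (g_nonneg h1 h2 0)
    nlinarith
  | succ k =>
    show 0 ≤ μ₁ α * g α (k + 4) + μ₀ α * g α (k + 3) + μm α * g α (k + 2)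
    have e1 := g_succ (α := α) (k := k + 3) (sub_ne_zero.2 (hn _))
    have e2 := g_succ (α := α) (k := k + 2) (sub_ne_zero.2 (hn _))
    rw [e1, e2]
    have hk : (0 : ℝ) ≤ k := Nat.cast_nonneg k
    have : μ₁ α * (g α (k + 2) * (((k + 2 : ℕ) - α) / ((k + 2 : ℕ) + 1))
          * (((k + 3 : ℕ) - α) / ((k + 3 : ℕ) + 1)))
        + μ₀ α * (g α (k + 2) * (((k + 2 : ℕ) - α) / ((k + 2 : ℕ) + 1))) + μm α * g α (k + 2)
        = g α (k + 2) * ((μ₁ α * ((k + 2 - α) * (k + 3 - α)) + μ₀ α * ((k + 2 - α) * (k + 4))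
          + μm α * ((k + 3) * (k + 4))) / ((k + 3) * (k + 4))) := by
      push_cast; field_simp; ring
    rw [this]
    refine mul_nonneg (g_nonneg h1 h2 k) (div_nonneg ?_ (by positivity))
    unfold μ₁ μ₀ μm
    -- With α = 2 - q and 0 < q < 1, the inequality becomes polynomial in k, q and 1 - q, all
    -- nonnegative.
    obtain ⟨p, rfl⟩ : ∃ p, α = 1 + p := ⟨α - 1, by ring⟩
    obtain ⟨q, rfl⟩ : ∃ q, p = 1 - q := ⟨1 - p, by ring⟩
    have hq : 0 < q := by linarith
    have hq' : 0 < 1 - q := by linarith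
    have : 0 ≤ (k:ℝ) * q := by positivity
    have : 0 ≤ (k:ℝ) * (1 - q) := by positivity
    ring_nf
    nlinarith [mul_pos hq hq', mul_pos (mul_pos hq hq') hq, mul_pos (mul_pos hq hq') hq', mul_nonneg hk hk, mul_nonneg this hq.le, mul_nonneg this hq'.le, mul_pos (mul_pos (mul_pos hq hq') hq) hq]

/-- Both weights multiply the autocorrelation at lag one, so only their sum has to have a sign. -/
theorem w_zero_add_two_nonneg {α : ℝ} (h1 : 1 < α) (h2 : α < 2) : 0 ≤ w α 0 + w α 2 := by
  have hn := natCast_ne_of_mem h1 h2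
  show 0 ≤ μ₁ α * g α 0 + (μ₁ α * g α 2 + μ₀ α * g α 1 + μm α * g α 0)
  rw [g_succ (k := 1) (sub_ne_zero.2 (hn 1)), g_one hn, g_zero hn]
  unfold μ₁ μ₀ μm
  obtain ⟨p, rfl⟩ : ∃ p, α = 1 + p := ⟨α - 1, by ring⟩
  have hp : 0 < p := by linarith
  push_cast
  have : 0 < 1 - p := by linarith
  ring_nf
  nlinarith [mul_pos hp this, pow_pos hp 3, pow_pos hp 2, pow_pos hp 4]

theorem sum_w {α : ℝ} (h : ∀ k : ℕ, (k : ℝ) ≠ α) (n : ℕ) :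
    ∑ k ∈ Finset.range (n + 3), w α k =
      μ₁ α * g (α - 1) (n + 2) + μ₀ α * g (α - 1) (n + 1) + μm α * g (α - 1) n := by
  rw [← sum_g h, ← sum_g h, ← sum_g h]
  induction n with
  | zero =>
    simp only [Finset.sum_range_succ, Finset.sum_range_zero, w]; ring
  | succ n ih =>
    rw [Finset.sum_range_succ, ih, Finset.sum_range_succ _ (n + 1 + 2),
      Finset.sum_range_succ _ (n + 1 + 1), Finset.sum_range_succ _ (n + 1)]
    simp only [w]; ring

/-- Partial sums of `w` are combinations of three consecutive `g (α - 1)`, which share a nonpositive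
factor. The exception is n = 0, where the positive value `g (α - 1) 0 = 1` takes part. -/
theorem sum_w_nonpos {α : ℝ} (h1 : 1 < α) (h2 : α < 2) (n : ℕ) :
    ∑ k ∈ Finset.range (n + 3), w α k ≤ 0 := by
  have hn := ne_sub_one (natCast_ne_of_mem h1 h2)
  rw [sum_w (natCast_ne_of_mem h1 h2)]
  cases n with
  | zero =>
    have e1 := g_succ (α := α - 1) (k := 1) (sub_ne_zero.2 (hn _))
    rw [show 0 + 2 = 1 + 1 from rfl, e1, show 0 + 1 = 1 from rfl, g_one hn, g_zero hn]
    unfold μ₁ μ₀ μm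
    push_cast
    have : (1 + α) * (2 + α) / 12 * (-(α - 1) * ((1 - (α - 1)) / (1 + 1)))
       + -((-2 + α) * (2 + α) / 6) * (-(α - 1)) + (-2 + α) * (-1 + α) / 12 * 1
       = -((α - 1) * (2 - α) * ((1 + α) * (2 + α) / 24 + (2 + α) / 6 + 1 / 12)) := by ring
    rw [this]
    have := sub_pos.2 h1; have := sub_pos.2 h2
    have : 0 ≤ (α - 1) * (2 - α) * ((1 + α) * (2 + α) / 24 + (2 + α) / 6 + 1 / 12) := by positivity
    linarith
  | succ k =>
    have e1 := g_succ (α := α - 1) (k := k + 2) (sub_ne_zero.2 (hn _))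
    have e2 := g_succ (α := α - 1) (k := k + 1) (sub_ne_zero.2 (hn _))
    rw [show k + 1 + 2 = k + 2 + 1 from rfl, e1, e2]
    have hk : (0 : ℝ) ≤ k := Nat.cast_nonneg k
    have : μ₁ α * (g (α - 1) (k + 1) * (((k + 1 : ℕ) - (α - 1)) / ((k + 1 : ℕ) + 1))
          * (((k + 2 : ℕ) - (α - 1)) / ((k + 2 : ℕ) + 1)))
        + μ₀ α * (g (α - 1) (k + 1) * (((k + 1 : ℕ) - (α - 1)) / ((k + 1 : ℕ) + 1)))
          + μm α * g (α - 1) (k + 1)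
        = g (α - 1) (k + 1) * ((μ₁ α * ((k + 2 - α) * (k + 3 - α)) + μ₀ α * ((k + 2 - α) * (k + 3))
          + μm α * ((k + 2) * (k + 3))) / ((k + 2) * (k + 3))) := by
      push_cast; field_simp; ring
    rw [this]
    refine mul_nonpos_of_nonpos_of_nonneg (g_sub_one_nonpos h1 h2 k) (div_nonneg ?_ (by positivity))
    unfold μ₁ μ₀ μm
    obtain ⟨p, rfl⟩ : ∃ p, α = 1 + p := ⟨α - 1, by ring⟩
    obtain ⟨q, rfl⟩ : ∃ q, p = 1 - q := ⟨1 - p, by ring⟩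
    have hq : 0 < q := by linarith
    have hq' : 0 < 1 - q := by linarith
    have : 0 ≤ (k:ℝ) * q := by positivity
    have : 0 ≤ (k:ℝ) * (1 - q) := by positivity
    ring_nf
    nlinarith [mul_pos hq hq', mul_pos (mul_pos hq hq') hq, mul_pos (mul_pos hq hq') hq', mul_nonneg hk hk, mul_nonneg this hq.le, mul_nonneg this hq'.le, mul_pos (mul_pos (mul_pos hq hq') hq) hq]

end FracDiffusion
namespace FracDiffusion

/-! One-dimensional difference operators on grid functions vanishing at the end points. -/

/-- `v` vanishes at all nodes but the interior ones. -/
noncomputable def IsInterior (M : ℕ) (v : ℕ → ℝ) : Prop := ∀ j, j ∉ Finset.Ioo 0 M → v j = 0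

theorem sum_Ioo_eq_range {M : ℕ} {f : ℕ → ℝ} (h : 0 < M → f 0 = 0) :
    ∑ j ∈ Finset.Ioo 0 M, f j = ∑ j ∈ Finset.range M, f j := by
  apply Finset.sum_subset
  · intro j hj; simp at hj ⊢; omega
  · intro j hj hj'
    have : j = 0 := by simp at hj hj'; omega
    subst this; exact h (by simpa using hj)

/-- By 2xy ≤ x² + y², since a window shifted by `d` sees at most the whole support. -/
theorem autocorrelation_le {M : ℕ} {v : ℕ → ℝ} (hv : ∀ j, M ≤ j → v j = 0) (d : ℕ) :
    ∑ i ∈ Finset.range M, v i * v (i + d) ≤ ∑ i ∈ Finset.range M, v i * v i := by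
  have h1 : ∑ i ∈ Finset.range M, v (i + d) * v (i + d) ≤ ∑ i ∈ Finset.range M, v i * v i := by
    have e1 : ∑ i ∈ Finset.range M, v (i + d) * v (i + d)
        = ∑ i ∈ Finset.Ico d (M + d), v i * v i := by
      rw [Finset.sum_Ico_eq_sum_range]; simp [add_comm]
    have e2 : ∑ i ∈ Finset.range M, v i * v i = ∑ i ∈ Finset.range (M + d), v i * v i := by
      apply Finset.sum_subset
      · intro i hi; simp at hi ⊢; omega
      · intro i _ hi'; rw [hv i (by simpa using hi')]; simp
    rw [e1, e2]
    refine Finset.sum_le_sum_of_subset_of_nonneg ?_ fun i _ _ => mul_self_nonneg _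
    intro i hi; simp at hi ⊢; omega
  have h2 : ∑ i ∈ Finset.range M, v i * v (i + d)
      ≤ ∑ i ∈ Finset.range M, (v i * v i + v (i + d) * v (i + d)) / 2 :=
    Finset.sum_le_sum fun i _ => by nlinarith [sq_nonneg (v i - v (i + d))]
  rw [← Finset.sum_div, Finset.sum_add_distrib] at h2
  linarith

/-- Summed along diagonals, the form is Σ w_k c_{|k-1|} with the autocorrelations c_d of `v`. Lag
zero carries w_1, lag one carries w_0 + w_2 ≥ 0, and the other lags carry weights w_k ≥ 0 with k ≥
3. Replacing every c_d by its upper bound c_0 leaves c_0 times a partial sum of weights, which is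
nonpositive. -/
theorem toeplitz_form_nonpos {α : ℝ} (h1 : 1 < α) (h2 : α < 2) {M : ℕ} {v : ℕ → ℝ}
    (hv : IsInterior M v) :
    ∑ j ∈ Finset.Ioo 0 M, (∑ k ∈ Finset.range (j + 2), w α k * v (j + 1 - k)) * v j ≤ 0 := by
  obtain hM | ⟨n, rfl⟩ : M < 2 ∨ ∃ n, M = n + 2 := by
    rcases lt_or_ge M 2 with h | h
    · exact Or.inl h
    · exact Or.inr ⟨M - 2, by omega⟩
  · rw [show Finset.Ioo 0 M = ∅ by ext j; simp; omega]; simp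
  have hv0 : v 0 = 0 := hv 0 (by simp)
  have hvM : ∀ j, n + 2 ≤ j → v j = 0 := fun j hj => hv j (by simp; omega)
  rw [sum_Ioo_eq_range (fun _ => by simp [hv0])]
  set c : ℕ → ℝ := fun d => ∑ i ∈ Finset.range (n + 2), v i * v (i + d) with hc
  have hle : ∀ d, c d ≤ c 0 := fun d => autocorrelation_le hvM d
  have key : ∑ j ∈ Finset.range (n + 2), (∑ k ∈ Finset.range (j + 2), w α k * v (j + 1 - k)) * v j
      = w α 0 * c 1 + ∑ l ∈ Finset.range (n + 2), w α (l + 1) * c l := by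
    have : ∀ j, (∑ k ∈ Finset.range (j + 2), w α k * v (j + 1 - k)) * v j
        = w α 0 * (v j * v (j + 1))
          + ∑ l ∈ Finset.range (j + 1), w α (l + 1) * (v (j - l) * v (j - l + l)) := by
      intro j
      rw [Finset.sum_range_succ', add_mul, add_comm, Finset.sum_mul]
      congr 1
      · simp; ring
      · refine Finset.sum_congr rfl fun l hl => ?_
        have : l ≤ j := by simp at hl; omega
        rw [show j + 1 - (l + 1) = j - l by omega, show j - l + l = j by omega]; ring
    rw [Finset.sum_congr rfl fun j _ => this j, Finset.sum_add_distrib, ← Finset.mul_sum,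
      Finset.sum_range_diag_flip (n + 2) (fun l i => w α (l + 1) * (v i * v (i + l)))]
    congr 1
    refine Finset.sum_congr rfl fun l _ => ?_
    rw [← Finset.mul_sum]
    congr 1
    apply Finset.sum_subset
    · intro i hi; simp at hi ⊢; omega
    · intro i _ hi'
      rw [hvM (i + l) (by simp at hi'; omega), mul_zero]
  rw [key, Finset.sum_range_succ', Finset.sum_range_succ']
  have hs := sum_w_nonpos h1 h2 n
  rw [Finset.sum_range_succ', Finset.sum_range_succ', Finset.sum_range_succ'] at hs
  have h3 : ∑ k ∈ Finset.range n, w α (k + 1 + 1 + 1) * c (k + 1 + 1)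
      ≤ (∑ k ∈ Finset.range n, w α (k + 1 + 1 + 1)) * c 0 := by
    rw [Finset.sum_mul]
    exact Finset.sum_le_sum fun k _ => mul_le_mul_of_nonneg_left (hle _) (w_nonneg h1 h2 k)
  have h4 := mul_le_mul_of_nonneg_left (hle 1) (w_zero_add_two_nonneg h1 h2)
  have h5 : 0 ≤ c 0 := Finset.sum_nonneg fun i _ => mul_self_nonneg _
  have h6 := mul_nonpos_of_nonpos_of_nonneg hs h5
  simp only [zero_add] at *
  norm_num at *
  linarith

theorem leftD_form_nonpos {α h : ℝ} (h1 : 1 < α) (h2 : α < 2) (hh : 0 ≤ h) {M : ℕ} {v : ℕ → ℝ}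
    (hv : IsInterior M v) : ∑ j ∈ Finset.Ioo 0 M, leftD α h v j * v j ≤ 0 := by
  unfold leftD
  simp only [mul_assoc]
  rw [← Finset.mul_sum]
  exact mul_nonpos_of_nonneg_of_nonpos (by positivity) (toeplitz_form_nonpos h1 h2 hv)

theorem rightD_eq_leftD (α h : ℝ) {M j : ℕ} (v : ℕ → ℝ) (hj : j ∈ Finset.Ioo 0 M) :
    rightD α h M v j = leftD α h (fun i => v (M - i)) (M - j) := by
  unfold rightD leftD
  congr 1
  refine Finset.sum_congr rfl fun k hk => ?_
  simp at hj hk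
  congr 2; omega

theorem rightD_form_nonpos {α h : ℝ} (h1 : 1 < α) (h2 : α < 2) (hh : 0 ≤ h) {M : ℕ} {v : ℕ → ℝ}
    (hv : IsInterior M v) : ∑ j ∈ Finset.Ioo 0 M, rightD α h M v j * v j ≤ 0 := by
  have hv' : IsInterior M fun i => if i ≤ M then v (M - i) else 0 := by
    intro j hj
    simp only
    split_ifs with h
    · exact hv _ (by simp at hj ⊢; omega)
    · rfl
  refine le_of_eq_of_le ?_ (leftD_form_nonpos (h := h) h1 h2 hh hv')
  refine Finset.sum_nbij' (fun j => M - j) (fun j => M - j) ?_ ?_ ?_ ?_ ?_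
  · intro j hj; simp at hj ⊢; omega
  · intro j hj; simp at hj ⊢; omega
  · intro j hj; simp at hj ⊢; omega
  · intro j hj; simp at hj ⊢; omega
  · intro j hj
    rw [rightD_eq_leftD α h v hj]
    simp at hj
    congr 1
    · unfold leftD
      congr 1
      refine Finset.sum_congr rfl fun k hk => ?_
      dsimp only
      rw [if_pos (by omega)]
    · rw [if_pos (by omega), show M - (M - j) = j by omega]

theorem deltaFrac_form_nonpos {α h K₁ K₂ : ℝ} (h1 : 1 < α) (h2 : α < 2) (hh : 0 ≤ h)
    (hK₁ : 0 ≤ K₁) (hK₂ : 0 ≤ K₂) {M : ℕ} {v : ℕ → ℝ} (hv : IsInterior M v) :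
    ∑ j ∈ Finset.Ioo 0 M, deltaFrac α K₁ K₂ h M v j * v j ≤ 0 := by
  have a := mul_nonpos_of_nonneg_of_nonpos hK₁ (leftD_form_nonpos h1 h2 hh hv)
  have b := mul_nonpos_of_nonneg_of_nonpos hK₂ (rightD_form_nonpos h1 h2 hh hv)
  unfold deltaFrac
  simp only [add_mul, mul_assoc]
  rw [Finset.sum_add_distrib, ← Finset.mul_sum, ← Finset.mul_sum]
  linarith

theorem P_eq {α h : ℝ} (hh : h ≠ 0) (v : ℕ → ℝ) (j : ℕ) :
    P α h v j = v j + b₂ α * (v (j - 1) - 2 * v j + v (j + 1)) := by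
  unfold P; field_simp

/-- Summation by parts with sums instead of differences: the second difference is (v_{j-1} + v_j) +
(v_j + v_{j+1}) - 4 v_j. As b₂ > 0 and 4 b₂ ≤ 2/3, both coefficients are nonnegative. This form
gives symmetry and coercivity of `P`, and it persists when the entries are vectors paired by a
semidefinite form. -/
theorem P_form {α h : ℝ} (hh : h ≠ 0) {M : ℕ} {v u : ℕ → ℝ} (hv : IsInterior M v)
    (hu : IsInterior M u) :
    ∑ j ∈ Finset.Ioo 0 M, P α h v j * u j = (1 - 4 * b₂ α) * ∑ j ∈ Finset.Ioo 0 M, v j * u j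
      + b₂ α * ∑ j ∈ Finset.range M, (v j + v (j + 1)) * (u j + u (j + 1)) := by
  have hv0 : v 0 = 0 := hv 0 (by simp)
  have hu0 : u 0 = 0 := hu 0 (by simp)
  have huM : ∀ j, M ≤ j → u j = 0 := fun j hj => hu j (by simp; omega)
  rw [sum_Ioo_eq_range (fun _ => by simp [hu0]), sum_Ioo_eq_range (fun _ => by simp [hu0])]
  have e1 : ∑ j ∈ Finset.range M, (v j + v (j + 1)) * u (j + 1)
      = ∑ j ∈ Finset.range M, (v (j - 1) + v j) * u j := by
    have := Finset.sum_range_succ (fun j => (v (j - 1) + v j) * u j) M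
    rw [Finset.sum_range_succ'] at this
    simp only [huM M le_rfl, hu0, mul_zero, add_zero, Nat.add_sub_cancel] at this
    exact this
  simp only [P_eq hh, mul_add (_ + _), Finset.sum_add_distrib, e1]
  rw [← Finset.sum_add_distrib, Finset.mul_sum, Finset.mul_sum, ← Finset.sum_add_distrib]
  exact Finset.sum_congr rfl fun j _ => by ring

theorem b₂_pos {α : ℝ} (h1 : 1 < α) (h2 : α < 2) : 0 < b₂ α := by unfold b₂; nlinarith

theorem four_mul_b₂_le {α : ℝ} (h1 : 1 < α) : 4 * b₂ α ≤ 2 / 3 := by unfold b₂; nlinarith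

theorem P_congr {α h : ℝ} {M j : ℕ} {v u : ℕ → ℝ} (hj : j ∈ Finset.Ioo 0 M)
    (huv : ∀ i ≤ M, v i = u i) : P α h v j = P α h u j := by
  simp at hj
  unfold P
  rw [huv _ (by omega), huv _ (by omega), huv _ (by omega)]

theorem leftD_congr {α h : ℝ} {M j : ℕ} {v u : ℕ → ℝ} (hj : j ∈ Finset.Ioo 0 M)
    (huv : ∀ i ≤ M, v i = u i) : leftD α h v j = leftD α h u j := by
  simp at hj
  unfold leftD
  congr 1
  exact Finset.sum_congr rfl fun k _ => by rw [huv _ (by omega)]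

theorem rightD_congr {α h : ℝ} {M j : ℕ} {v u : ℕ → ℝ} (hj : j ∈ Finset.Ioo 0 M)
    (huv : ∀ i ≤ M, v i = u i) : rightD α h M v j = rightD α h M u j := by
  simp at hj
  unfold rightD
  congr 1
  refine Finset.sum_congr rfl fun k hk => ?_
  simp at hk
  rw [huv _ (by omega)]

theorem deltaFrac_congr {α h K₁ K₂ : ℝ} {M j : ℕ} {v u : ℕ → ℝ} (hj : j ∈ Finset.Ioo 0 M)
    (huv : ∀ i ≤ M, v i = u i) : deltaFrac α K₁ K₂ h M v j = deltaFrac α K₁ K₂ h M u j := by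
  unfold deltaFrac
  rw [leftD_congr hj huv, rightD_congr hj huv]

/-- `P` at index `j` as a linear functional. -/
noncomputable def Pₗ (α h : ℝ) (j : ℕ) : (ℕ → ℝ) →ₗ[ℝ] ℝ where
  toFun v := P α h v j
  map_add' v u := by simp only [P, Pi.add_apply]; ring
  map_smul' c v := by simp only [P, Pi.smul_apply, smul_eq_mul, RingHom.id_apply]; ring

/-- `deltaFrac` at index `j` as a linear functional. -/
noncomputable def deltaₗ (α K₁ K₂ h : ℝ) (M j : ℕ) : (ℕ → ℝ) →ₗ[ℝ] ℝ where
  toFun v := deltaFrac α K₁ K₂ h M v j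
  map_add' v u := by
    simp only [deltaFrac, leftD, rightD, Pi.add_apply, mul_add, Finset.sum_add_distrib]; ring
  map_smul' c v := by
    simp only [deltaFrac, leftD, rightD, Pi.smul_apply, smul_eq_mul, RingHom.id_apply,
      Finset.mul_sum, mul_add]
    congr 1 <;> exact Finset.sum_congr rfl fun k _ => by ring

/-- `P` is an average with the nonnegative weights b₂, 1 - 2b₂, b₂. -/
theorem abs_P_le {α h B : ℝ} (h1 : 1 < α) (h2 : α < 2) (hh : h ≠ 0) {M j : ℕ} {v : ℕ → ℝ}
    (hj : j ∈ Finset.Ioo 0 M) (hB : ∀ i ≤ M, |v i| ≤ B) : |P α h v j| ≤ B := by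
  simp at hj
  rw [P_eq hh]
  have b0 := b₂_pos h1 h2
  have b1 := four_mul_b₂_le h1
  have e1 := abs_le.1 (hB (j - 1) (by omega))
  have e2 := abs_le.1 (hB j (by omega))
  have e3 := abs_le.1 (hB (j + 1) (by omega))
  rw [abs_le]
  constructor <;> nlinarith

end FracDiffusion
namespace FracDiffusion

/-! Stability of factored Crank-Nicolson schemes. -/

/-- Since P_y Y = A_y E, the factor P_y ± r A_y applied to E equals P_y (E ± rY), so the step is
(P_x - rA_x) P_y W' = (P_x + rA_x) P_y W + R with W' = E' - rY' and W = E + rY. Pairing with W' + W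
controls the energy of W' by that of W, and the sign of P_x A_y returns from W to E - rY. The energy
of E - rY is thus the quantity that propagates from step to step. -/
theorem factored_crankNicolson_step {H : Type*} [AddCommGroup H] [Module ℝ H]
    (ip : H →ₗ[ℝ] H →ₗ[ℝ] ℝ) (Px Py Ax Ay : H →ₗ[ℝ] H) {r κ ρ : ℝ} (hr : 0 ≤ r) (hκ : 0 ≤ κ)
    (hρ : 0 ≤ ρ)
    (symm : ∀ V W, ip (Px (Py V)) W = ip (Px (Py W)) V)
    (coer : ∀ V, ip V V ≤ κ ^ 2 * ip (Px (Py V)) V)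
    (hAx : ∀ V, ip (Ax (Py V)) V ≤ 0) (hAy : ∀ V, ip (Px (Ay V)) V ≤ 0)
    {E E' Y Y' R : H} (hY : Py Y = Ay E) (hY' : Py Y' = Ay E')
    (hR : ∀ W, ip R W ≤ ρ * √(ip W W))
    (step : Px (Py E') - r • Px (Ay E') - r • Ax (Py E') + r ^ 2 • Ax (Ay E')
      = Px (Py E) + r • Px (Ay E) + r • Ax (Py E) + r ^ 2 • Ax (Ay E) + R)
    (hq : ∀ V, 0 ≤ ip (Px (Py V)) V) :
    √(ip (Px (Py (E' - r • Y'))) (E' - r • Y')) ≤ √(ip (Px (Py (E - r • Y))) (E - r • Y)) + κ * ρ := by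
  set q : H → ℝ := fun V => ip (Px (Py V)) V with hqdef
  have hs : ∀ V, √(ip V V) ≤ κ * √(q V) := by
    intro V
    rw [← Real.sqrt_sq hκ, ← Real.sqrt_mul (sq_nonneg κ)]
    exact Real.sqrt_le_sqrt (coer V)
  set W' := E' - r • Y' with hW'
  set W := E + r • Y with hW
  have key : Px (Py (W' - W)) = r • Ax (Py (W' + W)) + R := by
    have : Px (Py W') - r • Ax (Py W') = Px (Py W) + r • Ax (Py W) + R := by
      simp only [hW', hW, map_sub, map_add, map_smul, hY, hY', smul_sub, smul_add, smul_smul]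
      rw [← sq, ← sub_eq_zero] at *
      rw [← step]; abel
    rw [map_sub Py, map_sub Px, map_add Py W' W, map_add Ax, smul_add, ← sub_eq_zero]
    rw [← sub_eq_zero] at this
    rw [← this]; abel
  -- Symmetry turns the energy difference into one pairing with W' + W, the very argument on which
  -- A_x P_y acts in `key`.
  have e1 : q W' - q W = ip (Px (Py (W' - W))) (W' + W) := by
    simp only [hqdef, map_sub, map_add, LinearMap.sub_apply]
    rw [symm W W']; ring
  have e2 : q W' - q W ≤ ρ * (κ * √(q W')) + ρ * (κ * √(q W)) := by
    rw [e1, key]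
    simp only [map_add, map_smul, LinearMap.add_apply, LinearMap.smul_apply, smul_eq_mul]
    have h1 := hAx (W' + W)
    simp only [map_add, LinearMap.add_apply] at h1
    have h2 := mul_nonneg hr (neg_nonneg.2 h1)
    have h3 := (hR W').trans (mul_le_mul_of_nonneg_left (hs W') hρ)
    have h4 := (hR W).trans (mul_le_mul_of_nonneg_left (hs W) hρ)
    linarith
  -- The left side of `e2` factors as the difference times the sum of the roots; arguing by
  -- contradiction avoids dividing by a sum that may vanish.
  have e3 : √(q W') ≤ √(q W) + κ * ρ := by
    have s1 := Real.sq_sqrt (hq W')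
    have s2 := Real.sq_sqrt (hq W)
    have n1 := Real.sqrt_nonneg (q W')
    have n2 := Real.sqrt_nonneg (q W)
    by_contra! hcon
    have : 0 ≤ κ * ρ := mul_nonneg hκ hρ
    change q W' - q W ≤ _ at e2
    change √(q W) + κ * ρ < √(q W') at hcon
    change √(q W') ^ 2 = q W' at s1
    change √(q W) ^ 2 = q W at s2
    nlinarith
  -- The energies of E + rY and E - rY differ only in the cross term, which is 4r⟨P_x A_y E, E⟩ ≤ 0.
  have e4 : q W ≤ q (E - r • Y) := by
    have : q (E - r • Y) - q W = -(4 * r * ip (Px (Ay E)) E) := by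
      simp only [hqdef, hW, map_sub, map_add, map_smul, LinearMap.sub_apply, LinearMap.add_apply,
        LinearMap.smul_apply, smul_eq_mul, hY]
      have := symm E Y
      rw [hY] at this
      rw [this]; ring
    have := mul_nonneg hr (neg_nonneg.2 (hAy E))
    linarith
  exact e3.trans (add_le_add_left (Real.sqrt_le_sqrt e4) _)

/-- The energy of E itself is recovered from that of E - rY: expanding the latter adds -2r⟨P_x A_y
E, E⟩ and r² q(Y), both nonnegative. One factor κ comes from testing the residual, the other from
comparing the norm with the energy. -/
theorem factored_crankNicolson_stability {H : Type*} [AddCommGroup H] [Module ℝ H]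
    (ip : H →ₗ[ℝ] H →ₗ[ℝ] ℝ) (Px Py Ax Ay : H →ₗ[ℝ] H) {r κ ρ : ℝ} (hr : 0 ≤ r) (hκ : 0 ≤ κ)
    (hρ : 0 ≤ ρ)
    (symm : ∀ V W, ip (Px (Py V)) W = ip (Px (Py W)) V)
    (coer : ∀ V, ip V V ≤ κ ^ 2 * ip (Px (Py V)) V)
    (hq : ∀ V, 0 ≤ ip (Px (Py V)) V)
    (hAx : ∀ V, ip (Ax (Py V)) V ≤ 0) (hAy : ∀ V, ip (Px (Ay V)) V ≤ 0)
    (hPy : Function.Surjective Py) {N : ℕ} {E R : ℕ → H} (hE : E 0 = 0)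
    (hR : ∀ n < N, ∀ W, ip (R n) W ≤ ρ * √(ip W W))
    (step : ∀ n < N, Px (Py (E (n + 1))) - r • Px (Ay (E (n + 1))) - r • Ax (Py (E (n + 1)))
        + r ^ 2 • Ax (Ay (E (n + 1)))
      = Px (Py (E n)) + r • Px (Ay (E n)) + r • Ax (Py (E n)) + r ^ 2 • Ax (Ay (E n)) + R n)
    {n : ℕ} (hn : n ≤ N) : √(ip (E n) (E n)) ≤ κ ^ 2 * (n * ρ) := by
  choose G hG using hPy
  -- At time zero the preimage is prescribed to be zero, so that the initial energy vanishes
  -- whatever preimage `G` selects.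
  set Y : ℕ → H := fun n => if n = 0 then 0 else G (Ay (E n)) with hYdef
  have hY : ∀ n, Py (Y n) = Ay (E n) := by
    intro n
    by_cases h : n = 0
    · simp [hYdef, h, hE]
    · simp [hYdef, h, hG]
  have main : ∀ n ≤ N, √(ip (Px (Py (E n - r • Y n))) (E n - r • Y n)) ≤ κ * (n * ρ) := by
    intro n
    induction n with
    | zero => intro _; simp [hYdef, hE]
    | succ n ih =>
      intro h
      have := factored_crankNicolson_step ip Px Py Ax Ay hr hκ hρ symm coer hAx hAy (hY n)
        (hY (n + 1)) (hR n (by omega)) (step n (by omega)) hq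
      have := ih (by omega)
      push_cast
      linarith
  have h1 : ip (Px (Py (E n))) (E n) ≤ ip (Px (Py (E n - r • Y n))) (E n - r • Y n) := by
    have h2 := mul_nonneg hr (neg_nonneg.2 (hAy (E n)))
    have h3 := mul_nonneg (sq_nonneg r) (hq (Y n))
    have := symm (E n) (Y n)
    rw [hY] at this h3
    simp only [map_sub, map_smul, LinearMap.sub_apply, LinearMap.smul_apply, smul_eq_mul, hY, this]
    linarith
  calc √(ip (E n) (E n)) ≤ κ * √(ip (Px (Py (E n))) (E n)) := by
        refine (Real.sqrt_le_sqrt (coer _)).trans_eq ?_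
        rw [Real.sqrt_mul (sq_nonneg κ), Real.sqrt_sq hκ]
    _ ≤ κ * (κ * (n * ρ)) :=
        mul_le_mul_of_nonneg_left ((Real.sqrt_le_sqrt h1).trans (main n hn)) hκ
    _ = κ ^ 2 * (n * ρ) := by ring

/-! Two-dimensional grid functions. -/

/-- Grid functions vanishing off the interior nodes. -/
noncomputable def InteriorGrid (Mx My : ℕ) : Submodule ℝ (ℕ → ℕ → ℝ) where
  carrier := {V | ∀ j s, ¬(j ∈ Finset.Ioo 0 Mx ∧ s ∈ Finset.Ioo 0 My) → V j s = 0}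
  add_mem' h1 h2 j s h := by simp [h1 j s h, h2 j s h]
  zero_mem' := by simp
  smul_mem' c V h j s h' := by simp [h j s h']

theorem InteriorGrid.apply_eq_zero {Mx My : ℕ} (V : InteriorGrid Mx My) {j s : ℕ}
    (h : ¬(j ∈ Finset.Ioo 0 Mx ∧ s ∈ Finset.Ioo 0 My)) : (V : ℕ → ℕ → ℝ) j s = 0 := V.2 j s h

theorem InteriorGrid.isInterior_row {Mx My : ℕ} (V : InteriorGrid Mx My) (j : ℕ) :
    IsInterior My ((V : ℕ → ℕ → ℝ) j) := fun _ hs => InteriorGrid.apply_eq_zero V fun h => hs h.2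

theorem InteriorGrid.isInterior_col {Mx My : ℕ} (V : InteriorGrid Mx My) (s : ℕ) :
    IsInterior Mx (fun j => (V : ℕ → ℕ → ℝ) j s) := fun _ hj => InteriorGrid.apply_eq_zero V fun h => hj h.1

theorem InteriorGrid.row_eq_zero {Mx My : ℕ} (V : InteriorGrid Mx My) {j : ℕ}
    (h : j ∉ Finset.Ioo 0 Mx) : (V : ℕ → ℕ → ℝ) j = 0 := by
  ext s; exact InteriorGrid.apply_eq_zero V fun h' => h h'.1

theorem InteriorGrid.col_eq_zero {Mx My : ℕ} (V : InteriorGrid Mx My) {s : ℕ}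
    (h : s ∉ Finset.Ioo 0 My) : (fun j => (V : ℕ → ℕ → ℝ) j s) = 0 := by
  ext j; exact InteriorGrid.apply_eq_zero V fun h' => h h'.2

/-- Finite dimension turns injectivity of P_y, which follows from coercivity, into the surjectivity
that stability requires. -/
instance (Mx My : ℕ) : FiniteDimensional ℝ (InteriorGrid Mx My) := by
  let f : InteriorGrid Mx My →ₗ[ℝ] (Fin Mx → Fin My → ℝ) :=
    { toFun := fun V j s => (V : ℕ → ℕ → ℝ) j s
      map_add' := fun _ _ => rfl
      map_smul' := fun _ _ => rfl }
  refine FiniteDimensional.of_injective f fun V W h => ?_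
  ext j s
  by_cases hjs : j ∈ Finset.Ioo 0 Mx ∧ s ∈ Finset.Ioo 0 My
  · simp at hjs
    exact congrFun (congrFun h ⟨j, hjs.1.2⟩) ⟨s, hjs.2.2⟩
  · rw [InteriorGrid.apply_eq_zero V hjs, InteriorGrid.apply_eq_zero W hjs]

open Classical in
/-- Restriction of a grid function to the interior nodes. -/
noncomputable def toInterior (Mx My : ℕ) : (ℕ → ℕ → ℝ) →ₗ[ℝ] InteriorGrid Mx My where
  toFun V := ⟨fun j s => if j ∈ Finset.Ioo 0 Mx ∧ s ∈ Finset.Ioo 0 My then V j s else 0,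
    fun j s h => if_neg h⟩
  map_add' V W := by ext j s; simp only [Submodule.coe_add, Pi.add_apply]; split_ifs <;> simp
  map_smul' c V := by
    ext j s
    simp only [Submodule.coe_smul, Pi.smul_apply, RingHom.id_apply]; split_ifs <;> simp

theorem toInterior_apply {Mx My j s : ℕ} (V : ℕ → ℕ → ℝ) (hj : j ∈ Finset.Ioo 0 Mx)
    (hs : s ∈ Finset.Ioo 0 My) : (toInterior Mx My V : ℕ → ℕ → ℝ) j s = V j s := if_pos ⟨hj, hs⟩

/-- A family of functionals acting in the first index. -/
noncomputable def gridX (Mx My : ℕ) (L : ℕ → (ℕ → ℝ) →ₗ[ℝ] ℝ) : InteriorGrid Mx My →ₗ[ℝ] InteriorGrid Mx My :=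
  toInterior Mx My ∘ₗ
    { toFun := fun V j s => L j (fun i => (V : ℕ → ℕ → ℝ) i s)
      map_add' := fun V W => by ext j s; exact map_add (L j) _ _
      map_smul' := fun c V => by ext j s; exact map_smul (L j) _ _ }

/-- A family of functionals acting in the second index. -/
noncomputable def gridY (Mx My : ℕ) (L : ℕ → (ℕ → ℝ) →ₗ[ℝ] ℝ) : InteriorGrid Mx My →ₗ[ℝ] InteriorGrid Mx My :=
  toInterior Mx My ∘ₗ
    { toFun := fun V j s => L s ((V : ℕ → ℕ → ℝ) j)
      map_add' := fun V W => by ext j s; exact map_add (L s) _ _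
      map_smul' := fun c V => by ext j s; exact map_smul (L s) _ _ }

theorem gridX_apply {Mx My j : ℕ} (L : ℕ → (ℕ → ℝ) →ₗ[ℝ] ℝ) (V : InteriorGrid Mx My)
    (hj : j ∈ Finset.Ioo 0 Mx) (s : ℕ) :
    (gridX Mx My L V : ℕ → ℕ → ℝ) j s = L j (fun i => (V : ℕ → ℕ → ℝ) i s) := by
  by_cases hs : s ∈ Finset.Ioo 0 My
  · exact toInterior_apply _ hj hs
  · rw [InteriorGrid.col_eq_zero V hs, map_zero]
    exact InteriorGrid.apply_eq_zero _ fun h => hs h.2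

theorem gridY_apply {Mx My s : ℕ} (L : ℕ → (ℕ → ℝ) →ₗ[ℝ] ℝ) (V : InteriorGrid Mx My) (j : ℕ)
    (hs : s ∈ Finset.Ioo 0 My) :
    (gridY Mx My L V : ℕ → ℕ → ℝ) j s = L s ((V : ℕ → ℕ → ℝ) j) := by
  by_cases hj : j ∈ Finset.Ioo 0 Mx
  · exact toInterior_apply _ hj hs
  · rw [InteriorGrid.row_eq_zero V hj, map_zero]
    exact InteriorGrid.apply_eq_zero _ fun h => hj h.1

/-- The (unscaled) inner product of grid functions. -/
noncomputable def gridIp (Mx My : ℕ) : InteriorGrid Mx My →ₗ[ℝ] InteriorGrid Mx My →ₗ[ℝ] ℝ :=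
  LinearMap.mk₂ ℝ (fun V W => ∑ j ∈ Finset.Ioo 0 Mx, ∑ s ∈ Finset.Ioo 0 My,
      (V : ℕ → ℕ → ℝ) j s * (W : ℕ → ℕ → ℝ) j s)
    (fun V V' W => by simp only [Submodule.coe_add, Pi.add_apply, add_mul, Finset.sum_add_distrib])
    (fun c V W => by
      simp only [Submodule.coe_smul, Pi.smul_apply, smul_eq_mul, mul_assoc, Finset.mul_sum])
    (fun V W W' => by simp only [Submodule.coe_add, Pi.add_apply, mul_add, Finset.sum_add_distrib])
    (fun c V W => by
      simp only [Submodule.coe_smul, Pi.smul_apply, smul_eq_mul, mul_left_comm, Finset.mul_sum])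

theorem gridIp_apply {Mx My : ℕ} (V W : InteriorGrid Mx My) :
    gridIp Mx My V W = ∑ j ∈ Finset.Ioo 0 Mx, ∑ s ∈ Finset.Ioo 0 My,
      (V : ℕ → ℕ → ℝ) j s * (W : ℕ → ℕ → ℝ) j s := rfl

theorem gridIp_symm {Mx My : ℕ} (V W : InteriorGrid Mx My) :
    gridIp Mx My V W = gridIp Mx My W V := by
  simp only [gridIp_apply, mul_comm]

theorem gridIp_self_nonneg {Mx My : ℕ} (V : InteriorGrid Mx My) : 0 ≤ gridIp Mx My V V := by
  rw [gridIp_apply]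
  exact Finset.sum_nonneg fun _ _ => Finset.sum_nonneg fun _ _ => mul_self_nonneg _

theorem gridIp_self_eq_zero {Mx My : ℕ} {V : InteriorGrid Mx My} (h : gridIp Mx My V V = 0) :
    V = 0 := by
  rw [gridIp_apply, Finset.sum_eq_zero_iff_of_nonneg
    fun _ _ => Finset.sum_nonneg fun _ _ => mul_self_nonneg _] at h
  ext j s
  by_cases hjs : j ∈ Finset.Ioo 0 Mx ∧ s ∈ Finset.Ioo 0 My
  · have := (Finset.sum_eq_zero_iff_of_nonneg fun _ _ => mul_self_nonneg _).1 (h j hjs.1) s hjs.2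
    simpa using this
  · simpa using InteriorGrid.apply_eq_zero V hjs

/-- Cauchy–Schwarz, with at most `Mx * My` interior nodes. The factor √(Mx My) is later absorbed by
the scaling √(h_x h_y) of the grid norm. -/
theorem gridIp_le {Mx My : ℕ} {V : InteriorGrid Mx My} {B : ℝ} (hB : 0 ≤ B)
    (hV : ∀ j ∈ Finset.Ioo 0 Mx, ∀ s ∈ Finset.Ioo 0 My, |(V : ℕ → ℕ → ℝ) j s| ≤ B)
    (W : InteriorGrid Mx My) :
    gridIp Mx My V W ≤ √(Mx * My) * B * √(gridIp Mx My W W) := by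
  have h1 : gridIp Mx My V V ≤ Mx * My * B ^ 2 := by
    have : ∀ j ∈ Finset.Ioo 0 Mx, ∑ s ∈ Finset.Ioo 0 My,
        (V : ℕ → ℕ → ℝ) j s * (V : ℕ → ℕ → ℝ) j s ≤ My * B ^ 2 := by
      intro j hj
      have := Finset.sum_le_card_nsmul (Finset.Ioo 0 My)
        (fun s => (V : ℕ → ℕ → ℝ) j s * (V : ℕ → ℕ → ℝ) j s) (B ^ 2) (fun s hs => by
          have := abs_le.1 (hV j hj s hs)
          nlinarith)
      refine this.trans ?_
      rw [nsmul_eq_mul]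
      gcongr
      simp
    refine (Finset.sum_le_card_nsmul _ _ _ this).trans ?_
    rw [nsmul_eq_mul, mul_assoc]
    gcongr
    simp
  have h2 : gridIp Mx My V W ≤ √(gridIp Mx My V V) * √(gridIp Mx My W W) := by
    simp only [gridIp_apply, ← Finset.sum_product']
    have := Real.sum_mul_le_sqrt_mul_sqrt (Finset.Ioo 0 Mx ×ˢ Finset.Ioo 0 My)
      (fun p => (V : ℕ → ℕ → ℝ) p.1 p.2) (fun p => (W : ℕ → ℕ → ℝ) p.1 p.2)
    simpa only [sq] using this
  refine h2.trans ?_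
  gcongr
  calc √(gridIp Mx My V V) ≤ √(Mx * My * B ^ 2) := Real.sqrt_le_sqrt h1
    _ = √(Mx * My) * B := by rw [Real.sqrt_mul (by positivity), Real.sqrt_sq hB]

/-- Applying `P_form` along the first index writes the form as (1 - 4b₂) Σ⟨L V_j, V_j⟩ plus b₂ times
the same sum over V_j + V_{j+1}; each summand inherits the lower bound of L. It serves with c = 1/3
for L = P (coercivity) and with c = 0 for L = -δ (dissipation). -/
theorem tensor_form_le {α h c : ℝ} (h1 : 1 < α) (h2 : α < 2) (hh : h ≠ 0) (hc : 0 ≤ c) {M M' : ℕ}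
    {V : ℕ → ℕ → ℝ} (hrow : ∀ i, IsInterior M' (V i)) (hcol : ∀ s, IsInterior M (fun i => V i s))
    (L : ℕ → (ℕ → ℝ) →ₗ[ℝ] ℝ) (hL : ∀ u, IsInterior M' u →
      c * ∑ s ∈ Finset.Ioo 0 M', u s * u s ≤ ∑ s ∈ Finset.Ioo 0 M', L s u * u s) :
    (1 - 4 * b₂ α) * (c * ∑ j ∈ Finset.Ioo 0 M, ∑ s ∈ Finset.Ioo 0 M', V j s * V j s)
      ≤ ∑ j ∈ Finset.Ioo 0 M, ∑ s ∈ Finset.Ioo 0 M', P α h (fun i => L s (V i)) j * V j s := by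
  have hLcol : ∀ s, IsInterior M fun i => L s (V i) := by
    intro s i hi
    have : V i = 0 := by ext s'; exact hcol s' i hi
    simp [this]
  have key : ∑ j ∈ Finset.Ioo 0 M, ∑ s ∈ Finset.Ioo 0 M', P α h (fun i => L s (V i)) j * V j s
      = (1 - 4 * b₂ α) * ∑ j ∈ Finset.Ioo 0 M, ∑ s ∈ Finset.Ioo 0 M', L s (V j) * V j s
        + b₂ α * ∑ j ∈ Finset.range M, ∑ s ∈ Finset.Ioo 0 M',
          L s (V j + V (j + 1)) * (V j + V (j + 1)) s := by
    rw [Finset.sum_comm, Finset.sum_congr rfl fun s _ => P_form hh (hLcol s) (hcol s),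
      Finset.sum_add_distrib, ← Finset.mul_sum, ← Finset.mul_sum, Finset.sum_comm,
      Finset.sum_comm (s := Finset.Ioo 0 M') (t := Finset.range M)]
    simp only [map_add, Pi.add_apply]
  rw [key]
  have b0 := b₂_pos h1 h2
  have b1 := four_mul_b₂_le h1
  have e1 : c * ∑ j ∈ Finset.Ioo 0 M, ∑ s ∈ Finset.Ioo 0 M', V j s * V j s
      ≤ ∑ j ∈ Finset.Ioo 0 M, ∑ s ∈ Finset.Ioo 0 M', L s (V j) * V j s := by
    rw [Finset.mul_sum]
    exact Finset.sum_le_sum fun j _ => hL _ (hrow j)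
  have e2 : 0 ≤ ∑ j ∈ Finset.range M, ∑ s ∈ Finset.Ioo 0 M',
          L s (V j + V (j + 1)) * (V j + V (j + 1)) s := by
    refine Finset.sum_nonneg fun j _ => le_trans ?_ (hL (V j + V (j + 1)) fun s hs => by
      simp [hrow j s hs, hrow (j + 1) s hs])
    exact mul_nonneg hc (Finset.sum_nonneg fun _ _ => mul_self_nonneg _)
  have := mul_le_mul_of_nonneg_left e1 (show 0 ≤ 1 - 4 * b₂ α by linarith)
  have := mul_nonneg b0.le e2
  linarith

/-- A row of P_x V is a combination of three rows of V, and L is linear on rows. -/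
theorem gridX_P_comm {Mx My : ℕ} (α h : ℝ) (L : ℕ → (ℕ → ℝ) →ₗ[ℝ] ℝ) (V : InteriorGrid Mx My) :
    gridX Mx My (Pₗ α h) (gridY Mx My L V) = gridY Mx My L (gridX Mx My (Pₗ α h) V) := by
  ext j s
  by_cases hjs : j ∈ Finset.Ioo 0 Mx ∧ s ∈ Finset.Ioo 0 My
  · rw [gridX_apply _ _ hjs.1, gridY_apply _ _ _ hjs.2]
    simp only [gridY_apply _ _ _ hjs.2]
    have : (gridX Mx My (Pₗ α h) V : ℕ → ℕ → ℝ) j = (V : ℕ → ℕ → ℝ) j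
        + (h ^ 2 * b₂ α / h ^ 2) • ((V : ℕ → ℕ → ℝ) (j - 1) - (2 : ℝ) • (V : ℕ → ℕ → ℝ) j
          + (V : ℕ → ℕ → ℝ) (j + 1)) := by
      ext s'
      rw [gridX_apply _ _ hjs.1]
      simp only [Pₗ, P, LinearMap.coe_mk, AddHom.coe_mk, Pi.add_apply, Pi.smul_apply, Pi.sub_apply,
        smul_eq_mul]
      ring
    rw [this]
    simp only [map_add, map_sub, map_smul, smul_eq_mul, Pₗ, P, LinearMap.coe_mk, AddHom.coe_mk]
    ring
  · rw [InteriorGrid.apply_eq_zero _ hjs, InteriorGrid.apply_eq_zero _ hjs]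

theorem gridY_P_comm {Mx My : ℕ} (α h : ℝ) (L : ℕ → (ℕ → ℝ) →ₗ[ℝ] ℝ) (V : InteriorGrid Mx My) :
    gridX Mx My L (gridY Mx My (Pₗ α h) V) = gridY Mx My (Pₗ α h) (gridX Mx My L V) := by
  ext j s
  by_cases hjs : j ∈ Finset.Ioo 0 Mx ∧ s ∈ Finset.Ioo 0 My
  · rw [gridX_apply _ _ hjs.1, gridY_apply _ _ _ hjs.2]
    have : (fun i => (gridY Mx My (Pₗ α h) V : ℕ → ℕ → ℝ) i s) = (fun i => (V : ℕ → ℕ → ℝ) i s)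
        + (h ^ 2 * b₂ α / h ^ 2) • ((fun i => (V : ℕ → ℕ → ℝ) i (s - 1))
          - (2 : ℝ) • (fun i => (V : ℕ → ℕ → ℝ) i s) + (fun i => (V : ℕ → ℕ → ℝ) i (s + 1))) := by
      ext i
      rw [gridY_apply _ _ _ hjs.2]
      simp only [Pₗ, P, LinearMap.coe_mk, AddHom.coe_mk, Pi.add_apply, Pi.smul_apply, Pi.sub_apply,
        smul_eq_mul]
      ring
    rw [this]
    simp only [map_add, map_sub, map_smul, smul_eq_mul, Pₗ, P, LinearMap.coe_mk, AddHom.coe_mk,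
      gridX_apply _ _ hjs.1]
    ring
  · rw [InteriorGrid.apply_eq_zero _ hjs, InteriorGrid.apply_eq_zero _ hjs]

/-! ### Symmetry and positivity on the two-dimensional grid, and stability of the scheme. -/

theorem P_form_symm {α h : ℝ} (hh : h ≠ 0) {M : ℕ} {v u : ℕ → ℝ} (hv : IsInterior M v)
    (hu : IsInterior M u) :
    ∑ j ∈ Finset.Ioo 0 M, P α h v j * u j = ∑ j ∈ Finset.Ioo 0 M, v j * P α h u j := by
  have := P_form (α := α) hh hu hv
  simp only [mul_comm (P α h u _)] at this
  rw [P_form hh hv hu, this]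
  simp only [mul_comm]

theorem P_form_ge {α h : ℝ} (h1 : 1 < α) (h2 : α < 2) (hh : h ≠ 0) {M : ℕ} {v : ℕ → ℝ}
    (hv : IsInterior M v) :
    1 / 3 * ∑ j ∈ Finset.Ioo 0 M, v j * v j ≤ ∑ j ∈ Finset.Ioo 0 M, P α h v j * v j := by
  rw [P_form hh hv hv]
  have e1 : 0 ≤ ∑ j ∈ Finset.Ioo 0 M, v j * v j := Finset.sum_nonneg fun _ _ => mul_self_nonneg _
  have e2 : 0 ≤ ∑ j ∈ Finset.range M, (v j + v (j + 1)) * (v j + v (j + 1)) :=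
    Finset.sum_nonneg fun _ _ => mul_self_nonneg _
  have b1 := four_mul_b₂_le h1
  have := mul_nonneg (b₂_pos h1 h2).le e2
  nlinarith

theorem gridX_symm {α h : ℝ} (hh : h ≠ 0) {Mx My : ℕ} (V W : InteriorGrid Mx My) :
    gridIp Mx My (gridX Mx My (Pₗ α h) V) W = gridIp Mx My V (gridX Mx My (Pₗ α h) W) := by
  rw [gridIp_apply, gridIp_apply, Finset.sum_comm,
    Finset.sum_comm (f := fun j s => (V : ℕ → ℕ → ℝ) j s * _)]
  refine Finset.sum_congr rfl fun s _ => ?_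
  refine Eq.trans (Finset.sum_congr rfl fun j hj => by rw [gridX_apply _ _ hj]; rfl) <|
    (P_form_symm (α := α) hh (InteriorGrid.isInterior_col V s) (InteriorGrid.isInterior_col W s)).trans <|
      Finset.sum_congr rfl fun j hj => by rw [gridX_apply _ _ hj]; rfl

theorem gridY_symm {α h : ℝ} (hh : h ≠ 0) {Mx My : ℕ} (V W : InteriorGrid Mx My) :
    gridIp Mx My (gridY Mx My (Pₗ α h) V) W = gridIp Mx My V (gridY Mx My (Pₗ α h) W) := by
  rw [gridIp_apply, gridIp_apply]
  refine Finset.sum_congr rfl fun j _ => ?_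
  refine Eq.trans (Finset.sum_congr rfl fun s hs => by rw [gridY_apply _ _ _ hs]; rfl) <|
    (P_form_symm (α := α) hh (InteriorGrid.isInterior_row V j) (InteriorGrid.isInterior_row W j)).trans <|
      Finset.sum_congr rfl fun s hs => by rw [gridY_apply _ _ _ hs]; rfl

theorem gridX_P_form_ge {α h c : ℝ} (h1 : 1 < α) (h2 : α < 2) (hh : h ≠ 0) (hc : 0 ≤ c)
    {Mx My : ℕ} (L : ℕ → (ℕ → ℝ) →ₗ[ℝ] ℝ) (hL : ∀ u, IsInterior My u →
      c * ∑ s ∈ Finset.Ioo 0 My, u s * u s ≤ ∑ s ∈ Finset.Ioo 0 My, L s u * u s)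
    (V : InteriorGrid Mx My) :
    1 / 3 * (c * gridIp Mx My V V) ≤ gridIp Mx My (gridX Mx My (Pₗ α h) (gridY Mx My L V)) V := by
  have := tensor_form_le h1 h2 hh hc (InteriorGrid.isInterior_row V)
    (InteriorGrid.isInterior_col V) L hL
  have b1 := four_mul_b₂_le h1
  refine le_trans ?_ (this.trans_eq ?_)
  · exact mul_le_mul_of_nonneg_right (by linarith) (mul_nonneg hc (gridIp_self_nonneg V))
  · refine Finset.sum_congr rfl fun j hj => Finset.sum_congr rfl fun s hs => ?_
    rw [gridX_apply _ _ hj]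
    simp only [gridY_apply _ _ _ hs]
    rfl

theorem gridY_P_form_ge {α h c : ℝ} (h1 : 1 < α) (h2 : α < 2) (hh : h ≠ 0) (hc : 0 ≤ c)
    {Mx My : ℕ} (L : ℕ → (ℕ → ℝ) →ₗ[ℝ] ℝ) (hL : ∀ u, IsInterior Mx u →
      c * ∑ s ∈ Finset.Ioo 0 Mx, u s * u s ≤ ∑ s ∈ Finset.Ioo 0 Mx, L s u * u s)
    (V : InteriorGrid Mx My) :
    1 / 3 * (c * gridIp Mx My V V) ≤ gridIp Mx My (gridY Mx My (Pₗ α h) (gridX Mx My L V)) V := by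
  have := tensor_form_le (V := fun s j => (V : ℕ → ℕ → ℝ) j s) h1 h2 hh hc
    (InteriorGrid.isInterior_col V) (InteriorGrid.isInterior_row V) L hL
  have b1 := four_mul_b₂_le h1
  refine le_trans ?_ (this.trans_eq ?_)
  · rw [Finset.sum_comm]
    exact mul_le_mul_of_nonneg_right (by linarith) (mul_nonneg hc (gridIp_self_nonneg V))
  · rw [gridIp_apply, Finset.sum_comm]
    refine Finset.sum_congr rfl fun j hj => Finset.sum_congr rfl fun s hs => ?_
    rw [gridY_apply _ _ _ ‹_›]
    have : (gridX Mx My L V : ℕ → ℕ → ℝ) j = fun s => L j (fun i => (V : ℕ → ℕ → ℝ) i s) := by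
      ext s; rw [gridX_apply _ _ ‹_›]
    rw [this]
    rfl

/-- The abstract stability theorem with κ = 3: each averaging operator is bounded below by 1/3, so
the energy is at least 1/9 of the squared norm. -/
theorem scheme_stability {α β hx hy r Kx₁ Kx₂ Ky₁ Ky₂ ρ : ℝ} (hα₁ : 1 < α) (hα₂ : α < 2)
    (hβ₁ : 1 < β) (hβ₂ : β < 2) (hhx : 0 < hx) (hhy : 0 < hy) (hr : 0 ≤ r) (hKx₁ : 0 ≤ Kx₁)
    (hKx₂ : 0 ≤ Kx₂) (hKy₁ : 0 ≤ Ky₁) (hKy₂ : 0 ≤ Ky₂) (hρ : 0 ≤ ρ) {Mx My N : ℕ}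
    {E R : ℕ → InteriorGrid Mx My} (hE : E 0 = 0)
    (hR : ∀ n < N, ∀ j ∈ Finset.Ioo 0 Mx, ∀ s ∈ Finset.Ioo 0 My,
      |(R n : ℕ → ℕ → ℝ) j s| ≤ ρ)
    {Px Py Ax Ay : InteriorGrid Mx My →ₗ[ℝ] InteriorGrid Mx My}
    (hPx : Px = gridX Mx My (Pₗ α hx)) (hPy : Py = gridY Mx My (Pₗ β hy))
    (hAx : Ax = gridX Mx My (deltaₗ α Kx₁ Kx₂ hx Mx))
    (hAy : Ay = gridY Mx My (deltaₗ β Ky₁ Ky₂ hy My))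
    (step : ∀ n < N, Px (Py (E (n + 1))) - r • Px (Ay (E (n + 1))) - r • Ax (Py (E (n + 1)))
        + r ^ 2 • Ax (Ay (E (n + 1)))
      = Px (Py (E n)) + r • Px (Ay (E n)) + r • Ax (Py (E n)) + r ^ 2 • Ax (Ay (E n)) + R n)
    {n : ℕ} (hn : n ≤ N) :
    √(gridIp Mx My (E n) (E n)) ≤ 3 ^ 2 * (n * (√(Mx * My) * ρ)) := by
  have coer : ∀ V, gridIp Mx My V V ≤ 3 ^ 2 * gridIp Mx My (Px (Py V)) V := by
    intro V
    have := gridX_P_form_ge hα₁ hα₂ hhx.ne' (c := 1 / 3) (by norm_num) (Pₗ β hy)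
      (fun u hu => P_form_ge hβ₁ hβ₂ hhy.ne' hu) V
    rw [hPx, hPy]; linarith
  have hq : ∀ V, 0 ≤ gridIp Mx My (Px (Py V)) V := fun V => by
    have := coer V; have := gridIp_self_nonneg V; linarith
  refine factored_crankNicolson_stability (gridIp Mx My) Px Py Ax Ay hr (by norm_num)
    (by positivity) ?_ coer hq ?_ ?_ ?_ hE
    (fun n hn W => gridIp_le hρ (hR n hn) W) step hn
  · intro V W
    rw [hPx, hPy, gridX_symm hhx.ne', gridY_symm hhy.ne', ← gridX_P_comm, gridIp_symm]
  · intro V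
    -- A_x and P_y are exchanged so that the averaging operator is outermost, as the tensor estimate
    -- requires; it is then applied to -δ_x with c = 0.
    rw [hAx, hPy, gridY_P_comm]
    have := gridY_P_form_ge hβ₁ hβ₂ hhy.ne' (c := 0) le_rfl (fun j => -deltaₗ α Kx₁ Kx₂ hx Mx j)
      (fun u hu => by
        have := deltaFrac_form_nonpos hα₁ hα₂ hhx.le hKx₁ hKx₂ hu
        simp only [LinearMap.neg_apply, neg_mul, Finset.sum_neg_distrib, zero_mul]
        exact neg_nonneg.2 this) V
    have e : gridX Mx My (fun j => -deltaₗ α Kx₁ Kx₂ hx Mx j)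
        = -gridX Mx My (deltaₗ α Kx₁ Kx₂ hx Mx) := by
      ext V j s
      by_cases hjs : j ∈ Finset.Ioo 0 Mx ∧ s ∈ Finset.Ioo 0 My
      · have e1 := gridX_apply (My := My) (fun j => -deltaₗ α Kx₁ Kx₂ hx Mx j) V hjs.1 s
        have e2 := gridX_apply (My := My) (deltaₗ α Kx₁ Kx₂ hx Mx) V hjs.1 s
        rw [e1]
        simp only [LinearMap.neg_apply, Submodule.coe_neg, Pi.neg_apply]
        rw [e2]
      · rw [InteriorGrid.apply_eq_zero _ hjs, InteriorGrid.apply_eq_zero _ hjs]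
    rw [e] at this
    simp only [LinearMap.neg_apply, map_neg] at this
    linarith
  · intro V
    rw [hPx, hAy]
    have := gridX_P_form_ge hα₁ hα₂ hhx.ne' (c := 0) le_rfl (fun j => -deltaₗ β Ky₁ Ky₂ hy My j)
      (fun u hu => by
        have := deltaFrac_form_nonpos hβ₁ hβ₂ hhy.le hKy₁ hKy₂ hu
        simp only [LinearMap.neg_apply, neg_mul, Finset.sum_neg_distrib, zero_mul]
        exact neg_nonneg.2 this) V
    have e : gridY Mx My (fun j => -deltaₗ β Ky₁ Ky₂ hy My j)
        = -gridY Mx My (deltaₗ β Ky₁ Ky₂ hy My) := by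
      ext V j s
      by_cases hjs : j ∈ Finset.Ioo 0 Mx ∧ s ∈ Finset.Ioo 0 My
      · have e1 := gridY_apply (Mx := Mx) (fun j => -deltaₗ β Ky₁ Ky₂ hy My j) V j hjs.2
        have e2 := gridY_apply (Mx := Mx) (deltaₗ β Ky₁ Ky₂ hy My) V j hjs.2
        rw [e1]
        simp only [LinearMap.neg_apply, Submodule.coe_neg, Pi.neg_apply]
        rw [e2]
      · rw [InteriorGrid.apply_eq_zero _ hjs, InteriorGrid.apply_eq_zero _ hjs]
    rw [e] at this
    simp only [LinearMap.neg_apply, map_neg] at this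
    linarith
  · refine LinearMap.surjective_of_injective ((injective_iff_map_eq_zero Py).2 fun V hV => ?_)
    apply gridIp_self_eq_zero
    have := coer V
    rw [hV] at this
    simp only [map_zero, LinearMap.zero_apply, mul_zero] at this
    exact le_antisymm this (gridIp_self_nonneg V)

end FracDiffusion
namespace FracDiffusion

/-! Asymptotics of a quotient of Gamma functions. -/

/-- The expression is odd, so degree-four Taylor polynomials of the two logarithms leave only x and
x³; each remainder is at most 2|x|⁵ because 1 - |x| ≥ 1/2. -/
theorem abs_log_sub_log_le {x : ℝ} (hx : |x| ≤ 1 / 2) :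
    |Real.log (1 + x) - Real.log (1 - x) - 2 * x - 2 / 3 * x ^ 3| ≤ 4 * |x| ^ 5 := by
  have h1 := Real.abs_log_sub_add_sum_range_le (x := x) (by linarith) 4
  have h2 := Real.abs_log_sub_add_sum_range_le (x := -x) (by rw [abs_neg]; linarith) 4
  rw [abs_neg] at h2
  have h3 : |x| ^ (4 + 1) / (1 - |x|) ≤ 2 * |x| ^ 5 := by
    rw [div_le_iff₀ (by linarith)]
    have : 0 ≤ |x| ^ 5 := by positivity
    norm_num
    nlinarith
  have h4 := abs_le.1 (h1.trans h3)
  have h5 := abs_le.1 (h2.trans h3)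
  simp only [Finset.sum_range_succ, Finset.sum_range_zero] at h4 h5
  norm_num at h4 h5
  rw [abs_le]
  constructor
  · ring_nf at h4 h5 ⊢
    linarith [h4.1, h4.2, h5.1, h5.2]
  · ring_nf at h4 h5 ⊢
    linarith [h4.1, h4.2, h5.1, h5.2]

/-- For n ≥ 2 the decrement of 8C/n⁴ dominates C/n⁵. Hence a + 8C/n⁴ decreases to zero and a - 8C/n⁴
increases to zero. -/
theorem abs_le_of_abs_diff_le {a : ℕ → ℝ} {C : ℝ} (h0 : Filter.Tendsto a Filter.atTop (nhds 0))
    (h : ∀ n : ℕ, 2 ≤ n → |a (n + 1) - a n| ≤ C / (n : ℝ) ^ 5) {n : ℕ} (hn : 2 ≤ n) :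
    |a n| ≤ 8 * C / (n : ℝ) ^ 4 := by
  have hC : 0 ≤ C := by
    have := (abs_nonneg _).trans (h 2 le_rfl)
    by_contra! hc
    have := div_neg_of_neg_of_pos hc (show (0:ℝ) < ((2:ℕ):ℝ) ^ 5 by positivity)
    linarith
  have hd : ∀ n : ℕ, 2 ≤ n → C / (n : ℝ) ^ 5 ≤ 8 * C / (n : ℝ) ^ 4 - 8 * C / ((n + 1 : ℕ) : ℝ) ^ 4 := by
    intro n hn
    have hn' : (2 : ℝ) ≤ n := by exact_mod_cast hn
    have : 1 / (n : ℝ) ^ 5 ≤ 8 / (n : ℝ) ^ 4 - 8 / ((n : ℝ) + 1) ^ 4 := by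
      have h1 : 8 / (n : ℝ) ^ 4 - 8 / ((n : ℝ) + 1) ^ 4 - 1 / (n : ℝ) ^ 5
          = (8 * n * (4 * (n : ℝ) ^ 3 + 6 * n ^ 2 + 4 * n + 1) - (n + 1) ^ 4)
            / ((n : ℝ) ^ 5 * (n + 1) ^ 4) := by
        field_simp; ring
      have h2 : 0 ≤ 8 * n * (4 * (n : ℝ) ^ 3 + 6 * n ^ 2 + 4 * n + 1) - (n + 1) ^ 4 := by
        obtain ⟨m, hm⟩ : ∃ m, (n : ℝ) = m + 2 := ⟨n - 2, by ring⟩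
        have hm0 : 0 ≤ m := by linarith
        rw [hm]; ring_nf; positivity
      have := div_nonneg h2 (show 0 ≤ (n : ℝ) ^ 5 * (n + 1) ^ 4 by positivity)
      linarith
    have := mul_le_mul_of_nonneg_left this hC
    push_cast
    calc C / (n : ℝ) ^ 5 = C * (1 / (n : ℝ) ^ 5) := by ring
      _ ≤ _ := this
      _ = _ := by ring
  have lim : Filter.Tendsto (fun n : ℕ => 8 * C / ((n + 2 : ℕ) : ℝ) ^ 4) Filter.atTop (nhds 0) := by
    have := (tendsto_const_div_pow (8 * C) 4 (by norm_num)).comp (Filter.tendsto_add_atTop_nat 2)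
    exact this.comp tendsto_natCast_atTop_atTop |>.congr fun n => by simp
  have ha := (Filter.tendsto_add_atTop_iff_nat 2).2 h0
  obtain ⟨m, rfl⟩ := Nat.exists_eq_add_of_le' hn
  rw [abs_le]
  constructor
  · have anti : Antitone fun n : ℕ => a (n + 2) + 8 * C / ((n + 2 : ℕ) : ℝ) ^ 4 := by
      refine antitone_nat_of_succ_le fun n => ?_
      have h1 := (abs_le.1 (h (n + 2) (by omega))).2
      have h2 := hd (n + 2) (by omega)
      rw [show n + 1 + 2 = n + 2 + 1 by ring]
      linarith
    have := anti.le_of_tendsto (by simpa using ha.add lim) m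
    linarith
  · have mono : Monotone fun n : ℕ => a (n + 2) - 8 * C / ((n + 2 : ℕ) : ℝ) ^ 4 := by
      refine monotone_nat_of_le_succ fun n => ?_
      have h1 := (abs_le.1 (h (n + 2) (by omega))).1
      have h2 := hd (n + 2) (by omega)
      rw [show n + 1 + 2 = n + 2 + 1 by ring]
      linarith
    have := mono.ge_of_tendsto (by simpa using ha.sub lim) m
    linarith

theorem Gamma_add_natCast {s : ℝ} (hs : 0 < s) (n : ℕ) :
    Real.Gamma (s + n) = Real.Gamma s * ∏ j ∈ Finset.range n, (s + j) := by
  induction n with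
  | zero => simp
  | succ n ih =>
    rw [Finset.prod_range_succ, ← mul_assoc, ← ih, Nat.cast_succ, ← add_assoc,
      Real.Gamma_add_one (by positivity), mul_comm]

/-- Euler's limit formula for Γ(2 - α), whose argument is positive. It produces Γ(n + 3 - α), and
the two surplus factors n + 1 - α and n + 2 - α have logarithms log n + o(1). -/
theorem tendsto_log_Gamma_ratio {α : ℝ} (h2 : α < 2) :
    Filter.Tendsto (fun n : ℕ => Real.log (Real.Gamma (n + 1 - α)) - Real.log (Real.Gamma n)
      - (1 - α) * Real.log n) Filter.atTop (nhds 0) := by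
  have hs : 0 < 2 - α := by linarith
  have hG := Real.Gamma_pos_of_pos hs
  have t1 : Filter.Tendsto (fun n : ℕ => Real.log (Real.GammaSeq (2 - α) n)
      - Real.log (Real.Gamma (2 - α))) Filter.atTop (nhds 0) := by
    have := ((Real.continuousAt_log hG.ne').tendsto.comp (Real.GammaSeq_tendsto_Gamma (2 - α)))
    simpa using this.sub_const (Real.log (Real.Gamma (2 - α)))
  have t2 : ∀ c : ℝ, Filter.Tendsto (fun n : ℕ => Real.log (n + c) - Real.log n)
      Filter.atTop (nhds 0) := fun c =>
    (Real.tendsto_log_comp_add_sub_log c).comp tendsto_natCast_atTop_atTop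
  have t3 := (t1.neg.sub (t2 (1 - α))).sub (t2 (2 - α))
  simp only [neg_zero, sub_zero] at t3
  refine t3.congr' ?_
  filter_upwards [Filter.eventually_ge_atTop 2] with n hn
  have hn' : (2 : ℝ) ≤ n := by exact_mod_cast hn
  have hpos : 0 < (n : ℝ) + 1 - α := by linarith
  have e1 : Real.GammaSeq (2 - α) n
      = (n : ℝ) ^ (2 - α) * Real.Gamma (n + 1) / (Real.Gamma (n + 3 - α) / Real.Gamma (2 - α)) := by
    unfold Real.GammaSeq
    rw [Real.Gamma_nat_eq_factorial, show (n : ℝ) + 3 - α = (2 - α) + (n + 1 : ℕ) by push_cast; ring,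
      Gamma_add_natCast hs]
    field_simp
  have e2 : Real.Gamma (n + 3 - α) = (n + 2 - α) * ((n + 1 - α) * Real.Gamma (n + 1 - α)) := by
    rw [show (n : ℝ) + 3 - α = (n + 2 - α) + 1 by ring, Real.Gamma_add_one (by linarith),
      show (n : ℝ) + 2 - α = (n + 1 - α) + 1 by ring, Real.Gamma_add_one hpos.ne']
  have p1 := Real.Gamma_pos_of_pos hpos
  have p2 := Real.Gamma_pos_of_pos (show 0 < (n : ℝ) by linarith)
  have p3 : 0 < (n : ℝ) + 2 - α := by linarith
  rw [e1, e2, Real.Gamma_add_one (by linarith), Real.log_div (by positivity) (by positivity),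
    Real.log_div (by positivity) (by positivity), Real.log_mul (by positivity) (by positivity),
    Real.log_mul (by positivity) (by positivity), Real.log_mul (by positivity) (by positivity),
    Real.log_mul (by positivity) (by positivity), Real.log_rpow (by linarith),
    show (n : ℝ) + (1 - α) = n + 1 - α by ring, show (n : ℝ) + (2 - α) = n + 2 - α by ring]
  ring

/-- The second coefficient in the asymptotics of `Γ(n+1-α)/Γ(n)`. -/
noncomputable def gammaCoeff (α : ℝ) : ℝ := (1 - α) / 24 - ((1 - α) / 2) ^ 3 / 3

/-- The remainder of the logarithmic asymptotics of `Γ(n+1-α)/Γ(n)`. -/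
noncomputable def logGammaRem (α : ℝ) (n : ℕ) : ℝ :=
  Real.log (Real.Gamma (n + 1 - α)) - Real.log (Real.Gamma n)
    - (1 - α) * Real.log (n - α / 2) - gammaCoeff α / (n - α / 2) ^ 2

theorem tendsto_logGammaRem {α : ℝ} (h2 : α < 2) :
    Filter.Tendsto (logGammaRem α) Filter.atTop (nhds 0) := by
  have t1 := tendsto_log_Gamma_ratio h2
  have t2 : Filter.Tendsto (fun n : ℕ => Real.log (n + -(α / 2)) - Real.log n)
      Filter.atTop (nhds 0) :=
    (Real.tendsto_log_comp_add_sub_log _).comp tendsto_natCast_atTop_atTop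
  have t4 : Filter.Tendsto (fun n : ℕ => (n : ℝ) + -(α / 2)) Filter.atTop Filter.atTop :=
    Filter.tendsto_atTop_add_const_right _ _ tendsto_natCast_atTop_atTop
  have t3 : Filter.Tendsto (fun x : ℝ => gammaCoeff α / x ^ 2) Filter.atTop (nhds 0) :=
    Filter.Tendsto.const_div_atTop (Filter.tendsto_pow_atTop (by norm_num)) _
  have := (t1.sub (t2.const_mul (1 - α))).sub (t3.comp t4)
  simp only [mul_zero, sub_zero] at this
  refine this.congr fun n => ?_
  simp only [logGammaRem, ← sub_eq_add_neg, Function.comp_apply]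
  ring

theorem inv_sq_diff {W : ℝ} (hW : 3 / 2 ≤ W) :
    |1 / (W + 1 / 2) ^ 2 - 1 / (W - 1 / 2) ^ 2 + 2 / W ^ 3| ≤ 2 / W ^ 5 := by
  have hWp : 0 < W := by linarith
  have hW2 : 0 < W ^ 2 - 1 / 4 := by nlinarith
  have e4 : 1 / (W + 1 / 2) ^ 2 - 1 / (W - 1 / 2) ^ 2 + 2 / W ^ 3
      = -((W ^ 2 - 1 / 8) / (W ^ 3 * (W ^ 2 - 1 / 4) ^ 2)) := by
    obtain ⟨p, hp⟩ : ∃ p, p = W + 1 / 2 := ⟨_, rfl⟩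
    obtain ⟨q, hq⟩ : ∃ q, q = W - 1 / 2 := ⟨_, rfl⟩
    have a1 : p ≠ 0 := by linarith
    have a2 : q ≠ 0 := by linarith
    have a3 : W ^ 2 - 1 / 4 = p * q := by rw [hp, hq]; ring
    rw [a3, ← hp, ← hq, div_sub_div _ _ (pow_ne_zero 2 a1) (pow_ne_zero 2 a2),
      div_add_div _ _ (by positivity) (by positivity), ← neg_div,
      div_eq_div_iff (by positivity) (by positivity), hp, hq]
    ring
  have e5 : 0 ≤ (W ^ 2 - 1 / 8) / (W ^ 3 * (W ^ 2 - 1 / 4) ^ 2) := by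
    apply div_nonneg (by nlinarith) (by positivity)
  rw [e4, abs_neg, abs_of_nonneg e5, div_le_div_iff₀ (by positivity) (by positivity)]
  have : (W ^ 2 - 1 / 8) * W ^ 2 ≤ 2 * (W ^ 2 - 1 / 4) ^ 2 := by
    nlinarith [pow_le_pow_left₀ (by norm_num) hW 2]
  calc (W ^ 2 - 1 / 8) * W ^ 5 = ((W ^ 2 - 1 / 8) * W ^ 2) * W ^ 3 := by ring
    _ ≤ 2 * (W ^ 2 - 1 / 4) ^ 2 * W ^ 3 := by gcongr
    _ = _ := by ring

theorem log_add_sub_log_sub {c W : ℝ} (hc : |c| ≤ 1 / 2) (hW : 3 / 2 ≤ W) :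
    |Real.log (W + c) - Real.log (W - c) - 2 * (c / W) - 2 / 3 * (c / W) ^ 3|
      ≤ 1 / 8 / W ^ 5 := by
  have hWp : 0 < W := by linarith
  have hcW : |c / W| ≤ 1 / 2 := by
    rw [abs_div, abs_of_pos hWp, div_le_iff₀ hWp]; nlinarith
  have hc' := abs_le.1 hc
  have := abs_log_sub_log_le hcW
  rw [show 1 + c / W = (W + c) / W by field_simp, show 1 - c / W = (W - c) / W by field_simp,
    Real.log_div (by linarith) hWp.ne', Real.log_div (by linarith) hWp.ne'] at this
  have e : 4 * |c / W| ^ 5 ≤ 1 / 8 / W ^ 5 := by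
    rw [abs_div, abs_of_pos hWp, div_pow, ← mul_div_assoc]
    have := pow_le_pow_left₀ (abs_nonneg c) hc 5
    gcongr
    linarith
  refine le_trans (le_of_eq ?_) (this.trans e)
  congr 1; ring

/-- Centring at W = n + (1 - α)/2 puts n and n + 1 - α at W ∓ δ, and the arguments n - α/2 and n + 1
- α/2 at W ∓ 1/2. All differences are then odd in W, and even powers of 1/W are absent. -/
theorem logGammaRem_diff_eq {α : ℝ} (h1 : 1 < α) (h2 : α < 2) {n : ℕ} (hn : 2 ≤ n) {δ W : ℝ}
    (hα : α = 1 - 2 * δ) (hnW : (n : ℝ) = W - δ) :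
    logGammaRem α (n + 1) - logGammaRem α n
      = Real.log (W + δ) - Real.log (W - δ)
        - 2 * δ * (Real.log (W + 1 / 2) - Real.log (W - 1 / 2))
        - gammaCoeff α * (1 / (W + 1 / 2) ^ 2 - 1 / (W - 1 / 2) ^ 2) := by
  have hn' : (2 : ℝ) ≤ n := by exact_mod_cast hn
  have e1 : Real.Gamma ((n + 1 : ℕ) + 1 - α) = (W + δ) * Real.Gamma (n + 1 - α) := by
    rw [show ((n + 1 : ℕ) : ℝ) + 1 - α = (n + 1 - α) + 1 by push_cast; ring,
      Real.Gamma_add_one (by linarith)]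
    congr 1; linarith
  have e2 : Real.Gamma ((n + 1 : ℕ) : ℝ) = (W - δ) * Real.Gamma n := by
    rw [Nat.cast_succ, Real.Gamma_add_one (by linarith), hnW]
  have p1 := Real.Gamma_pos_of_pos (show 0 < (n : ℝ) + 1 - α by linarith)
  have p2 := Real.Gamma_pos_of_pos (show 0 < (n : ℝ) by linarith)
  unfold logGammaRem
  rw [e1, e2, Real.log_mul (by linarith) p1.ne', Real.log_mul (by linarith) p2.ne',
    show ((n + 1 : ℕ) : ℝ) - α / 2 = W + 1 / 2 by push_cast; linarith,
    show (n : ℝ) - α / 2 = W - 1 / 2 by linarith, show 1 - α = 2 * δ by linarith]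
  ring

theorem logGammaRem_diff {α : ℝ} (h1 : 1 < α) (h2 : α < 2) {n : ℕ} (hn : 2 ≤ n) :
    |logGammaRem α (n + 1) - logGammaRem α n| ≤ 400 / (n : ℝ) ^ 5 := by
  have hn' : (2 : ℝ) ≤ n := by exact_mod_cast hn
  obtain ⟨δ, hδ⟩ : ∃ δ, δ = (1 - α) / 2 := ⟨_, rfl⟩
  obtain ⟨W, hW⟩ : ∃ W, W = (n : ℝ) + δ := ⟨_, rfl⟩
  have hα : α = 1 - 2 * δ := by linarith
  have d1 : -(1 / 2) < δ := by linarith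
  have d2 : δ < 0 := by linarith
  have hW1 : (n : ℝ) / 2 ≤ W := by linarith
  have hW0' : 3 / 2 ≤ W := by linarith
  have hWp : 0 < W := by linarith
  have l1 := log_add_sub_log_sub (c := δ) (by rw [abs_le]; constructor <;> linarith) hW0'
  have l2 := log_add_sub_log_sub (c := 1 / 2) (by norm_num) hW0'
  have l3 := inv_sq_diff hW0'
  have g1 : gammaCoeff α = δ / 12 - δ ^ 3 / 3 := by unfold gammaCoeff; rw [hα]; ring
  have g2 : |gammaCoeff α| ≤ 1 := by
    rw [g1, abs_le]; constructor <;> nlinarith [pow_pos (neg_pos.2 d2) 2, pow_pos (neg_pos.2 d2) 3]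
  -- From W ≥ n/2 one gets 3/W⁵ ≤ 96/n⁵; 400 is a generous round number.
  have g4 : 3 / W ^ 5 ≤ 400 / (n : ℝ) ^ 5 := by
    rw [div_le_div_iff₀ (by positivity) (by positivity)]
    have := pow_le_pow_left₀ (by positivity) hW1 5
    rw [div_pow] at this
    linarith [pow_pos hWp 5]
  refine le_trans ?_ g4
  rw [logGammaRem_diff_eq (W := W) h1 h2 hn hα (by linarith)]
  -- The 1/W terms cancel identically, and `gammaCoeff` is the value for which the 1/W³ terms cancel
  -- too. Only O(W⁻⁵) remains.
  have main : 2 * (δ / W) + 2 / 3 * (δ / W) ^ 3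
      - 2 * δ * (2 * (1 / 2 / W) + 2 / 3 * (1 / 2 / W) ^ 3) + gammaCoeff α * (2 / W ^ 3) = 0 := by
    rw [g1]; field_simp; ring
  generalize Real.log (W + δ) - Real.log (W - δ) = A at *
  generalize Real.log (W + 1 / 2) - Real.log (W - 1 / 2) = B at *
  generalize 1 / (W + 1 / 2) ^ 2 - 1 / (W - 1 / 2) ^ 2 = Q at *
  have split : A - 2 * δ * B - gammaCoeff α * Q = (A - 2 * (δ / W) - 2 / 3 * (δ / W) ^ 3)
      + (-(2 * δ)) * (B - 2 * (1 / 2 / W) - 2 / 3 * (1 / 2 / W) ^ 3)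
      + (-gammaCoeff α) * (Q + 2 / W ^ 3) := by
    linear_combination main
  rw [split]
  have m2 : |(-(2 * δ)) * (B - 2 * (1 / 2 / W) - 2 / 3 * (1 / 2 / W) ^ 3)| ≤ 1 / 8 / W ^ 5 := by
    rw [abs_mul]
    have : |-(2 * δ)| ≤ 1 := by rw [abs_le]; constructor <;> linarith
    exact (mul_le_of_le_one_left (abs_nonneg _) this).trans l2
  have m3 : |(-gammaCoeff α) * (Q + 2 / W ^ 3)| ≤ 2 / W ^ 5 := by
    rw [abs_mul, abs_neg]
    exact (mul_le_of_le_one_left (abs_nonneg _) g2).trans l3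
  have m4 : 1 / 8 / W ^ 5 + 1 / 8 / W ^ 5 + 2 / W ^ 5 ≤ 3 / W ^ 5 := by
    rw [← add_div, ← add_div]
    gcongr
    norm_num
  exact ((abs_add_le _ _).trans (add_le_add ((abs_add_le _ _).trans (add_le_add l1 m2)) m3)).trans m4

theorem abs_exp_sub_one_sub_le {x X : ℝ} (hX : 0 ≤ X) (hx : |x| ≤ X) :
    |Real.exp x - 1 - x| ≤ (Real.exp X + 1 + X) * x ^ 2 := by
  rcases le_or_gt |x| 1 with h | h
  · refine (Real.abs_exp_sub_one_sub_id_le h).trans ?_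
    have := Real.exp_pos X
    nlinarith [sq_nonneg x]
  · have h1 : |Real.exp x - 1 - x| ≤ Real.exp X + 1 + X := by
      have := Real.exp_le_exp.2 ((le_abs_self x).trans hx)
      have := Real.exp_pos x
      have := abs_le.1 hx
      rw [abs_le]; constructor <;> linarith
    have h2 : 1 ≤ x ^ 2 := by rw [← sq_abs]; nlinarith
    have := Real.exp_pos X
    nlinarith

/-- Exponential of the logarithmic expansion. The quadratic term of the exponential is of order Z⁻⁴
and joins the remainder, of which only boundedness of ε is recorded. -/
theorem exists_Gamma_ratio_expansion {α : ℝ} (h1 : 1 < α) (h2 : α < 2) :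
    ∃ C : ℝ, 0 ≤ C ∧ ∀ n : ℕ, 1 ≤ n → ∃ ε, |ε| ≤ C ∧ Real.Gamma (n + 1 - α) / Real.Gamma n
      = ((n : ℝ) - α / 2) ^ (1 - α)
        * (1 + gammaCoeff α / ((n : ℝ) - α / 2) ^ 2 + ε / ((n : ℝ) - α / 2) ^ 4) := by
  obtain ⟨D, hD, hD'⟩ : ∃ D : ℝ, 0 ≤ D ∧ ∀ n : ℕ, 1 ≤ n →
      |logGammaRem α n| ≤ D / ((n : ℝ) - α / 2) ^ 4 := by
    -- The first entry comes from summing the O(n⁻⁵) differences, valid for n ≥ 2; the second covers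
    -- n = 1.
    refine ⟨max (8 * 400) (|logGammaRem α 1| * (1 - α / 2) ^ 4), by positivity, fun n hn => ?_⟩
    rcases hn.eq_or_lt with rfl | hn
    · rw [le_div_iff₀ (pow_pos (by push_cast; linarith) 4)]
      push_cast
      exact le_max_right _ _
    · refine (abs_le_of_abs_diff_le (tendsto_logGammaRem h2) (fun n => logGammaRem_diff h1 h2)
        hn).trans ?_
      have hn' : (2 : ℝ) ≤ n := by exact_mod_cast hn
      refine div_le_div₀ (by positivity) (le_max_left _ _) (pow_pos (by linarith) 4) ?_
      exact pow_le_pow_left₀ (by linarith) (by linarith) 4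
  set z := 1 - α / 2 with hz
  have hz0 : 0 < z := by linarith
  set c := gammaCoeff α
  set X := |c| / z ^ 2 + D / z ^ 4 with hX
  have hX0 : 0 ≤ X := by positivity
  refine ⟨D + (Real.exp X + 1 + X) * (D / z ^ 2 + |c|) ^ 2, by positivity, fun n hn => ?_⟩
  have hn' : (1 : ℝ) ≤ n := by exact_mod_cast hn
  obtain ⟨Z, hZ⟩ : ∃ Z, Z = (n : ℝ) - α / 2 := ⟨_, rfl⟩
  have hZz : z ≤ Z := by linarith
  have hZ0 : 0 < Z := by linarith
  have hl := hD' n hn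
  rw [← hZ] at hl ⊢
  set x := logGammaRem α n + c / Z ^ 2 with hx
  have hxX : |x| ≤ X := by
    refine (abs_add_le _ _).trans ?_
    rw [add_comm, abs_div, abs_of_pos (pow_pos hZ0 2)]
    refine add_le_add (by gcongr) (hl.trans (by gcongr))
  have hx2 : |x| ≤ (D / z ^ 2 + |c|) / Z ^ 2 := by
    refine (abs_add_le _ _).trans ?_
    rw [add_div, abs_div c, abs_of_pos (pow_pos hZ0 2)]
    gcongr
    refine hl.trans ?_
    rw [div_div, ← pow_mul_pow_sub Z (show 2 ≤ 4 by norm_num)]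
    gcongr
  have hexp := abs_exp_sub_one_sub_le hX0 hxX
  have key : Real.Gamma (n + 1 - α) / Real.Gamma n = Z ^ (1 - α) * Real.exp x := by
    have p1 := Real.Gamma_pos_of_pos (show 0 < (n : ℝ) + 1 - α by linarith)
    have p2 := Real.Gamma_pos_of_pos (show 0 < (n : ℝ) by linarith)
    rw [Real.rpow_def_of_pos hZ0, ← Real.exp_add, ← Real.exp_log (div_pos p1 p2),
      Real.log_div p1.ne' p2.ne']
    congr 1
    rw [hx]; unfold logGammaRem; rw [← hZ]; ring
  refine ⟨(logGammaRem α n + (Real.exp x - 1 - x)) * Z ^ 4, ?_, ?_⟩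
  · rw [abs_mul, abs_of_pos (pow_pos hZ0 4), ← le_div_iff₀ (pow_pos hZ0 4), add_div]
    refine (abs_add_le _ _).trans (add_le_add hl (hexp.trans ?_))
    rw [mul_div_assoc]
    have : x ^ 2 ≤ ((D / z ^ 2 + |c|) / Z ^ 2) ^ 2 := by
      rw [← sq_abs]; exact pow_le_pow_left₀ (abs_nonneg _) hx2 2
    rw [div_pow, ← pow_mul] at this
    have := Real.exp_pos X
    gcongr
  · rw [key, hx]
    field_simp
    ring_nf

end FracDiffusion
namespace FracDiffusion

/-! Truncated powers. -/

/-- The normalized truncated power `x₊ᵖ / Γ(p+1)`. -/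
noncomputable def tp (p x : ℝ) : ℝ := max x 0 ^ p / Real.Gamma (p + 1)

theorem tp_of_nonpos {p x : ℝ} (hp : 0 < p) (hx : x ≤ 0) : tp p x = 0 := by
  rw [tp, max_eq_right hx, Real.zero_rpow hp.ne', zero_div]

theorem tp_of_nonneg {p x : ℝ} (hx : 0 ≤ x) : tp p x = x ^ p / Real.Gamma (p + 1) := by
  rw [tp, max_eq_left hx]

theorem tp_nonneg {p x : ℝ} (hp : 0 < p) : 0 ≤ tp p x :=
  div_nonneg (Real.rpow_nonneg (le_max_right _ _) _) (Real.Gamma_pos_of_pos (by linarith)).le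

theorem tp_mono {p : ℝ} (hp : 0 < p) : Monotone (tp p) := fun x y h => by
  unfold tp
  have := Real.Gamma_pos_of_pos (show 0 < p + 1 by linarith)
  gcongr

theorem continuous_tp {p : ℝ} (hp : 0 < p) : Continuous (tp p) := by
  unfold tp
  exact ((continuous_id.max continuous_const).rpow_const fun _ => Or.inr hp.le).div_const _

theorem tp_mul {p h x : ℝ} (hh : 0 ≤ h) : tp p (h * x) = h ^ p * tp p x := by
  unfold tp
  rw [show max (h * x) 0 = h * max x 0 by rw [mul_max_of_nonneg _ _ hh, mul_zero],
    Real.mul_rpow hh (le_max_right _ _), mul_div_assoc]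

/-- The normalization by Γ removes the constant from differentiation; at zero the two one-sided
derivatives are glued. -/
theorem hasDerivAt_tp {p : ℝ} (hp : 0 < p) (x : ℝ) : HasDerivAt (tp (p + 1)) (tp p x) x := by
  have hG : Real.Gamma (p + 1 + 1) = (p + 1) * Real.Gamma (p + 1) :=
    Real.Gamma_add_one (by linarith)
  have hG0 := Real.Gamma_pos_of_pos (show 0 < p + 1 by linarith)
  have hpos : ∀ y : ℝ, 0 ≤ y →
      HasDerivAt (fun y : ℝ => y ^ (p + 1) / Real.Gamma (p + 1 + 1)) (tp p y) y := by
    intro y hy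
    have := (Real.hasDerivAt_rpow_const (x := y) (p := p + 1) (Or.inr (by linarith))).div_const
      (Real.Gamma (p + 1 + 1))
    refine this.congr_deriv ?_
    rw [tp_of_nonneg hy, hG, add_sub_cancel_right]
    field_simp
  rcases lt_trichotomy x 0 with hx | rfl | hx
  · rw [tp_of_nonpos hp hx.le]
    refine (hasDerivAt_const x (0 : ℝ)).congr_of_eventuallyEq ?_
    filter_upwards [gt_mem_nhds hx] with y hy
    exact tp_of_nonpos (by linarith) hy.le
  · have hr : HasDerivWithinAt (tp (p + 1)) (tp p 0) (Ici 0) 0 :=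
      (hpos 0 le_rfl).hasDerivWithinAt.congr (fun y hy => tp_of_nonneg hy) (tp_of_nonneg le_rfl)
    have hl : HasDerivWithinAt (tp (p + 1)) (tp p 0) (Iic 0) 0 := by
      rw [tp_of_nonpos hp le_rfl]
      exact (hasDerivWithinAt_const (0 : ℝ) _ (0 : ℝ)).congr
        (fun y hy => tp_of_nonpos (by linarith) hy) (tp_of_nonpos (by linarith) le_rfl)
    have := hl.union hr
    rwa [Iic_union_Ici, hasDerivWithinAt_univ] at this
  · refine (hpos x hx.le).congr_of_eventuallyEq ?_
    filter_upwards [lt_mem_nhds hx] with y hy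
    exact tp_of_nonneg hy.le

theorem tp_natCast (p j : ℕ) : tp p j = (j : ℝ) ^ p / p.factorial := by
  rw [tp_of_nonneg (Nat.cast_nonneg j), Real.rpow_natCast, Real.Gamma_nat_eq_factorial]

/-! Grünwald sums of truncated powers. -/

noncomputable def gsum (α p : ℝ) (N : ℕ) (z : ℝ) : ℝ := ∑ k ∈ Finset.range N, g α k * tp p (z - k)

/-- Terms with k ≥ z vanish, so the truncation index is irrelevant once it reaches z. -/
theorem gsum_eq {α p z : ℝ} (hp : 0 < p) {N N' : ℕ} (h : z ≤ N) (h' : z ≤ N') :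
    gsum α p N z = gsum α p N' z := by
  wlog hN : N ≤ N' generalizing N N'
  · exact (this h' h (by omega)).symm
  refine Finset.sum_subset (by simpa using hN) fun k _ hk => ?_
  rw [tp_of_nonpos hp, mul_zero]
  have : (N : ℝ) ≤ k := by exact_mod_cast (by simpa using hk)
  linarith

theorem hasDerivAt_gsum {α p : ℝ} (hp : 0 < p) (N : ℕ) (z : ℝ) :
    HasDerivAt (gsum α (p + 1) N) (gsum α p N z) z := by
  unfold gsum
  refine HasDerivAt.fun_sum fun k _ => ?_
  have := (hasDerivAt_tp hp (z - k)).comp z ((hasDerivAt_id z).sub_const (k : ℝ))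
  simpa using this.const_mul (g α k)

/-- Taking partial sums multiplies a generating function by 1/(1 - z), which commutes with
convolution by `g`. -/
theorem convolution_step {α : ℝ} {c c' S S' : ℕ → ℝ} (hc0 : c' 0 = c 0)
    (hc : ∀ j, c' (j + 1) = c' j + c (j + 1)) (hS0 : S' 0 = S 0)
    (hS : ∀ n, S' (n + 1) = S' n + S (n + 1))
    (h : ∀ n, ∑ k ∈ Finset.range (n + 1), g α k * c (n - k) = S n) (n : ℕ) :
    ∑ k ∈ Finset.range (n + 1), g α k * c' (n - k) = S' n := by
  induction n with
  | zero => have := h 0; simpa [hc0, hS0] using this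
  | succ n ih =>
    rw [hS, ← ih, ← h (n + 1), Finset.sum_range_succ, Finset.sum_range_succ _ (n + 1),
      Nat.sub_self, hc0, ← add_assoc, ← Finset.sum_add_distrib]
    congr 1
    refine Finset.sum_congr rfl fun k hk => ?_
    have : k ≤ n := by simp at hk; omega
    rw [show n + 1 - k = (n - k) + 1 by omega, hc]; ring

theorem ne_sub_natCast {α : ℝ} (h : ∀ k : ℕ, (k : ℝ) ≠ α) (i k : ℕ) : (k : ℝ) ≠ α - i := by
  have := h (k + i); push_cast at this
  intro h'; apply this; linarith

theorem convolution_step' {α : ℝ} (hα : ∀ k : ℕ, (k : ℝ) ≠ α) (i : ℕ) {c c' : ℕ → ℝ}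
    (hc0 : c' 0 = c 0) (hc : ∀ j, c' (j + 1) = c' j + c (j + 1))
    (h : ∀ n, ∑ k ∈ Finset.range (n + 1), g α k * c (n - k) = g (α - i) n) (n : ℕ) :
    ∑ k ∈ Finset.range (n + 1), g α k * c' (n - k) = g (α - (i + 1 : ℕ)) n := by
  have e : α - (i + 1 : ℕ) = α - i - 1 := by push_cast; ring
  refine convolution_step (S' := fun n => g (α - (i + 1 : ℕ)) n) hc0 hc ?_ ?_ h n
  · rw [g_zero (ne_sub_natCast hα _), g_zero (ne_sub_natCast hα _)]
  · intro n
    simp only [e]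
    exact g_sub_one_diff (ne_sub_natCast hα _) n

/-- Coefficients of (1 - z)^α (1 - z)^{-i} = (1 - z)^{α-i} for i = 1, …, 6; the polynomials in n - k
are the binomial coefficients of (1 - z)^{-i}. -/
theorem sum_g_poly {α : ℝ} (hα : ∀ k : ℕ, (k : ℝ) ≠ α) (n : ℕ) :
    ∑ k ∈ Finset.range (n + 1), g α k * (1 : ℝ) = g (α - 1) n ∧
    ∑ k ∈ Finset.range (n + 1), g α k * (((n - k : ℕ) : ℝ) + 1) = g (α - 2) n ∧
    ∑ k ∈ Finset.range (n + 1), g α k * ((((n - k : ℕ) : ℝ) + 1) * ((n - k : ℕ) + 2) / 2)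
      = g (α - 3) n ∧
    ∑ k ∈ Finset.range (n + 1), g α k * ((((n - k : ℕ) : ℝ) + 1) * ((n - k : ℕ) + 2)
      * ((n - k : ℕ) + 3) / 6) = g (α - 4) n ∧
    ∑ k ∈ Finset.range (n + 1), g α k * ((((n - k : ℕ) : ℝ) + 1) * ((n - k : ℕ) + 2)
      * ((n - k : ℕ) + 3) * ((n - k : ℕ) + 4) / 24) = g (α - 5) n ∧
    ∑ k ∈ Finset.range (n + 1), g α k * ((((n - k : ℕ) : ℝ) + 1) * ((n - k : ℕ) + 2)
      * ((n - k : ℕ) + 3) * ((n - k : ℕ) + 4) * ((n - k : ℕ) + 5) / 120) = g (α - 6) n := by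
  have h0 : ∀ n, ∑ k ∈ Finset.range (n + 1), g α k * (fun _ : ℕ => (1 : ℝ)) (n - k)
      = g (α - (1 : ℕ)) n := fun n => by simpa using sum_g hα n
  have h1 := convolution_step' hα 1 (c := fun _ => 1) (c' := fun j => (j : ℝ) + 1) (by simp)
    (fun j => by push_cast; ring) h0
  have h2 := convolution_step' hα 2 (c := fun j => (j : ℝ) + 1)
     (c' := fun j => ((j : ℝ) + 1) * (j + 2) / 2) (by simp)
    (fun j => by push_cast; ring) h1
  have h3 := convolution_step' hα 3 (c := fun j => ((j : ℝ) + 1) * (j + 2) / 2)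
     (c' := fun j => ((j : ℝ) + 1) * (j + 2) * (j + 3) / 6)
    (by norm_num) (fun j => by push_cast; ring) h2
  have h4 := convolution_step' hα 4 (c := fun j => ((j : ℝ) + 1) * (j + 2) * (j + 3) / 6)
     (c' := fun j => ((j : ℝ) + 1) * (j + 2) * (j + 3) * (j + 4) / 24)
    (by norm_num) (fun j => by push_cast; ring) h3
  have h5 := convolution_step' hα 5 (c := fun j => ((j : ℝ) + 1) * (j + 2) * (j + 3) * (j + 4) / 24)
    
    (c' := fun j => ((j : ℝ) + 1) * (j + 2) * (j + 3) * (j + 4) * (j + 5) / 120)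
    (by norm_num) (fun j => by push_cast; ring) h4
  refine ⟨by simpa using h0 n, ?_, ?_, ?_, ?_, ?_⟩
  · exact_mod_cast h1 n
  · exact_mod_cast h2 n
  · exact_mod_cast h3 n
  · exact_mod_cast h4 n
  · exact_mod_cast h5 n

theorem g_sub_one_eq {β : ℝ} (h : ∀ k : ℕ, (k : ℝ) ≠ β) (n : ℕ) :
    g (β - 1) n = g β n * ((n - β) / (-β)) := by
  unfold g
  have h0 : -β ≠ 0 := by have := h 0; simp at this; simpa [eq_comm] using this
  have h1 : (n : ℝ) - β ≠ 0 := sub_ne_zero.2 (h n)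
  rw [show (n : ℝ) - (β - 1) = n - β + 1 by ring, show -(β - 1) = -β + 1 by ring,
    Real.Gamma_add_one h0, Real.Gamma_add_one h1, div_mul_div_comm]
  congr 1 <;> ring

/-- The quotient `Γ(n+1-α)/Γ(n)`. -/
noncomputable def gammaRatio (α : ℝ) (n : ℕ) : ℝ := Real.Gamma (n + 1 - α) / Real.Gamma n

theorem g_sub_one_eq_gammaRatio {α : ℝ} (h1 : 1 < α) (h2 : α < 2) {n : ℕ} (hn : 1 ≤ n) :
    g (α - 1) n = gammaRatio α n / Real.Gamma (2 - α) * ((1 - α) / n) := by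
  unfold g gammaRatio
  have hn0 : (n : ℝ) ≠ 0 := by positivity
  have h1' : 1 - α ≠ 0 := by linarith
  have : Real.Gamma (1 - α) ≠ 0 := Real.Gamma_ne_zero fun m hm => by
    have := natCast_ne_of_mem h1 h2 (m + 1)
    push_cast at this; apply this; linarith
  have := (Real.Gamma_pos_of_pos (show 0 < (n : ℝ) by positivity)).ne'
  rw [show (n : ℝ) - (α - 1) = n + 1 - α by ring, show -(α - 1) = 1 - α by ring,
    show 2 - α = 1 - α + 1 by ring, Real.Gamma_add_one hn0, Real.Gamma_add_one h1']
  field_simp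

theorem gsum_natCast {α : ℝ} {p N n : ℕ} (hp : 0 < p) (hnN : n ≤ N) :
    gsum α p N n = ∑ k ∈ Finset.range (n + 1), g α k * (((n - k : ℕ) : ℝ) ^ p / p.factorial) := by
  rw [gsum_eq (N' := n + 1) (by exact_mod_cast hp) (by exact_mod_cast hnN) (by push_cast; linarith)]
  refine Finset.sum_congr rfl fun k hk => ?_
  have : k ≤ n := by simp at hk; omega
  rw [← Nat.cast_sub this, tp_natCast]

theorem g_chain {α : ℝ} (h1 : 1 < α) (h2 : α < 2) {n : ℕ} (hn : 1 ≤ n) :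
    g (α - 1) n = gammaRatio α n / Real.Gamma (2 - α) * ((1 - α) / n) ∧
    g (α - 2) n = gammaRatio α n / Real.Gamma (2 - α) * ((n + 1 - α) / n) ∧
    g (α - 3) n = gammaRatio α n / Real.Gamma (3 - α) * ((n + 1 - α) * (n + 2 - α) / n) ∧
    g (α - 4) n = gammaRatio α n / Real.Gamma (4 - α)
      * ((n + 1 - α) * (n + 2 - α) * (n + 3 - α) / n) ∧
    g (α - 5) n = gammaRatio α n / Real.Gamma (5 - α)
      * ((n + 1 - α) * (n + 2 - α) * (n + 3 - α) * (n + 4 - α) / n) ∧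
    g (α - 6) n = gammaRatio α n / Real.Gamma (6 - α)
      * ((n + 1 - α) * (n + 2 - α) * (n + 3 - α) * (n + 4 - α) * (n + 5 - α) / n) := by
  have hα := natCast_ne_of_mem h1 h2
  have hn0 : (n : ℝ) ≠ 0 := by positivity
  have d1 : 1 - α ≠ 0 := by linarith
  have d2 : 2 - α ≠ 0 := by linarith
  have d3 : 3 - α ≠ 0 := by linarith
  have d4 : 4 - α ≠ 0 := by linarith
  have d5 : 5 - α ≠ 0 := by linarith
  have p2 := (Real.Gamma_pos_of_pos (show 0 < 2 - α by linarith)).ne'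
  have G3 : Real.Gamma (3 - α) = (2 - α) * Real.Gamma (2 - α) := by
    rw [← Real.Gamma_add_one d2]; congr 1; ring
  have G4 : Real.Gamma (4 - α) = (3 - α) * Real.Gamma (3 - α) := by
    rw [← Real.Gamma_add_one d3]; congr 1; ring
  have G5 : Real.Gamma (5 - α) = (4 - α) * Real.Gamma (4 - α) := by
    rw [← Real.Gamma_add_one d4]; congr 1; ring
  have G6 : Real.Gamma (6 - α) = (5 - α) * Real.Gamma (5 - α) := by
    rw [← Real.Gamma_add_one d5]; congr 1; ring
  have e1 := g_sub_one_eq_gammaRatio h1 h2 hn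
  have st : ∀ i : ℕ, g (α - (i + 1 : ℕ)) n = g (α - i) n * ((n + i - α) / (i - α)) := by
    intro i
    rw [show α - (i + 1 : ℕ) = α - i - 1 by push_cast; ring, g_sub_one_eq (ne_sub_natCast hα i)]
    congr 2 <;> ring
  have s1 := st 1; have s2 := st 2; have s3 := st 3; have s4 := st 4; have s5 := st 5
  push_cast at s1 s2 s3 s4 s5
  refine ⟨e1, ?_, ?_, ?_, ?_, ?_⟩
  · rw [s1, e1]; field_simp
  · rw [s2, s1, e1, G3]; field_simp
  · rw [s3, s2, s1, e1, G4, G3]; field_simp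
  · rw [s4, s3, s2, s1, e1, G5, G4, G3]; field_simp
  · rw [s5, s4, s3, s2, s1, e1, G6, G5, G4, G3]; field_simp

/-- The powers j^p are expanded in the binomials of `sum_g_poly`, and `g_chain` makes each resulting
weight a rational multiple of `gammaRatio`. In the centred variable Z the remaining polynomial is
even or odd, which matches the even expansion of the ratio. -/
theorem gsum_closed_form {α : ℝ} (h1 : 1 < α) (h2 : α < 2) {n N : ℕ} (hn : 1 ≤ n) (hnN : n ≤ N)
    {Z : ℝ} (hZ : Z = n - α / 2) :
    gsum α 1 N n = gammaRatio α n / Real.Gamma (2 - α) ∧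
    gsum α 2 N n = gammaRatio α n / Real.Gamma (3 - α) * Z ∧
    gsum α 3 N n = gammaRatio α n / Real.Gamma (4 - α) * (Z ^ 2 + (α / 6 - α ^ 2 / 12)) ∧
    gsum α 4 N n = gammaRatio α n / Real.Gamma (5 - α) * (Z ^ 3 + (5 * α / 12 - α ^ 2 / 6) * Z) ∧
    gsum α 5 N n = gammaRatio α n / Real.Gamma (6 - α) * (Z ^ 4 + (3 * α / 4 - α ^ 2 / 4) * Z ^ 2
      + (-α / 30 + 11 * α ^ 2 / 120 - 13 * α ^ 3 / 240 + α ^ 4 / 120)) := by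
  obtain ⟨c1, c2, c3, c4, c5, c6⟩ := g_chain h1 h2 hn
  obtain ⟨t1, t2, t3, t4, t5, t6⟩ := sum_g_poly (natCast_ne_of_mem h1 h2) n
  have hn0 : (n : ℝ) ≠ 0 := by positivity
  have d2 : 2 - α ≠ 0 := by linarith
  have d3 : 3 - α ≠ 0 := by linarith
  have d4 : 4 - α ≠ 0 := by linarith
  have d5 : 5 - α ≠ 0 := by linarith
  have p2 := (Real.Gamma_pos_of_pos (show 0 < 2 - α by linarith)).ne'
  have G3 : Real.Gamma (3 - α) = (2 - α) * Real.Gamma (2 - α) := by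
    rw [← Real.Gamma_add_one d2]; congr 1; ring
  have G4 : Real.Gamma (4 - α) = (3 - α) * Real.Gamma (3 - α) := by
    rw [← Real.Gamma_add_one d3]; congr 1; ring
  have G5 : Real.Gamma (5 - α) = (4 - α) * Real.Gamma (4 - α) := by
    rw [← Real.Gamma_add_one d4]; congr 1; ring
  have G6 : Real.Gamma (6 - α) = (5 - α) * Real.Gamma (5 - α) := by
    rw [← Real.Gamma_add_one d5]; congr 1; ring
  have b1 := gsum_natCast (α := α) (p := 1) (by norm_num) hnN
  have b2 := gsum_natCast (α := α) (p := 2) (by norm_num) hnN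
  have b3 := gsum_natCast (α := α) (p := 3) (by norm_num) hnN
  have b4 := gsum_natCast (α := α) (p := 4) (by norm_num) hnN
  have b5 := gsum_natCast (α := α) (p := 5) (by norm_num) hnN
  simp only [Nat.factorial] at b1 b2 b3 b4 b5
  push_cast at b1 b2 b3 b4 b5
  norm_num at b1 b2 b3 b4 b5
  have q1 : gsum α 1 N n = g (α - 2) n - g (α - 1) n := by
    rw [b1, ← t2, ← t1, ← Finset.sum_sub_distrib]
    exact Finset.sum_congr rfl fun k _ => by ring
  have q2 : gsum α 2 N n = g (α - 3) n - 3 / 2 * g (α - 2) n + 1 / 2 * g (α - 1) n := by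
    rw [b2, ← t3, ← t2, ← t1, Finset.mul_sum, Finset.mul_sum, ← Finset.sum_sub_distrib,
      ← Finset.sum_add_distrib]
    exact Finset.sum_congr rfl fun k _ => by ring
  have q3 : gsum α 3 N n = g (α - 4) n - 2 * g (α - 3) n + 7 / 6 * g (α - 2) n
      - 1 / 6 * g (α - 1) n := by
    rw [b3, ← t4, ← t3, ← t2, ← t1, Finset.mul_sum, Finset.mul_sum, Finset.mul_sum,
      ← Finset.sum_sub_distrib, ← Finset.sum_add_distrib, ← Finset.sum_sub_distrib]
    exact Finset.sum_congr rfl fun k _ => by ring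
  have q4 : gsum α 4 N n = g (α - 5) n - 60 / 24 * g (α - 4) n + 50 / 24 * g (α - 3) n
      - 15 / 24 * g (α - 2) n + 1 / 24 * g (α - 1) n := by
    rw [b4, ← t5, ← t4, ← t3, ← t2, ← t1, Finset.mul_sum, Finset.mul_sum, Finset.mul_sum,
      Finset.mul_sum, ← Finset.sum_sub_distrib, ← Finset.sum_add_distrib, ← Finset.sum_sub_distrib,
      ← Finset.sum_add_distrib]
    exact Finset.sum_congr rfl fun k _ => by ring
  have q5 : gsum α 5 N n = g (α - 6) n - 3 * g (α - 5) n + 390 / 120 * g (α - 4) n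
      - 180 / 120 * g (α - 3) n + 31 / 120 * g (α - 2) n - 1 / 120 * g (α - 1) n := by
    rw [b5, ← t6, ← t5, ← t4, ← t3, ← t2, ← t1, Finset.mul_sum, Finset.mul_sum, Finset.mul_sum,
      Finset.mul_sum, Finset.mul_sum, ← Finset.sum_sub_distrib, ← Finset.sum_add_distrib,
      ← Finset.sum_sub_distrib, ← Finset.sum_add_distrib, ← Finset.sum_sub_distrib]
    exact Finset.sum_congr rfl fun k _ => by ring
  subst hZ
  refine ⟨?_, ?_, ?_, ?_, ?_⟩
  · rw [q1, c1, c2]; field_simp; ring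
  · rw [q2, c1, c2, c3, G3]; field_simp; ring
  · rw [q3, c1, c2, c3, c4, G4, G3]; field_simp; ring
  · rw [q4, c1, c2, c3, c4, c5, G5, G4, G3]; field_simp; ring
  · rw [q5, c1, c2, c3, c4, c5, c6, G6, G5, G4, G3]; field_simp; ring

end FracDiffusion
namespace FracDiffusion

/-! Asymptotics of Grünwald sums of truncated powers. -/

theorem shifted_rpow_le {α z : ℝ} (h1 : 1 < α) (h2 : α < 2) (hz : 1 ≤ z) :
    (z - α / 2) ^ (1 - α) ≤ (1 - α / 2) ^ (1 - α) * z ^ (1 - α) := by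
  rw [← Real.mul_rpow (by linarith) (by linarith)]
  refine Real.rpow_le_rpow_of_nonpos (by nlinarith) (by nlinarith) (by linarith)

/-- All remainders below have the form Z^{1-α} G(1/Z, ε) with a polynomial G. Since Z ≥ 1 - α/2 > 0,
the arguments of G stay in a compact rectangle. -/
theorem exists_bound_of_continuous {α : ℝ} (h1 : 1 < α) (h2 : α < 2) {ε : ℕ → ℝ} {C : ℝ}
    (hε : ∀ n, 1 ≤ n → |ε n| ≤ C) {G : ℝ × ℝ → ℝ} (hG : Continuous G) :
    ∃ B, 0 ≤ B ∧ ∀ n : ℕ, 1 ≤ n →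
      |((n : ℝ) - α / 2) ^ (1 - α) * G (1 / ((n : ℝ) - α / 2), ε n)| ≤ B * (n : ℝ) ^ (1 - α) := by
  obtain ⟨B, hB⟩ := ((isCompact_Icc (a := (0 : ℝ)) (b := 1 / (1 - α / 2))).prod
    (isCompact_Icc (a := -C) (b := C))).exists_bound_of_continuousOn hG.continuousOn
  refine ⟨(1 - α / 2) ^ (1 - α) * |B|, by have : 0 < 1 - α / 2 := by linarith
                                          positivity, fun n hn => ?_⟩
  have hn' : (1 : ℝ) ≤ n := by exact_mod_cast hn
  have hz : 0 < 1 - α / 2 := by linarith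
  have hZ : 0 < (n : ℝ) - α / 2 := by linarith
  have hm : (1 / ((n : ℝ) - α / 2), ε n) ∈ Icc (0 : ℝ) (1 / (1 - α / 2)) ×ˢ Icc (-C) C := by
    refine ⟨⟨by positivity, ?_⟩, abs_le.1 (hε n hn)⟩
    exact one_div_le_one_div_of_le hz (by linarith)
  have hb : |G (1 / ((n : ℝ) - α / 2), ε n)| ≤ |B| := (hB _ hm).trans (le_abs_self B)
  rw [abs_mul, abs_of_pos (Real.rpow_pos_of_pos hZ _)]
  calc _ ≤ (1 - α / 2) ^ (1 - α) * (n : ℝ) ^ (1 - α) * |B| :=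
        mul_le_mul (shifted_rpow_le h1 h2 hn') hb (abs_nonneg _) (by positivity)
    _ = _ := by ring

theorem rpow_floor_le {α z : ℝ} (h1 : 1 < α) (h2 : α < 2) (hz : 1 ≤ z) :
    (⌊z⌋₊ : ℝ) ^ (1 - α) ≤ 2 * z ^ (1 - α) := by
  have hn : 1 ≤ ⌊z⌋₊ := Nat.one_le_floor_iff z |>.2 hz
  have hn' : (1 : ℝ) ≤ ⌊z⌋₊ := by exact_mod_cast hn
  have hlt := Nat.lt_floor_add_one z
  calc (⌊z⌋₊ : ℝ) ^ (1 - α) ≤ (1 / 2 * z) ^ (1 - α) :=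
        Real.rpow_le_rpow_of_nonpos (by linarith) (by linarith) (by linarith)
    _ = (1 / 2) ^ (1 - α) * z ^ (1 - α) := Real.mul_rpow (by norm_num) (by linarith)
    _ ≤ 2 * z ^ (1 - α) := by
        refine mul_le_mul_of_nonneg_right ?_ (Real.rpow_nonneg (by linarith) _)
        calc (1 / 2 : ℝ) ^ (1 - α) ≤ (1 / 2 : ℝ) ^ (-1 : ℝ) :=
              Real.rpow_le_rpow_of_exponent_ge (by norm_num) (by norm_num) (by linarith)
          _ = 2 := by rw [Real.rpow_neg_one]; norm_num

/-- Mean value inequality between ⌊z⌋ and z; passing from ⌊z⌋ to z costs at most a factor two in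
z^{1-α}. -/
theorem bound_of_bound_natCast {α : ℝ} (h1 : 1 < α) (h2 : α < 2) {F F' : ℝ → ℝ} {A B X : ℝ}
    (hA : 0 ≤ A) (hF : ∀ z, 1 ≤ z → HasDerivAt F (F' z) z)
    (hF' : ∀ z, 1 ≤ z → z ≤ X → |F' z| ≤ A * z ^ (1 - α))
    (hn : ∀ n : ℕ, 1 ≤ n → (n : ℝ) ≤ X → |F n| ≤ B * (n : ℝ) ^ (1 - α)) {z : ℝ} (hz : 1 ≤ z)
    (hzX : z ≤ X) : |F z| ≤ 2 * (A + B) * z ^ (1 - α) := by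
  have hn1 : 1 ≤ ⌊z⌋₊ := Nat.one_le_floor_iff z |>.2 hz
  have hn1' : (1 : ℝ) ≤ ⌊z⌋₊ := by exact_mod_cast hn1
  have hle := Nat.floor_le (show 0 ≤ z by linarith)
  have hlt := Nat.lt_floor_add_one z
  set n := ⌊z⌋₊ with hndef
  have hb := hn n hn1 (hle.trans hzX)
  have hd : ‖F z - F n‖ ≤ A * (n : ℝ) ^ (1 - α) * ‖z - n‖ := by
    refine (convex_Icc (n : ℝ) z).norm_image_sub_le_of_norm_hasDerivWithin_le
      (fun y hy => (hF y (by linarith [hy.1])).hasDerivWithinAt) (fun y hy => ?_)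
      (left_mem_Icc.2 hle) (right_mem_Icc.2 hle)
    refine (hF' y (by linarith [hy.1]) (hy.2.trans hzX)).trans ?_
    exact mul_le_mul_of_nonneg_left
      (Real.rpow_le_rpow_of_nonpos (by linarith) hy.1 (by linarith)) hA
  have hnn : 0 ≤ (n : ℝ) ^ (1 - α) := by positivity
  have h1 : ‖z - n‖ ≤ 1 := by rw [Real.norm_eq_abs, abs_le]; constructor <;> linarith
  have h3 : ‖F z - F n‖ ≤ A * (n : ℝ) ^ (1 - α) :=
    hd.trans (mul_le_of_le_one_right (by positivity) h1)
  have h4 : |F z| ≤ (A + B) * (n : ℝ) ^ (1 - α) := by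
    have := abs_add_le (F z - F n) (F n)
    rw [sub_add_cancel] at this
    rw [Real.norm_eq_abs] at h3
    linarith
  have hAB : 0 ≤ A + B := by
    by_contra! h
    have : 0 < (n : ℝ) ^ (1 - α) := by positivity
    nlinarith [abs_nonneg (F z)]
  calc |F z| ≤ (A + B) * (n : ℝ) ^ (1 - α) := h4
    _ ≤ (A + B) * (2 * z ^ (1 - α)) :=
        mul_le_mul_of_nonneg_left (rpow_floor_le ‹_› h2 hz) hAB
    _ = _ := by ring

theorem hasDerivAt_shifted_rpow {α q z : ℝ} (h2 : α < 2) (hz : 1 ≤ z) (hq : 0 < q) :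
    HasDerivAt (fun z => (z - α / 2) ^ q / Real.Gamma (q + 1))
      ((z - α / 2) ^ (q - 1) / Real.Gamma q) z := by
  have := (((hasDerivAt_id z).sub_const (α / 2)).rpow_const (p := q)
    (Or.inl (by simp only [id]; linarith))).div_const (Real.Gamma (q + 1))
  refine this.congr_deriv ?_
  have := Real.Gamma_pos_of_pos hq
  rw [Real.Gamma_add_one hq.ne']
  simp only [id]
  field_simp

/-- Base of the climb in the exponent: this sum is piecewise linear, so its value at n and its slope
`g (α - 1) n` on [n, n+1] determine it. -/
theorem gsum_one_bound {α : ℝ} (h1 : 1 < α) (h2 : α < 2) : ∃ C, 0 ≤ C ∧ ∀ N : ℕ, ∀ z : ℝ,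
    1 ≤ z → z ≤ N → |gsum α 1 N z| ≤ C * z ^ (1 - α) := by
  obtain ⟨C, hC, h⟩ := exists_Gamma_ratio_expansion h1 h2
  choose! ε hε hR using h
  obtain ⟨B, hB, hb⟩ := exists_bound_of_continuous h1 h2 hε
    (G := fun p => (1 + gammaCoeff α * p.1 ^ 2 + p.2 * p.1 ^ 4)) (by fun_prop)
  have hG := Real.Gamma_pos_of_pos (show 0 < 2 - α by linarith)
  refine ⟨2 * (2 * (B / Real.Gamma (2 - α))), by positivity, fun N z hz hzN => ?_⟩
  have hn1 : 1 ≤ ⌊z⌋₊ := Nat.one_le_floor_iff z |>.2 hz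
  have hn1' : (1 : ℝ) ≤ ⌊z⌋₊ := by exact_mod_cast hn1
  have hle := Nat.floor_le (show 0 ≤ z by linarith)
  have hlt := Nat.lt_floor_add_one z
  have hfl := rpow_floor_le h1 h2 hz
  set n := ⌊z⌋₊ with hndef
  have hr : |gammaRatio α n| ≤ B * (n : ℝ) ^ (1 - α) := by
    refine le_trans (le_of_eq ?_) (hb n hn1)
    unfold gammaRatio
    rw [hR n hn1]
    generalize ((n : ℝ) - α / 2) = Z
    ring_nf
  have e : gsum α 1 N z = gsum α 1 (n + 1) n + (z - n) * g (α - 1) n := by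
    rw [gsum_eq (N' := n + 1) one_pos hzN (by push_cast; linarith),
      ← sum_g (natCast_ne_of_mem h1 h2), Finset.mul_sum]
    unfold gsum
    rw [← Finset.sum_add_distrib]
    refine Finset.sum_congr rfl fun k hk => ?_
    have : (k : ℝ) ≤ n := by
      have : k ≤ n := by simp at hk; omega
      exact_mod_cast this
    rw [tp_of_nonneg (by linarith), tp_of_nonneg (by linarith), Real.rpow_one, Real.rpow_one,
      Real.Gamma_add_one one_ne_zero, Real.Gamma_one]
    ring
  rw [e, (gsum_closed_form h1 h2 hn1 (by omega) rfl).1, g_sub_one_eq_gammaRatio h1 h2 hn1]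
  have hq : |(z - n) * ((1 - α) / n)| ≤ 1 := by
    rw [abs_mul, abs_div, abs_of_nonneg (show 0 ≤ z - n by linarith), abs_of_pos (show 0 < (n : ℝ) by linarith),
      abs_of_neg (show 1 - α < 0 by linarith)]
    have : -(1 - α) / n ≤ 1 := by rw [div_le_one (by linarith)]; linarith
    exact mul_le_one₀ (by linarith) (div_nonneg (by linarith) (by linarith)) this
  have : gammaRatio α n / Real.Gamma (2 - α)
      + (z - n) * (gammaRatio α n / Real.Gamma (2 - α) * ((1 - α) / n))
      = gammaRatio α n / Real.Gamma (2 - α) * (1 + (z - n) * ((1 - α) / n)) := by ring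
  rw [this, abs_mul, abs_div, abs_of_pos hG]
  have h5 : |1 + (z - n) * ((1 - α) / n)| ≤ 2 := by
    refine (abs_add_le _ _).trans ?_
    rw [abs_one]; linarith
  calc _ ≤ B * (n : ℝ) ^ (1 - α) / Real.Gamma (2 - α) * 2 := by gcongr
    _ = 2 * (B / Real.Gamma (2 - α)) * (n : ℝ) ^ (1 - α) := by ring
    _ ≤ 2 * (B / Real.Gamma (2 - α)) * (2 * z ^ (1 - α)) := by gcongr
    _ = _ := by ring

theorem gsum_two_bound {α : ℝ} (h1 : 1 < α) (h2 : α < 2) : ∃ C, 0 ≤ C ∧ ∀ N : ℕ, ∀ z : ℝ,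
    1 ≤ z → z ≤ N → |gsum α 2 N z - (z - α / 2) ^ (2 - α) / Real.Gamma (3 - α)|
      ≤ C * z ^ (1 - α) := by
  obtain ⟨C, hC, h⟩ := exists_Gamma_ratio_expansion h1 h2
  choose! ε hε hR using h
  obtain ⟨B, hB, hb⟩ := exists_bound_of_continuous h1 h2 hε
    (G := fun p => ((gammaCoeff α * p.1 + p.2 * p.1 ^ 3) / Real.Gamma (3 - α))) (by fun_prop)
  obtain ⟨A, hA, ha⟩ := gsum_one_bound h1 h2
  have hG := Real.Gamma_pos_of_pos (show 0 < 2 - α by linarith)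
  set K := (1 - α / 2) ^ (1 - α) / Real.Gamma (2 - α)
  have hK : 0 ≤ K := by
    have : 0 < 1 - α / 2 := by linarith
    positivity
  refine ⟨2 * (A + K + B), by positivity, fun N z hz hzN => ?_⟩
  refine bound_of_bound_natCast h1 h2 (by positivity)
    (F := fun z => gsum α 2 N z - (z - α / 2) ^ (2 - α) / Real.Gamma (3 - α))
    (F' := fun z => gsum α 1 N z - (z - α / 2) ^ (1 - α) / Real.Gamma (2 - α)) ?_ ?_ ?_ hz hzN
  · intro z hz
    have d1 := hasDerivAt_gsum (α := α) (p := 1) one_pos N z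
    have d2 := hasDerivAt_shifted_rpow h2 hz (show 0 < 2 - α by linarith)
    rw [show 2 - α + 1 = 3 - α by ring, show 2 - α - 1 = 1 - α by ring] at d2
    rw [one_add_one_eq_two] at d1
    exact d1.sub d2
  · intro z hz hzN
    refine (abs_sub _ _).trans ?_
    rw [add_mul]
    refine add_le_add (ha N z hz hzN) ?_
    rw [abs_of_nonneg (div_nonneg (Real.rpow_nonneg (by linarith) _) hG.le)]
    have := shifted_rpow_le h1 h2 hz
    calc _ ≤ (1 - α / 2) ^ (1 - α) * z ^ (1 - α) / Real.Gamma (2 - α) := by gcongr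
      _ = _ := by ring
  · intro n hn hnN
    refine le_trans (le_of_eq ?_) (hb n hn)
    congr 1
    have hn' : (1 : ℝ) ≤ n := by exact_mod_cast hn
    have hZ : 0 < (n : ℝ) - α / 2 := by linarith
    rw [(gsum_closed_form h1 h2 hn (by exact_mod_cast hnN) rfl).2.1]
    unfold gammaRatio
    rw [hR n hn, show 2 - α = 1 - α + 1 by ring, Real.rpow_add_one hZ.ne']
    generalize ((n : ℝ) - α / 2) ^ (1 - α) = Y at *
    generalize (n : ℝ) - α / 2 = Z at *
    field_simp
    ring

theorem gsum_three_bound {α : ℝ} (h1 : 1 < α) (h2 : α < 2) : ∃ C, 0 ≤ C ∧ ∀ N : ℕ, ∀ z : ℝ,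
    1 ≤ z → z ≤ N → |gsum α 3 N z - (z - α / 2) ^ (3 - α) / Real.Gamma (4 - α)|
      ≤ C * z ^ (1 - α) := by
  obtain ⟨C, hC, h⟩ := exists_Gamma_ratio_expansion h1 h2
  choose! ε hε hR using h
  obtain ⟨B, hB, hb⟩ := exists_bound_of_continuous h1 h2 hε
    (G := fun p => ((p.2 * p.1 ^ 2 + gammaCoeff α + (α / 6 - α ^ 2 / 12)
      * (1 + gammaCoeff α * p.1 ^ 2 + p.2 * p.1 ^ 4)) / Real.Gamma (4 - α))) (by fun_prop)
  obtain ⟨A, hA, ha⟩ := gsum_two_bound h1 h2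
  refine ⟨2 * (A + B), by positivity, fun N z hz hzN => ?_⟩
  refine bound_of_bound_natCast h1 h2 hA
    (F := fun z => gsum α 3 N z - (z - α / 2) ^ (3 - α) / Real.Gamma (4 - α))
    (F' := fun z => gsum α 2 N z - (z - α / 2) ^ (2 - α) / Real.Gamma (3 - α))
    ?_ (fun z hz hzN => ha N z hz hzN) ?_ hz hzN
  · intro z hz
    have d1 := hasDerivAt_gsum (α := α) (p := 2) two_pos N z
    have d2 := hasDerivAt_shifted_rpow h2 hz (show 0 < 3 - α by linarith)
    rw [show 3 - α + 1 = 4 - α by ring, show 3 - α - 1 = 2 - α by ring] at d2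
    norm_num at d1
    exact d1.sub d2
  · intro n hn hnN
    refine le_trans (le_of_eq ?_) (hb n hn)
    congr 1
    have hn' : (1 : ℝ) ≤ n := by exact_mod_cast hn
    have hZ : 0 < (n : ℝ) - α / 2 := by linarith
    rw [(gsum_closed_form h1 h2 hn (by exact_mod_cast hnN) rfl).2.2.1]
    unfold gammaRatio
    rw [hR n hn, show 3 - α = 1 - α + (2 : ℕ) by push_cast; ring, Real.rpow_add_natCast hZ.ne']
    generalize ((n : ℝ) - α / 2) ^ (1 - α) = Y at *
    generalize (n : ℝ) - α / 2 = Z at *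
    field_simp
    ring

/-- The factor α/24 is the s²-coefficient of (sinh(s/2)/(s/2))^α, which is the symbol (1 - e^{-s})^α
s^{-α} recentred by e^{αs/2}. For exponents up to three the corresponding term is already within the
error z^{1-α}; from four on it must be displayed. -/
theorem gsum_four_bound {α : ℝ} (h1 : 1 < α) (h2 : α < 2) : ∃ C, 0 ≤ C ∧ ∀ N : ℕ, ∀ z : ℝ,
    1 ≤ z → z ≤ N → |gsum α 4 N z - ((z - α / 2) ^ (4 - α) / Real.Gamma (5 - α)
      + α / 24 * ((z - α / 2) ^ (2 - α) / Real.Gamma (3 - α)))| ≤ C * z ^ (1 - α) := by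
  obtain ⟨C, hC, h⟩ := exists_Gamma_ratio_expansion h1 h2
  choose! ε hε hR using h
  obtain ⟨B, hB, hb⟩ := exists_bound_of_continuous h1 h2 hε
    (G := fun p => (((5 * α / 12 - α ^ 2 / 6) * gammaCoeff α * p.1 + p.2 * p.1
      + p.2 * (5 * α / 12 - α ^ 2 / 6) * p.1 ^ 3) / Real.Gamma (5 - α))) (by fun_prop)
  obtain ⟨A, hA, ha⟩ := gsum_three_bound h1 h2
  have hG := Real.Gamma_pos_of_pos (show 0 < 2 - α by linarith)
  set K := (1 - α / 2) ^ (1 - α) / Real.Gamma (2 - α)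
  have hK : 0 ≤ K := by
    have : 0 < 1 - α / 2 := by linarith
    positivity
  refine ⟨2 * (A + α / 24 * K + B), by positivity, fun N z hz hzN => ?_⟩
  refine bound_of_bound_natCast h1 h2 (by positivity)
    (F := fun z => gsum α 4 N z - ((z - α / 2) ^ (4 - α) / Real.Gamma (5 - α)
      + α / 24 * ((z - α / 2) ^ (2 - α) / Real.Gamma (3 - α))))
    (F' := fun z => gsum α 3 N z - ((z - α / 2) ^ (3 - α) / Real.Gamma (4 - α)
      + α / 24 * ((z - α / 2) ^ (1 - α) / Real.Gamma (2 - α)))) ?_ ?_ ?_ hz hzN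
  · intro z hz
    have d1 := hasDerivAt_gsum (α := α) (p := 3) three_pos N z
    have d2 := hasDerivAt_shifted_rpow h2 hz (show 0 < 4 - α by linarith)
    have d3 := hasDerivAt_shifted_rpow h2 hz (show 0 < 2 - α by linarith)
    rw [show 4 - α + 1 = 5 - α by ring, show 4 - α - 1 = 3 - α by ring] at d2
    rw [show 2 - α + 1 = 3 - α by ring, show 2 - α - 1 = 1 - α by ring] at d3
    norm_num at d1
    exact d1.sub (d2.add (d3.const_mul _))
  · intro z hz hzN
    rw [← sub_sub]
    refine (abs_sub _ _).trans ?_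
    rw [add_mul]
    refine add_le_add (ha N z hz hzN) ?_
    have hzz : 0 ≤ (z - α / 2) ^ (1 - α) := Real.rpow_nonneg (by linarith) _
    rw [abs_of_nonneg (by positivity)]
    have := shifted_rpow_le h1 h2 hz
    calc _ ≤ α / 24 * ((1 - α / 2) ^ (1 - α) * z ^ (1 - α) / Real.Gamma (2 - α)) := by gcongr
      _ = _ := by ring
  · intro n hn hnN
    refine le_trans (le_of_eq ?_) (hb n hn)
    congr 1
    have hn' : (1 : ℝ) ≤ n := by exact_mod_cast hn
    have hZ : 0 < (n : ℝ) - α / 2 := by linarith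
    have d3 : 3 - α ≠ 0 := by linarith
    have d4 : 4 - α ≠ 0 := by linarith
    have p3 := (Real.Gamma_pos_of_pos (show 0 < 3 - α by linarith)).ne'
    have G4 : Real.Gamma (4 - α) = (3 - α) * Real.Gamma (3 - α) := by
      rw [← Real.Gamma_add_one d3]; congr 1; ring
    have G5 : Real.Gamma (5 - α) = (4 - α) * Real.Gamma (4 - α) := by
      rw [← Real.Gamma_add_one d4]; congr 1; ring
    rw [(gsum_closed_form h1 h2 hn (by exact_mod_cast hnN) rfl).2.2.2.1, G5, G4]
    unfold gammaRatio
    rw [hR n hn, show (4 : ℝ) - α = 1 - α + (3 : ℕ) by push_cast; ring,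
      Real.rpow_add_natCast hZ.ne', show (2 : ℝ) - α = 1 - α + 1 by ring, Real.rpow_add_one hZ.ne']
    have d4' : 1 - α + (3 : ℕ) ≠ 0 := by push_cast; linarith
    unfold gammaCoeff
    push_cast
    push_cast at d4'
    generalize ((n : ℝ) - α / 2) ^ (1 - α) = Y at *
    generalize (n : ℝ) - α / 2 = Z at *
    field_simp
    ring

theorem gsum_five_bound {α : ℝ} (h1 : 1 < α) (h2 : α < 2) : ∃ C, 0 ≤ C ∧ ∀ N : ℕ, ∀ z : ℝ,
    1 ≤ z → z ≤ N → |gsum α 5 N z - ((z - α / 2) ^ (5 - α) / Real.Gamma (6 - α)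
      + α / 24 * ((z - α / 2) ^ (3 - α) / Real.Gamma (4 - α)))| ≤ C * z ^ (1 - α) := by
  obtain ⟨C, hC, h⟩ := exists_Gamma_ratio_expansion h1 h2
  choose! ε hε hR using h
  obtain ⟨c, hc⟩ : ∃ c, c = gammaCoeff α := ⟨_, rfl⟩
  obtain ⟨e, he⟩ : ∃ e, e = 3 * α / 4 - α ^ 2 / 4 := ⟨_, rfl⟩
  obtain ⟨f, hf⟩ : ∃ f, f = -α / 30 + 11 * α ^ 2 / 120 - 13 * α ^ 3 / 240 + α ^ 4 / 120 := ⟨_, rfl⟩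
  -- The two contributions to Z^{3-α}, from the Γ-ratio and from the polynomial, add up to the
  -- predicted α/24 once Γ(6 - α) is reduced to Γ(4 - α).
  have hce : c + e = α * (4 - α) * (5 - α) / 24 := by rw [hc, he]; unfold gammaCoeff; ring
  obtain ⟨B, hB, hb⟩ := exists_bound_of_continuous h1 h2 hε
    (G := fun p => ((c * e + f + p.2 + (e * p.2 + c * f) * p.1 ^ 2 + f * p.2 * p.1 ^ 4)
      / Real.Gamma (6 - α))) (by fun_prop)
  obtain ⟨A, hA, ha⟩ := gsum_four_bound h1 h2
  refine ⟨2 * (A + B), by positivity, fun N z hz hzN => ?_⟩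
  refine bound_of_bound_natCast h1 h2 (by positivity)
    (F := fun z => gsum α 5 N z - ((z - α / 2) ^ (5 - α) / Real.Gamma (6 - α)
      + α / 24 * ((z - α / 2) ^ (3 - α) / Real.Gamma (4 - α))))
    (F' := fun z => gsum α 4 N z - ((z - α / 2) ^ (4 - α) / Real.Gamma (5 - α)
      + α / 24 * ((z - α / 2) ^ (2 - α) / Real.Gamma (3 - α)))) ?_
    (fun z hz hzN => ha N z hz hzN) ?_ hz hzN
  · intro z hz
    have d1 := hasDerivAt_gsum (α := α) (p := 4) four_pos N z
    have d2 := hasDerivAt_shifted_rpow h2 hz (show 0 < 5 - α by linarith)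
    have d3 := hasDerivAt_shifted_rpow h2 hz (show 0 < 3 - α by linarith)
    rw [show 5 - α + 1 = 6 - α by ring, show 5 - α - 1 = 4 - α by ring] at d2
    rw [show 3 - α + 1 = 4 - α by ring, show 3 - α - 1 = 2 - α by ring] at d3
    norm_num at d1
    exact d1.sub (d2.add (d3.const_mul _))
  · intro n hn hnN
    refine le_trans (le_of_eq ?_) (hb n hn)
    congr 1
    have hn' : (1 : ℝ) ≤ n := by exact_mod_cast hn
    have hZ : 0 < (n : ℝ) - α / 2 := by linarith
    have d4 : 4 - α ≠ 0 := by linarith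
    have d5 : 5 - α ≠ 0 := by linarith
    have p4 := (Real.Gamma_pos_of_pos (show 0 < 4 - α by linarith)).ne'
    have G5 : Real.Gamma (5 - α) = (4 - α) * Real.Gamma (4 - α) := by
      rw [← Real.Gamma_add_one d4]; congr 1; ring
    have G6 : Real.Gamma (6 - α) = (5 - α) * Real.Gamma (5 - α) := by
      rw [← Real.Gamma_add_one d5]; congr 1; ring
    rw [(gsum_closed_form h1 h2 hn (by exact_mod_cast hnN) rfl).2.2.2.2, ← he, ← hf]
    unfold gammaRatio
    rw [hR n hn, ← hc, show (5 : ℝ) - α = 1 - α + (4 : ℕ) by push_cast; ring,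
      Real.rpow_add_natCast hZ.ne', show (3 : ℝ) - α = 1 - α + (2 : ℕ) by push_cast; ring,
      Real.rpow_add_natCast hZ.ne']
    have hα' : α / 24 / Real.Gamma (4 - α) = (c + e) / Real.Gamma (6 - α) := by
      rw [hce, G6, G5]; field_simp
    generalize Real.Gamma (6 - α) = Γ6 at *
    generalize ((n : ℝ) - α / 2) ^ (1 - α) = Y at *
    generalize (n : ℝ) - α / 2 = Z at *
    generalize ε n = η at *
    have : α / 24 * (Y * Z ^ 2 / Real.Gamma (4 - α)) = Y * Z ^ 2 * ((c + e) / Γ6) := by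
      rw [← hα']; ring
    rw [this]
    field_simp
    ring

end FracDiffusion
namespace FracDiffusion

/-! Taylor expansion along a chain of derivatives. -/

/-- Induction by the mean value inequality on the points of `I` no farther from y than x is; a
remainder without the factorial suffices. -/
theorem taylor_chain {I : Set ℝ} (hI : Convex ℝ I) {n : ℕ} {B : ℝ} {f : ℕ → ℝ → ℝ}
    (hf : ∀ i < n, ∀ x ∈ I, HasDerivWithinAt (f i) (f (i + 1) x) I x)
    (hB : ∀ x ∈ I, |f n x| ≤ B) {x y : ℝ} (hx : x ∈ I) (hy : y ∈ I) :
    |f 0 x - ∑ l ∈ Finset.range n, (x - y) ^ l / l.factorial * f l y| ≤ B * |x - y| ^ n := by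
  induction n generalizing f x with
  | zero => simpa using hB x hx
  | succ n ih =>
    have hB0 : 0 ≤ B := (abs_nonneg _).trans (hB x hx)
    have ih' := fun x hx => ih (f := fun i => f (i + 1)) (fun i hi => hf (i + 1) (by omega)) hB (x := x) hx
    set J := I ∩ Icc (y - |x - y|) (y + |x - y|)
    have hJ : Convex ℝ J := hI.inter (convex_Icc _ _)
    have hyJ : y ∈ J := ⟨hy, by constructor <;> linarith [abs_nonneg (x - y)]⟩
    have hxJ : x ∈ J := by
      refine ⟨hx, ?_⟩
      have := abs_le.1 (le_refl |x - y|)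
      constructor <;> linarith [this.1, this.2]
    have hd : ∀ u ∈ J, HasDerivWithinAt
        (fun u => f 0 u - ∑ l ∈ Finset.range (n + 1), (u - y) ^ l / l.factorial * f l y)
        (f 1 u - ∑ l ∈ Finset.range n, (u - y) ^ l / l.factorial * f (l + 1) y) J u := by
      intro u hu
      simp only [Finset.sum_range_succ' _ n]
      refine ((hf 0 (by omega) u hu.1).mono inter_subset_left).sub ?_
      have h0 : HasDerivWithinAt (fun u => (u - y) ^ 0 / (Nat.factorial 0 : ℝ) * f 0 y) 0 J u := by
        simpa using hasDerivWithinAt_const u J (f 0 y)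
      have h1 : HasDerivWithinAt
          (fun u => ∑ l ∈ Finset.range n, (u - y) ^ (l + 1) / (Nat.factorial (l + 1) : ℝ) * f (l + 1) y)
          (∑ l ∈ Finset.range n, (u - y) ^ l / (Nat.factorial l : ℝ) * f (l + 1) y) J u := by
        refine HasDerivWithinAt.fun_sum fun l _ => ?_
        have := ((((hasDerivWithinAt_id u J).sub_const y).pow (l + 1)).div_const
          (Nat.factorial (l + 1) : ℝ)).mul_const (f (l + 1) y)
        refine this.congr_deriv ?_
        have : (l.factorial : ℝ) ≠ 0 := by positivity
        simp only [id, Nat.factorial_succ, Nat.cast_mul, Nat.add_sub_cancel]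
        push_cast
        field_simp
      exact (h1.fun_add h0).congr_deriv (by simp)
    have hb : ∀ u ∈ J, ‖f 1 u - ∑ l ∈ Finset.range n, (u - y) ^ l / l.factorial * f (l + 1) y‖
        ≤ B * |x - y| ^ n := by
      intro u hu
      refine (ih' u hu.1).trans ?_
      have : |u - y| ≤ |x - y| := by rw [abs_le]; constructor <;> linarith [hu.2.1, hu.2.2]
      gcongr
    have := hJ.norm_image_sub_le_of_norm_hasDerivWithin_le hd hb hyJ hxJ
    have e : ∑ l ∈ Finset.range (n + 1), (y - y) ^ l / (l.factorial : ℝ) * f l y = f 0 y := by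
      rw [Finset.sum_range_succ', Finset.sum_eq_zero fun l _ => by simp]; simp
    beta_reduce at this
    rw [e, sub_self, sub_zero] at this
    rw [pow_succ, ← mul_assoc]
    exact this

/-! The Peano kernel of the quasi-compact approximation. -/

noncomputable def wsum (α p : ℝ) (N : ℕ) (z : ℝ) : ℝ := ∑ k ∈ Finset.range N, w α k * tp p (z - k)

theorem wsum_eq {α p z : ℝ} (hp : 0 < p) {N N' : ℕ} (h : z ≤ N) (h' : z ≤ N') :
    wsum α p N z = wsum α p N' z := by
  wlog hN : N ≤ N' generalizing N N'
  · exact (this h' h (by omega)).symm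
  refine Finset.sum_subset (by simpa using hN) fun k _ hk => ?_
  rw [tp_of_nonpos hp, mul_zero]
  have : (N : ℝ) ≤ k := by exact_mod_cast (by simpa using hk)
  linarith

theorem wsum_eq_gsum (α p : ℝ) (N : ℕ) (z : ℝ) :
    wsum α p (N + 2) z = μ₁ α * gsum α p (N + 2) z + μ₀ α * gsum α p (N + 1) (z - 1)
      + μm α * gsum α p N (z - 2) := by
  unfold wsum gsum
  rw [Finset.sum_range_succ', Finset.sum_range_succ', Finset.sum_range_succ' _ (N + 1),
    Finset.sum_range_succ' _ N, Finset.sum_range_succ' _ N]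
  have : ∑ k ∈ Finset.range N, w α (k + 1 + 1) * tp p (z - (k + 1 + 1 : ℕ))
      = μ₁ α * ∑ k ∈ Finset.range N, g α (k + 1 + 1) * tp p (z - (k + 1 + 1 : ℕ))
      + μ₀ α * ∑ k ∈ Finset.range N, g α (k + 1) * tp p (z - 1 - (k + 1 : ℕ))
      + μm α * ∑ k ∈ Finset.range N, g α k * tp p (z - 2 - k) := by
    rw [Finset.mul_sum, Finset.mul_sum, Finset.mul_sum, ← Finset.sum_add_distrib,
      ← Finset.sum_add_distrib]
    refine Finset.sum_congr rfl fun k _ => ?_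
    rw [show z - 1 - (k + 1 : ℕ) = z - (k + 1 + 1 : ℕ) by push_cast; ring,
      show z - 2 - (k : ℝ) = z - (k + 1 + 1 : ℕ) by push_cast; ring]
    simp only [w]; ring
  rw [this]
  simp only [zero_add, w]
  push_cast
  simp only [sub_zero]
  ring

/-- The Peano kernel. -/
noncomputable def peanoKernel (α : ℝ) (N : ℕ) (z : ℝ) : ℝ :=
  wsum α 5 (N + 2) z - (tp (5 - α) (z - 1)
    + b₂ α * (tp (5 - α) (z - 2) - 2 * tp (5 - α) (z - 1) + tp (5 - α) z))

theorem mul_rpow_le_of_le {α z x : ℝ} (h1 : 1 < α) (h2 : α < 2) (hz : 0 < z) (hx : z / 4 ≤ x) :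
    x ^ (1 - α) ≤ 4 * z ^ (1 - α) := by
  calc x ^ (1 - α) ≤ (1 / 4 * z) ^ (1 - α) :=
        Real.rpow_le_rpow_of_nonpos (by linarith) (by linarith) (by linarith)
    _ = (1 / 4) ^ (1 - α) * z ^ (1 - α) := Real.mul_rpow (by norm_num) hz.le
    _ ≤ 4 * z ^ (1 - α) := by
        refine mul_le_mul_of_nonneg_right ?_ (Real.rpow_nonneg hz.le _)
        calc (1 / 4 : ℝ) ^ (1 - α) ≤ (1 / 4 : ℝ) ^ (-1 : ℝ) :=
              Real.rpow_le_rpow_of_exponent_ge (by norm_num) (by norm_num) (by linarith)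
          _ = 4 := by rw [Real.rpow_neg_one]; norm_num

/-- No cancellation is needed here: the kernel is bounded, and z^{1-α} is bounded below on (0, 4].
-/
theorem peanoKernel_bound_of_le {α : ℝ} (h1 : 1 < α) (h2 : α < 2) : ∃ C, 0 ≤ C ∧ ∀ N : ℕ, ∀ z : ℝ,
    0 < z → z ≤ (N + 2 : ℕ) → z ≤ 4 → |peanoKernel α N z| ≤ C * z ^ (1 - α) := by
  set A := ∑ k ∈ Finset.range 4, |w α k| * tp 5 4
  set T := tp (5 - α) 4
  have hp : 0 < 5 - α := by linarith
  have hT : 0 ≤ T := tp_nonneg hp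
  have hA : 0 ≤ A := Finset.sum_nonneg fun k _ => mul_nonneg (abs_nonneg _) (tp_nonneg (by norm_num))
  have hb := b₂_pos h1 h2
  refine ⟨4 * (A + (T + b₂ α * (T + 2 * T + T))), by positivity, fun N z hz hzN hz4 => ?_⟩
  have hw : |wsum α 5 (N + 2) z| ≤ A := by
    rw [wsum_eq (N' := 4) (by norm_num) hzN (by exact_mod_cast hz4)]
    refine (Finset.abs_sum_le_sum_abs _ _).trans (Finset.sum_le_sum fun k _ => ?_)
    rw [abs_mul, abs_of_nonneg (tp_nonneg (p := 5) (by norm_num))]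
    have : (0 : ℝ) ≤ k := Nat.cast_nonneg k
    exact mul_le_mul_of_nonneg_left (tp_mono (by norm_num) (by linarith)) (abs_nonneg _)
  have ht : ∀ x : ℝ, x ≤ 4 → tp (5 - α) x ≤ T := fun x hx => tp_mono hp hx
  have t0 := fun x => tp_nonneg (x := x) hp
  have h3 : |tp (5 - α) (z - 1) + b₂ α * (tp (5 - α) (z - 2) - 2 * tp (5 - α) (z - 1)
      + tp (5 - α) z)| ≤ T + b₂ α * (T + 2 * T + T) := by
    refine (abs_add_le _ _).trans ?_
    rw [abs_of_nonneg (t0 _), abs_mul, abs_of_pos hb]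
    refine add_le_add (ht _ (by linarith)) (mul_le_mul_of_nonneg_left ?_ hb.le)
    have := ht (z - 1) (by linarith); have := ht (z - 2) (by linarith); have := ht z hz4
    have := t0 (z - 1); have := t0 (z - 2); have := t0 z
    rw [abs_le]; constructor <;> linarith
  have h4 : 1 ≤ 4 * z ^ (1 - α) := by
    have := mul_rpow_le_of_le h1 h2 hz (x := 1) (by linarith)
    rwa [Real.one_rpow] at this
  refine ((abs_sub _ _).trans (add_le_add hw h3)).trans ?_
  calc A + (T + b₂ α * (T + 2 * T + T)) ≤ (A + (T + b₂ α * (T + 2 * T + T))) * (4 * z ^ (1 - α)) :=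
        le_mul_of_one_le_right (by positivity) h4
    _ = _ := by ring

/-- By `gsum_five_bound` the kernel is, up to O(z^{1-α}), a combination of values of x^{5-α}/Γ(6-α)
and of its second derivative near z - 1. Taylor expansion at z - 1 leaves fourth-order remainders,
again O(z^{1-α}), because the coefficients of the derivatives of order 0 to 3 all cancel. -/
theorem peanoKernel_bound_of_ge {α : ℝ} (h1 : 1 < α) (h2 : α < 2) : ∃ C, 0 ≤ C ∧ ∀ N : ℕ, ∀ z : ℝ,
    z ≤ (N + 2 : ℕ) → 4 ≤ z → |peanoKernel α N z| ≤ C * z ^ (1 - α) := by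
  obtain ⟨E, hE, hgs⟩ := gsum_five_bound h1 h2
  have hG2 := Real.Gamma_pos_of_pos (show 0 < 2 - α by linarith)
  have hb := b₂_pos h1 h2
  set B' := 4 / Real.Gamma (2 - α)
  have hB' : 0 ≤ B' := by positivity
  set Q := 4 * E + 16 * B' + α / 24 * (4 * B')
  have hQ : 0 ≤ Q := by positivity
  refine ⟨(|μ₁ α| + |μ₀ α| + |μm α|) * Q + b₂ α * (16 * B' + 16 * B'), by positivity,
    fun N z hzN hz => ?_⟩
  -- This centre corresponds to the node x_j. Radius 2 covers the shifts 1 - α/2, -α/2, -1 - α/2 and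
  -- ±1, and z ≥ 4 keeps all points above z/4.
  obtain ⟨y, hy⟩ : ∃ y, y = z - 1 := ⟨_, rfl⟩
  set X := z ^ (1 - α) with hX
  have hX0 : 0 < X := Real.rpow_pos_of_pos (by linarith) _
  set f : ℕ → ℝ → ℝ := fun l x => x ^ (5 - α - l) / Real.Gamma (6 - α - l) with hf
  have hder : ∀ i < 4, ∀ x ∈ Icc (y - 2) (y + 2),
      HasDerivWithinAt (f i) (f (i + 1) x) (Icc (y - 2) (y + 2)) x := by
    intro i hi x hx
    have hi' : (i : ℝ) ≤ 3 := by exact_mod_cast (by omega : i ≤ 3)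
    have hq : 0 < 5 - α - i := by linarith
    have := ((hasDerivAt_id x).rpow_const (p := 5 - α - i)
      (Or.inl (by simp only [id]; linarith [hx.1]))).div_const (Real.Gamma (6 - α - i))
    refine (this.congr_deriv ?_).hasDerivWithinAt
    have := Real.Gamma_pos_of_pos hq
    simp only [hf, id]
    rw [show 6 - α - i = 5 - α - i + 1 by ring, Real.Gamma_add_one hq.ne',
      show 6 - α - (i + 1 : ℕ) = 5 - α - i by push_cast; ring,
      show 5 - α - (i + 1 : ℕ) = 5 - α - i - 1 by push_cast; ring]
    field_simp
  have hbd : ∀ x ∈ Icc (y - 2) (y + 2), |f 4 x| ≤ B' * X := by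
    intro x hx
    have hx0 : z / 4 ≤ x := by linarith [hx.1]
    simp only [hf]
    rw [show 5 - α - (4 : ℕ) = 1 - α by push_cast; ring,
      show 6 - α - (4 : ℕ) = 2 - α by push_cast; ring,
      abs_of_nonneg (div_nonneg (Real.rpow_nonneg (by linarith) _) hG2.le)]
    have := mul_rpow_le_of_le h1 h2 (by linarith) hx0
    calc _ ≤ 4 * z ^ (1 - α) / Real.Gamma (2 - α) := by gcongr
      _ = _ := by ring
  have hyI : y ∈ Icc (y - 2) (y + 2) := by constructor <;> linarith
  have hcI : ∀ c : ℝ, |c| ≤ 2 → y + c ∈ Icc (y - 2) (y + 2) := fun c hc => by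
    have := abs_le.1 hc
    constructor <;> linarith [this.1, this.2]
  have T0 : ∀ c : ℝ, |c| ≤ 2 → |f 0 (y + c) - (f 0 y + c * f 1 y + c ^ 2 / 2 * f 2 y
      + c ^ 3 / 6 * f 3 y)| ≤ 16 * B' * X := by
    intro c hc
    have := taylor_chain (convex_Icc _ _) hder hbd (hcI c hc) hyI
    simp only [Finset.sum_range_succ, Finset.sum_range_zero, add_sub_cancel_left, Nat.factorial] at this
    push_cast at this
    norm_num at this
    have hc4 : |c| ^ 4 ≤ 16 := by
      have := pow_le_pow_left₀ (abs_nonneg c) hc 4; linarith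
    refine this.trans ?_
    calc B' * X * |c| ^ 4 ≤ B' * X * 16 := by gcongr
      _ = _ := by ring
  have T2 : ∀ c : ℝ, |c| ≤ 2 → |f 2 (y + c) - (f 2 y + c * f 3 y)| ≤ 4 * B' * X := by
    intro c hc
    have := taylor_chain (n := 2) (f := fun i => f (i + 2)) (convex_Icc _ _)
      (fun i hi => hder (i + 2) (by omega)) hbd (hcI c hc) hyI
    simp only [Finset.sum_range_succ, Finset.sum_range_zero, add_sub_cancel_left, Nat.factorial] at this
    push_cast at this
    norm_num at this
    have hc4 : |c| ^ 2 ≤ 4 := by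
      have := pow_le_pow_left₀ (abs_nonneg c) hc 2; linarith
    refine this.trans ?_
    rw [← sq_abs]
    calc B' * X * |c| ^ 2 ≤ B' * X * 4 := by gcongr
      _ = _ := by ring
  have gs : ∀ (c : ℝ) (M : ℕ) (x : ℝ), |c| ≤ 2 → x = y + c + α / 2 → x ≤ M → 1 ≤ x → z / 4 ≤ x →
      |gsum α 5 M x - (f 0 y + c * f 1 y + c ^ 2 / 2 * f 2 y + c ^ 3 / 6 * f 3 y
        + α / 24 * (f 2 y + c * f 3 y))| ≤ Q * X := by
    intro c M x hc hx hxM hx1 hxz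
    have a1 := hgs M x hx1 hxM
    have a2 := T0 c hc
    have a3 := T2 c hc
    have a4 : E * x ^ (1 - α) ≤ 4 * E * X := by
      have := mul_le_mul_of_nonneg_left (mul_rpow_le_of_le h1 h2 (by linarith) hxz) hE
      linarith
    have e1 : (x - α / 2) ^ (5 - α) / Real.Gamma (6 - α) = f 0 (y + c) := by
      simp only [hf, Nat.cast_zero, sub_zero]; rw [hx, add_sub_cancel_right]
    have e2 : (x - α / 2) ^ (3 - α) / Real.Gamma (4 - α) = f 2 (y + c) := by
      simp only [hf]
      rw [hx, add_sub_cancel_right, show 5 - α - (2 : ℕ) = 3 - α by push_cast; ring,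
        show 6 - α - (2 : ℕ) = 4 - α by push_cast; ring]
    rw [e1, e2] at a1
    have a5 : |α / 24 * (f 2 (y + c) - (f 2 y + c * f 3 y))| ≤ α / 24 * (4 * B' * X) := by
      rw [abs_mul, abs_of_pos (show 0 < α / 24 by linarith)]
      exact mul_le_mul_of_nonneg_left a3 (by linarith)
    have := (abs_add_le _ _).trans (add_le_add ((abs_add_le _ _).trans
      (add_le_add (a1.trans a4) a2)) a5)
    refine le_trans (le_of_eq ?_) (this.trans (le_of_eq ?_))
    · congr 1; ring
    · simp only [Q]; ring
  have hzN' : z ≤ N + 2 := by exact_mod_cast hzN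
  have g1 := gs (1 - α / 2) (N + 2) z (by rw [abs_le]; constructor <;> linarith) (by linarith) hzN
    (by linarith) (by linarith)
  have g0 := gs (-α / 2) (N + 1) (z - 1) (by rw [abs_le]; constructor <;> linarith) (by linarith)
    (by push_cast; linarith) (by linarith) (by linarith)
  have gm := gs (-1 - α / 2) N (z - 2) (by rw [abs_le]; constructor <;> linarith) (by linarith)
    (by linarith) (by linarith) (by linarith)
  have tp1 := T0 1 (by norm_num)
  have tm1 := T0 (-1) (by norm_num)
  have ρ : ∀ x : ℝ, 0 ≤ x → tp (5 - α) x = f 0 x := by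
    intro x hx
    rw [tp_of_nonneg hx]
    simp only [hf, Nat.cast_zero, sub_zero]
    rw [show 5 - α + 1 = 6 - α by ring]
  unfold peanoKernel
  have hz2 : z - 2 = y + -1 := by linarith
  rw [wsum_eq_gsum, ρ z (by linarith), ρ (z - 1) (by linarith), ρ (z - 2) (by linarith),
    hz2, ← hy, show f 0 z = f 0 (y + 1) by rw [hy, sub_add_cancel]]
  rw [hz2] at gm
  rw [← hy] at g0
  generalize gsum α 5 (N + 2) z = G1 at *
  generalize gsum α 5 (N + 1) y = G0 at *
  generalize gsum α 5 N (y + -1) = Gm at *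
  generalize f 0 (y + 1) = F1 at *
  generalize f 0 (y + -1) = Fm at *
  generalize f 0 y = f0 at *
  generalize f 1 y = f1 at *
  generalize f 2 y = f2 at *
  generalize f 3 y = f3 at *
  -- This identity is the order condition. With c the shift attached to μ, it encodes Σμ = 1, Σμc =
  -- 0, Σμ(c²/2 + α/24) = b₂ and Σμ(c³/6 + αc/24) = 0.
  have key : μ₁ α * G1 + μ₀ α * G0 + μm α * Gm - (f0 + b₂ α * (Fm - 2 * f0 + F1))
      = μ₁ α * (G1 - (f0 + (1 - α / 2) * f1 + (1 - α / 2) ^ 2 / 2 * f2 + (1 - α / 2) ^ 3 / 6 * f3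
          + α / 24 * (f2 + (1 - α / 2) * f3)))
        + μ₀ α * (G0 - (f0 + (-α / 2) * f1 + (-α / 2) ^ 2 / 2 * f2 + (-α / 2) ^ 3 / 6 * f3
          + α / 24 * (f2 + (-α / 2) * f3)))
        + μm α * (Gm - (f0 + (-1 - α / 2) * f1 + (-1 - α / 2) ^ 2 / 2 * f2
          + (-1 - α / 2) ^ 3 / 6 * f3 + α / 24 * (f2 + (-1 - α / 2) * f3)))
        - b₂ α * ((Fm - (f0 + -1 * f1 + (-1) ^ 2 / 2 * f2 + (-1) ^ 3 / 6 * f3))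
          + (F1 - (f0 + 1 * f1 + 1 ^ 2 / 2 * f2 + 1 ^ 3 / 6 * f3))) := by
    unfold μ₁ μ₀ μm b₂
    ring
  rw [key]
  refine (abs_sub _ _).trans ?_
  rw [add_mul]
  refine add_le_add ?_ ?_
  · refine (abs_add_le _ _).trans ?_
    rw [show (|μ₁ α| + |μ₀ α| + |μm α|) * Q * X
      = |μ₁ α| * (Q * X) + |μ₀ α| * (Q * X) + |μm α| * (Q * X) by ring]
    refine add_le_add ((abs_add_le _ _).trans (add_le_add ?_ ?_)) ?_
    · rw [abs_mul]; exact mul_le_mul_of_nonneg_left g1 (abs_nonneg _)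
    · rw [abs_mul]; exact mul_le_mul_of_nonneg_left g0 (abs_nonneg _)
    · rw [abs_mul]; exact mul_le_mul_of_nonneg_left gm (abs_nonneg _)
  · rw [abs_mul, abs_of_pos hb, mul_assoc, add_mul]
    exact mul_le_mul_of_nonneg_left ((abs_add_le _ _).trans (add_le_add tm1 tp1)) hb.le

theorem peanoKernel_bound {α : ℝ} (h1 : 1 < α) (h2 : α < 2) : ∃ C, 0 ≤ C ∧ ∀ N : ℕ, ∀ z : ℝ,
    0 < z → z ≤ (N + 2 : ℕ) → |peanoKernel α N z| ≤ C * z ^ (1 - α) := by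
  obtain ⟨C, hC, h⟩ := peanoKernel_bound_of_le h1 h2
  obtain ⟨C', hC', h'⟩ := peanoKernel_bound_of_ge h1 h2
  refine ⟨max C C', by positivity, fun N z hz hzN => ?_⟩
  have hX := Real.rpow_nonneg hz.le (1 - α)
  rcases le_total z 4 with h4 | h4
  · exact (h N z hz hzN h4).trans (mul_le_mul_of_nonneg_right (le_max_left _ _) hX)
  · exact (h' N z hzN h4).trans (mul_le_mul_of_nonneg_right (le_max_right _ _) hX)

/-- The kernel that bounds the discrete derivative of a C³ function uniformly in h; no cancellation
among the μ's is used. -/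
theorem wsum_two_bound {α : ℝ} (h1 : 1 < α) (h2 : α < 2) : ∃ C, 0 ≤ C ∧ ∀ N : ℕ, ∀ z : ℝ,
    z ≤ (N + 2 : ℕ) → |wsum α 2 (N + 2) z| ≤ C * (max z 1) ^ (2 - α) := by
  obtain ⟨A, hA, ha⟩ := gsum_two_bound h1 h2
  have hG3 := Real.Gamma_pos_of_pos (show 0 < 3 - α by linarith)
  have hG3' := Real.Gamma_pos_of_pos (show (0 : ℝ) < 2 + 1 by norm_num)
  set Q := A + 1 / Real.Gamma (3 - α) + tp 2 1
  have ht : 0 ≤ tp 2 1 := tp_nonneg two_pos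
  have hQ : 0 ≤ Q := by positivity
  have gb : ∀ N : ℕ, ∀ z : ℝ, z ≤ N → ∀ z' : ℝ, z ≤ z' →
      |gsum α 2 N z| ≤ Q * (max z' 1) ^ (2 - α) := by
    intro N z hzN z' hz'
    have hm : 1 ≤ (max z' 1) ^ (2 - α) := Real.one_le_rpow (le_max_right _ _) (by linarith)
    rcases le_total z 1 with hz1 | hz1
    · have e : |gsum α 2 N z| ≤ tp 2 1 := by
        rw [gsum_eq (N' := 1) two_pos hzN (by simpa using hz1)]
        unfold gsum
        rw [Finset.sum_range_one, g_zero (natCast_ne_of_mem h1 h2), one_mul,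
          abs_of_nonneg (tp_nonneg two_pos)]
        exact tp_mono two_pos (by simpa using hz1)
      calc _ ≤ tp 2 1 := e
        _ ≤ Q * 1 := by
            simp only [Q]; have : 0 ≤ A + 1 / Real.Gamma (3 - α) := by positivity
            linarith
        _ ≤ _ := by gcongr
    · have h3 := ha N z hz1 hzN
      have h4 : z ^ (1 - α) ≤ 1 := Real.rpow_le_one_of_one_le_of_nonpos hz1 (by linarith)
      have h5 : (z - α / 2) ^ (2 - α) / Real.Gamma (3 - α)
          ≤ 1 / Real.Gamma (3 - α) * (max z' 1) ^ (2 - α) := by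
        rw [one_div, ← div_eq_inv_mul]
        gcongr
        · linarith
        · exact le_trans (by linarith) (le_max_left _ _)
      have h6 : 0 ≤ (z - α / 2) ^ (2 - α) / Real.Gamma (3 - α) :=
        div_nonneg (Real.rpow_nonneg (by linarith) _) hG3.le
      have h7 := abs_add_le (gsum α 2 N z - (z - α / 2) ^ (2 - α) / Real.Gamma (3 - α))
        ((z - α / 2) ^ (2 - α) / Real.Gamma (3 - α))
      rw [sub_add_cancel, abs_of_nonneg h6] at h7
      have h8 : A * z ^ (1 - α) ≤ A * (max z' 1) ^ (2 - α) :=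
        mul_le_mul_of_nonneg_left (h4.trans hm) hA
      have : 0 ≤ tp 2 1 * (max z' 1) ^ (2 - α) := by positivity
      simp only [Q, add_mul]
      linarith
  refine ⟨|μ₁ α| * Q + |μ₀ α| * Q + |μm α| * Q, by positivity, fun N z hzN => ?_⟩
  have hzN' : z ≤ N + 2 := by exact_mod_cast hzN
  rw [wsum_eq_gsum, add_mul, add_mul]
  refine (abs_add_le _ _).trans (add_le_add ((abs_add_le _ _).trans (add_le_add ?_ ?_)) ?_) <;>
    rw [abs_mul, mul_assoc] <;> refine mul_le_mul_of_nonneg_left ?_ (abs_nonneg _)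
  · exact gb _ _ hzN _ le_rfl
  · exact gb _ _ (by push_cast; linarith) _ (by linarith)
  · exact gb _ _ (by linarith) _ (by linarith)

end FracDiffusion
namespace FracDiffusion

/-! Fractional integrals and one-dimensional consistency. -/

/-- `v 0, …, v m` are successive derivatives on `[a, b]`. -/
structure IsChain (a b : ℝ) (m : ℕ) (v : ℕ → ℝ → ℝ) : Prop where
  deriv : ∀ i < m, ∀ x ∈ Icc a b, HasDerivWithinAt (v i) (v (i + 1) x) (Icc a b) x
  cont : ContinuousOn (v m) (Icc a b)

theorem IsChain.continuousOn {a b : ℝ} {m : ℕ} {v : ℕ → ℝ → ℝ} (h : IsChain a b m v) {i : ℕ}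
    (hi : i ≤ m) : ContinuousOn (v i) (Icc a b) := by
  rcases hi.lt_or_eq with hi | rfl
  · exact fun x hx => (h.deriv i hi x hx).continuousWithinAt
  · exact h.cont

/-- The Riemann-Liouville integral of order `p`. -/
noncomputable def fracInt (a p : ℝ) (q : ℝ → ℝ) (z : ℝ) : ℝ :=
  ∫ s in a..z, (z - s) ^ (p - 1) / Real.Gamma p * q s

theorem intervalIntegrable_sub_rpow {a z p : ℝ} (hp : 0 < p) :
    IntervalIntegrable (fun s => (z - s) ^ (p - 1)) MeasureTheory.volume a z := by
  have := (intervalIntegral.intervalIntegrable_rpow' (a := z - a) (b := z - z)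
    (show -1 < p - 1 by linarith)).comp_sub_left z
  simpa using this

/-- Integration by parts: the boundary term vanishes at z because p > 0 and at a by `h0`. -/
theorem fracInt_step {a b p : ℝ} {v₀ v₁ : ℝ → ℝ} (hp : 0 < p)
    (hd : ∀ x ∈ Icc a b, HasDerivWithinAt v₀ (v₁ x) (Icc a b) x) (hc : ContinuousOn v₁ (Icc a b))
    (h0 : v₀ a = 0) {z : ℝ} (hz : z ∈ Icc a b) : fracInt a p v₀ z = fracInt a (p + 1) v₁ z := by
  have hsub : Icc a z ⊆ Icc a b := Icc_subset_Icc_right hz.2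
  have hu : uIcc a z = Icc a z := uIcc_of_le hz.1
  have hc0 : ContinuousOn v₀ (Icc a z) := fun x hx =>
    (hd x (hsub hx)).continuousWithinAt.mono hsub
  have hc1 : ContinuousOn v₁ (Icc a z) := hc.mono hsub
  have hG := Real.Gamma_pos_of_pos hp
  have i0 : IntervalIntegrable (fun s => (z - s) ^ (p - 1) / Real.Gamma p * v₀ s)
      MeasureTheory.volume a z :=
    ((intervalIntegrable_sub_rpow hp).div_const _).mul_continuousOn (by rwa [hu])
  have i1 : IntervalIntegrable (fun s => (z - s) ^ (p + 1 - 1) / Real.Gamma (p + 1) * v₁ s)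
      MeasureTheory.volume a z :=
    ((intervalIntegrable_sub_rpow (by linarith)).div_const _).mul_continuousOn (by rwa [hu])
  have key := intervalIntegral.integral_eq_sub_of_hasDerivAt_of_le hz.1
    (f := fun s => -((z - s) ^ p / Real.Gamma (p + 1) * v₀ s))
    (f' := fun s => (z - s) ^ (p - 1) / Real.Gamma p * v₀ s
      - (z - s) ^ (p + 1 - 1) / Real.Gamma (p + 1) * v₁ s) ?_ ?_ (i0.sub i1)
  · rw [intervalIntegral.integral_sub i0 i1] at key
    simp only [sub_self, Real.zero_rpow hp.ne', h0, zero_div, zero_mul, mul_zero, neg_zero] at key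
    exact sub_eq_zero.1 key
  · refine ContinuousOn.neg (ContinuousOn.mul (ContinuousOn.div_const ?_ _) hc0)
    exact (continuousOn_const.sub continuousOn_id).rpow_const fun _ _ => Or.inr hp.le
  · intro s hs
    have d0 : HasDerivAt v₀ (v₁ s) s := (hd s (hsub (Ioo_subset_Icc_self hs))).hasDerivAt
      (Icc_mem_nhds hs.1 (hs.2.trans_le hz.2))
    have hzs : z - s ≠ 0 := by linarith [hs.2]
    have d1 := ((((hasDerivAt_id s).const_sub z).rpow_const (p := p) (Or.inl hzs)).div_const
      (Real.Gamma (p + 1))).mul d0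
    refine d1.neg.congr_deriv ?_
    simp only [id, add_sub_cancel_right]
    rw [Real.Gamma_add_one hp.ne']
    field_simp
    ring

theorem fracInt_chain {a b p : ℝ} {m : ℕ} {v : ℕ → ℝ → ℝ} (hp : 0 < p) (hv : IsChain a b m v)
    (h0 : ∀ i < m, v i a = 0) {z : ℝ} (hz : z ∈ Icc a b) :
    fracInt a p (v 0) z = fracInt a (p + m) (v m) z := by
  have : ∀ k ≤ m, fracInt a p (v 0) z = fracInt a (p + k) (v k) z := by
    intro k
    induction k with
    | zero => simp
    | succ k ih =>
      intro hk
      rw [ih (by omega), fracInt_step (by positivity) (hv.deriv k hk) (hv.continuousOn hk)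
        (h0 k hk) hz]
      push_cast
      rw [add_assoc]
  exact this m le_rfl

theorem eq_fracInt {a b : ℝ} {m : ℕ} {v : ℕ → ℝ → ℝ} (hm : 0 < m) (hv : IsChain a b m v)
    (h0 : ∀ i < m, v i a = 0) {z : ℝ} (hz : z ∈ Icc a b) : v 0 z = fracInt a m (v m) z := by
  obtain ⟨n, rfl⟩ : ∃ n, m = n + 1 := ⟨m - 1, by omega⟩
  have h1 : IsChain a b n fun i => v (i + 1) := ⟨fun i hi => hv.deriv (i + 1) (by omega), hv.cont⟩
  have := fracInt_chain one_pos h1 (fun i hi => h0 (i + 1) (by omega)) hz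
  rw [show ((n + 1 : ℕ) : ℝ) = 1 + n by push_cast; ring, ← this]
  unfold fracInt
  simp only [sub_self, Real.rpow_zero, Real.Gamma_one, div_one, one_mul, zero_add]
  have hsub : Icc a z ⊆ Icc a b := Icc_subset_Icc_right hz.2
  have hu : uIcc a z = Icc a z := uIcc_of_le hz.1
  rw [intervalIntegral.integral_eq_sub_of_hasDerivAt_of_le hz.1 (f := v 0), h0 0 hm, sub_zero]
  · exact (hv.continuousOn (Nat.zero_le _)).mono hsub
  · exact fun s hs => (hv.deriv 0 hm s (hsub (Ioo_subset_Icc_self hs))).hasDerivAt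
      (Icc_mem_nhds hs.1 (hs.2.trans_le hz.2))
  · apply ContinuousOn.intervalIntegrable
    rw [hu]
    exact (hv.continuousOn (by omega)).mono hsub

/-- Integration against a truncated power. -/
noncomputable def tpInt (a b p : ℝ) (q : ℝ → ℝ) (z : ℝ) : ℝ := ∫ s in a..b, tp p (z - s) * q s

theorem intervalIntegrable_tp_mul {a b p z : ℝ} {q : ℝ → ℝ} (hp : 0 < p) (hab : a ≤ b)
    (hq : ContinuousOn q (Icc a b)) :
    IntervalIntegrable (fun s => tp p (z - s) * q s) MeasureTheory.volume a b := by
  apply ContinuousOn.intervalIntegrable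
  rw [uIcc_of_le hab]
  exact ((continuous_tp hp).comp (continuous_const.sub continuous_id)).continuousOn.mul hq

theorem fracInt_eq_tpInt {a b p z : ℝ} {q : ℝ → ℝ} (hp : 0 < p) (hq : ContinuousOn q (Icc a b))
    (hz : z ∈ Icc a b) : fracInt a (p + 1) q z = tpInt a b p q z := by
  have hab : a ≤ b := hz.1.trans hz.2
  have hi := intervalIntegrable_tp_mul (z := z) hp hab hq
  unfold tpInt
  rw [← intervalIntegral.integral_add_adjacent_intervals (b := z)
    (hi.mono_set (by rw [uIcc_of_le hab, uIcc_of_le hz.1]; exact Icc_subset_Icc_right hz.2))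
    (hi.mono_set (by rw [uIcc_of_le hab, uIcc_of_le hz.2]; exact Icc_subset_Icc_left hz.1))]
  have h2 : ∫ s in z..b, tp p (z - s) * q s = 0 := by
    rw [intervalIntegral.integral_congr (g := fun _ => (0 : ℝ)), intervalIntegral.integral_zero]
    intro s hs
    rw [uIcc_of_le hz.2] at hs
    simp only
    rw [tp_of_nonpos hp (by linarith [hs.1]), zero_mul]
  rw [h2, add_zero]
  apply intervalIntegral.integral_congr
  intro s hs
  rw [uIcc_of_le hz.1] at hs
  simp only [add_sub_cancel_right]
  rw [tp_of_nonneg (by linarith [hs.2])]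

/-- Truncating the kernel fixes the interval of integration, so z enters only the integrand and one
can differentiate under the integral. -/
theorem hasDerivAt_tpInt {a b p : ℝ} {q : ℝ → ℝ} (hp : 0 < p) (hab : a ≤ b)
    (hq : ContinuousOn q (Icc a b)) (z : ℝ) :
    HasDerivAt (tpInt a b (p + 1) q) (tpInt a b p q z) z := by
  have hqi : IntervalIntegrable q MeasureTheory.volume a b := by
    apply ContinuousOn.intervalIntegrable; rwa [uIcc_of_le hab]
  have hp1 : 0 < p + 1 := by linarith
  refine (intervalIntegral.hasDerivAt_integral_of_dominated_loc_of_deriv_le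
    (s := Metric.ball z 1) (bound := fun s => tp p (z + 1 - a) * |q s|)
    (F := fun z s => tp (p + 1) (z - s) * q s) (F' := fun z s => tp p (z - s) * q s)
    (Metric.ball_mem_nhds z one_pos) ?_ ?_ ?_ ?_ ?_ ?_).2
  · exact Filter.Eventually.of_forall fun x =>
      (intervalIntegrable_tp_mul hp1 hab hq).def'.aestronglyMeasurable
  · exact intervalIntegrable_tp_mul hp1 hab hq
  · exact (intervalIntegrable_tp_mul hp hab hq).def'.aestronglyMeasurable
  · refine Filter.Eventually.of_forall fun s hs x hx => ?_
    rw [uIoc_of_le hab] at hs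
    rw [Real.norm_eq_abs, abs_mul, abs_of_nonneg (tp_nonneg hp)]
    refine mul_le_mul_of_nonneg_right (tp_mono hp ?_) (abs_nonneg _)
    rw [Metric.mem_ball, Real.dist_eq] at hx
    linarith [(abs_lt.1 hx).2, hs.1]
  · exact hqi.abs.const_mul _
  · refine Filter.Eventually.of_forall fun s _ x _ => ?_
    have := (hasDerivAt_tp hp (x - s)).comp x ((hasDerivAt_id x).sub_const s)
    simpa using this.mul_const (q s)

/-! ### Exact and discrete fractional derivatives as integrals of a higher derivative. -/

theorem floor_eq_one {α : ℝ} (h1 : 1 < α) (h2 : α < 2) : ⌊α⌋₊ = 1 := by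
  rw [Nat.floor_eq_iff (by linarith)]
  push_cast
  exact ⟨h1.le, by linarith⟩

/-- The integral of order 2 - α of v is the integral of order 8 - α of v⁽⁶⁾, and the two outer
derivatives lower this to order 6 - α. On [a, b], `tpInt` with exponent p is the integral of order p
+ 1. -/
theorem leftRL_eq_tpInt {α a b : ℝ} (h1 : 1 < α) (h2 : α < 2) {v : ℕ → ℝ → ℝ}
    (hv : IsChain a b 6 v) (h0 : ∀ i < 6, v i a = 0) {x : ℝ} (hx : x ∈ Ioo a b) :
    leftRL a α (v 0) x = tpInt a b (5 - α) (v 6) x := by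
  have hab : a ≤ b := (hx.1.trans hx.2).le
  have hG := Real.Gamma_pos_of_pos (show 0 < 2 - α by linarith)
  unfold leftRL
  rw [floor_eq_one h1 h2]
  push_cast
  have e1 : ∀ z ∈ Icc a b, ∫ s in a..z, (z - s) ^ (2 - α - 1) * v 0 s
      = Real.Gamma (2 - α) * tpInt a b (7 - α) (v 6) z := by
    intro z hz
    have := fracInt_chain (p := 2 - α) (by linarith) hv h0 hz
    rw [show 2 - α + (6 : ℕ) = (7 - α) + 1 by push_cast; ring,
      fracInt_eq_tpInt (by linarith) hv.cont hz] at this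
    rw [← this]
    unfold fracInt
    rw [← intervalIntegral.integral_const_mul]
    congr 1; ext s
    field_simp
  have e2 : (fun z => ∫ s in a..z, (z - s) ^ (2 - α - 1) * v 0 s)
      =ᶠ[nhds x] fun z => Real.Gamma (2 - α) * tpInt a b (7 - α) (v 6) z := by
    filter_upwards [Icc_mem_nhds hx.1 hx.2] with z hz using e1 z hz
  rw [e2.iteratedDeriv_eq, iteratedDeriv_succ, iteratedDeriv_one]
  have d1 : deriv (fun z => Real.Gamma (2 - α) * tpInt a b (7 - α) (v 6) z)
      = fun z => Real.Gamma (2 - α) * tpInt a b (6 - α) (v 6) z := by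
    ext z
    have := hasDerivAt_tpInt (p := 6 - α) (by linarith) hab hv.cont z
    rw [show 6 - α + 1 = 7 - α by ring] at this
    exact (this.const_mul _).deriv
  have d2 := hasDerivAt_tpInt (p := 5 - α) (by linarith) hab hv.cont x
  rw [show 5 - α + 1 = 6 - α by ring] at d2
  rw [d1, (d2.const_mul _).deriv]
  field_simp

theorem tp_eq_rpow_mul {p h x : ℝ} (hh : 0 < h) : tp p x = h ^ p * tp p (x / h) := by
  rw [← tp_mul hh.le, mul_div_cancel₀ _ hh.ne']

/-- Homogeneity of the truncated power extracts h^p, and grid shifts become integer shifts of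
(x_{j+1} - s)/h. -/
theorem leftD_tpInt {α a b h p : ℝ} {q : ℝ → ℝ} (hp : 0 < p) (hab : a ≤ b) (hh : 0 < h)
    (hq : ContinuousOn q (Icc a b)) (j : ℕ) :
    leftD α h (fun i => tpInt a b p q (a + i * h)) j
      = h ^ (p - α) * ∫ s in a..b, wsum α p (j + 2) ((a + (j + 1 : ℕ) * h - s) / h) * q s := by
  unfold leftD tpInt wsum
  have hi := fun z => intervalIntegrable_tp_mul (z := z) hp hab hq
  simp only [Finset.sum_mul]
  rw [intervalIntegral.integral_finsetSum]
  · rw [Finset.mul_sum, Finset.mul_sum]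
    refine Finset.sum_congr rfl fun k hk => ?_
    rw [← intervalIntegral.integral_const_mul, ← intervalIntegral.integral_const_mul,
      ← intervalIntegral.integral_const_mul]
    congr 1; ext s
    have hk' : k ≤ j + 1 := by simp at hk; omega
    rw [tp_eq_rpow_mul (x := a + (j + 1 - k : ℕ) * h - s) hh, Real.rpow_sub hh, Nat.cast_sub hk']
    have : (a + (((j + 1 : ℕ) : ℝ) - k) * h - s) / h = (a + (j + 1 : ℕ) * h - s) / h - k := by
      field_simp; ring
    rw [this]
    ring
  · intro k _
    have := (hi (a + (j + 1 : ℕ) * h - k * h)).const_mul (w α k * (h ^ p)⁻¹)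
    refine this.congr ?_
    intro s _
    simp only
    rw [tp_eq_rpow_mul (x := a + (j + 1 : ℕ) * h - k * h - s) hh]
    have : (a + (j + 1 : ℕ) * h - k * h - s) / h = (a + (j + 1 : ℕ) * h - s) / h - k := by
      field_simp; ring
    rw [this]
    have := (Real.rpow_pos_of_pos hh p).ne'
    field_simp

/-- With v the threefold integral of its third derivative, the factor h^{2-α} meets a kernel of size
M^{2-α}, and Mh = b - a makes the bound uniform in h. -/
theorem leftD_bound {α a b : ℝ} (h1 : 1 < α) (h2 : α < 2) (hab : a < b) :
    ∃ C, 0 ≤ C ∧ ∀ (M : ℕ) (v : ℕ → ℝ → ℝ) (B : ℝ), IsChain a b 3 v → (∀ i < 3, v i a = 0) →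
      (∀ x ∈ Icc a b, |v 3 x| ≤ B) → ∀ j ∈ Finset.Ioo 0 M,
        |leftD α ((b - a) / M) (fun i => v 0 (a + i * ((b - a) / M))) j| ≤ C * B := by
  obtain ⟨C, hC, hw⟩ := wsum_two_bound h1 h2
  have hba : 0 < b - a := sub_pos.2 hab
  refine ⟨C * (b - a) ^ (2 - α) * (b - a), by positivity, fun M v B hv h0 hB j hj => ?_⟩
  simp at hj
  have hM : (0 : ℝ) < M := by exact_mod_cast (by omega : 0 < M)
  have hM1 : (1 : ℝ) ≤ M := by exact_mod_cast (by omega : 1 ≤ M)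
  have hB0 : 0 ≤ B := (abs_nonneg _).trans (hB a (left_mem_Icc.2 hab.le))
  set h := (b - a) / M with hh
  have hh0 : 0 < h := div_pos hba hM
  have hMh : M * h = b - a := by rw [hh]; field_simp
  have e : leftD α h (fun i => v 0 (a + i * h)) j
      = leftD α h (fun i => tpInt a b 2 (v 3) (a + i * h)) j := by
    refine leftD_congr (M := M) (by simpa using hj) fun i hi => ?_
    have hi' : (i : ℝ) ≤ M := by exact_mod_cast hi
    have hz : a + i * h ∈ Icc a b := by
      constructor
      · have : 0 ≤ i * h := by positivity
        linarith
      · have : i * h ≤ M * h := by gcongr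
        linarith
    rw [eq_fracInt (by norm_num) hv h0 hz, ← fracInt_eq_tpInt (by norm_num) hv.cont hz]
    norm_num
  rw [e, leftD_tpInt two_pos hab.le hh0 hv.cont, abs_mul, abs_of_pos (Real.rpow_pos_of_pos hh0 _)]
  have hb : ‖∫ s in a..b, wsum α 2 (j + 2) ((a + (j + 1 : ℕ) * h - s) / h) * v 3 s‖
      ≤ C * (M : ℝ) ^ (2 - α) * B * |b - a| := by
    refine intervalIntegral.norm_integral_le_of_norm_le_const fun s hs => ?_
    rw [uIoc_of_le hab.le] at hs
    have hz : (a + (j + 1 : ℕ) * h - s) / h ≤ (j + 1 : ℕ) := by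
      rw [div_le_iff₀ hh0]; linarith [hs.1]
    have hjM : ((j + 1 : ℕ) : ℝ) ≤ M := by exact_mod_cast hj.2
    rw [norm_mul]
    refine mul_le_mul ((hw j _ (hz.trans ?_)).trans ?_) (hB s ⟨hs.1.le, hs.2⟩) (norm_nonneg _)
      (by positivity)
    · push_cast; linarith
    · gcongr
      exact max_le (hz.trans hjM) hM1
  rw [Real.norm_eq_abs] at hb
  calc _ ≤ h ^ (2 - α) * (C * (M : ℝ) ^ (2 - α) * B * |b - a|) := by gcongr
    _ = C * (M * h) ^ (2 - α) * (b - a) * B := by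
        rw [abs_of_pos hba, Real.mul_rpow hM.le hh0.le]; ring
    _ = _ := by rw [hMh]

theorem peanoKernel_of_nonpos {α : ℝ} (h2 : α < 2) (N : ℕ) {z : ℝ} (hz : z ≤ 0) :
    peanoKernel α N z = 0 := by
  unfold peanoKernel wsum
  have hp : 0 < 5 - α := by linarith
  rw [tp_of_nonpos hp (by linarith), tp_of_nonpos hp (by linarith), tp_of_nonpos hp hz,
    Finset.sum_eq_zero]
  · simp
  · intro k _
    have : (0 : ℝ) ≤ k := Nat.cast_nonneg k
    rw [tp_of_nonpos (by norm_num) (by linarith), mul_zero]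

/-- Both terms are integrals of v⁽⁶⁾ with prefactor h^{5-α}, and their kernels differ by
`peanoKernel`. The kernel bound scales as h^{α-1} (x_{j+1} - s)^{1-α}, integrable since α < 2, and
the powers of h multiply to h⁴. -/
theorem leftD_consistency {α a b : ℝ} (h1 : 1 < α) (h2 : α < 2) (hab : a < b) :
    ∃ C, 0 ≤ C ∧ ∀ (M : ℕ) (v : ℕ → ℝ → ℝ) (B : ℝ), IsChain a b 6 v → (∀ i < 6, v i a = 0) →
      (∀ x ∈ Icc a b, |v 6 x| ≤ B) → ∀ j ∈ Finset.Ioo 0 M,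
        |leftD α ((b - a) / M) (fun i => v 0 (a + i * ((b - a) / M))) j
          - P α ((b - a) / M) (fun i => tpInt a b (5 - α) (v 6) (a + i * ((b - a) / M))) j|
        ≤ C * B * ((b - a) / M) ^ 4 := by
  obtain ⟨C, hC, hw⟩ := peanoKernel_bound h1 h2
  have hba : 0 < b - a := sub_pos.2 hab
  have hα2 : 0 < 2 - α := by linarith
  have hp5 : 0 < 5 - α := by linarith
  refine ⟨C * ((b - a) ^ (2 - α) / (2 - α)), by positivity, fun M v B hv h0 hB j hj => ?_⟩
  have hj' := hj
  simp at hj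
  have hM : (0 : ℝ) < M := by exact_mod_cast (by omega : 0 < M)
  have hB0 : 0 ≤ B := (abs_nonneg _).trans (hB a (left_mem_Icc.2 hab.le))
  set h := (b - a) / M with hh
  have hh0 : 0 < h := div_pos hba hM
  have hMh : M * h = b - a := by rw [hh]; field_simp
  have e : leftD α h (fun i => v 0 (a + i * h)) j
      = leftD α h (fun i => tpInt a b 5 (v 6) (a + i * h)) j := by
    refine leftD_congr (M := M) hj' fun i hi => ?_
    have hi' : (i : ℝ) ≤ M := by exact_mod_cast hi
    have hz : a + i * h ∈ Icc a b := by
      constructor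
      · have : 0 ≤ i * h := by positivity
        linarith
      · have : i * h ≤ M * h := by gcongr
        linarith
    rw [eq_fracInt (by norm_num) hv h0 hz, ← fracInt_eq_tpInt (by norm_num) hv.cont hz]
    norm_num
  set y : ℝ := a + (j + 1 : ℕ) * h with hy
  have hya : a ≤ y := by have : 0 ≤ ((j + 1 : ℕ) : ℝ) * h := by positivity
                         linarith
  have hyb : y ≤ b := by
    have : ((j + 1 : ℕ) : ℝ) ≤ M := by exact_mod_cast hj.2
    have : ((j + 1 : ℕ) : ℝ) * h ≤ M * h := by gcongr
    linarith
  have ti : ∀ c : ℝ, tpInt a b (5 - α) (v 6) (y - c * h)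
      = h ^ (5 - α) * ∫ s in a..b, tp (5 - α) ((y - s) / h - c) * v 6 s := by
    intro c
    unfold tpInt
    rw [← intervalIntegral.integral_const_mul]
    congr 1; ext s
    rw [tp_eq_rpow_mul (x := y - c * h - s) hh0, show (y - c * h - s) / h = (y - s) / h - c by
      field_simp; ring]
    ring
  have hint : ∀ c : ℝ, IntervalIntegrable (fun s => tp (5 - α) ((y - s) / h - c) * v 6 s)
      MeasureTheory.volume a b := by
    intro c
    apply ContinuousOn.intervalIntegrable
    rw [uIcc_of_le hab.le]
    exact ((continuous_tp hp5).comp (by fun_prop)).continuousOn.mul hv.cont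
  have hintw : IntervalIntegrable (fun s => wsum α 5 (j + 2) ((y - s) / h) * v 6 s)
      MeasureTheory.volume a b := by
    apply ContinuousOn.intervalIntegrable
    rw [uIcc_of_le hab.le]
    refine ContinuousOn.mul (Continuous.continuousOn ?_) hv.cont
    unfold wsum
    exact continuous_finsetSum _ fun k _ =>
      continuous_const.mul ((continuous_tp (by norm_num)).comp (by fun_prop))
  have hP : P α h (fun i => tpInt a b (5 - α) (v 6) (a + i * h)) j
      = h ^ (5 - α) * ∫ s in a..b, (tp (5 - α) ((y - s) / h - 1)
        + b₂ α * (tp (5 - α) ((y - s) / h - 2) - 2 * tp (5 - α) ((y - s) / h - 1)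
          + tp (5 - α) ((y - s) / h - 0))) * v 6 s := by
    have hj1 : ((j - 1 : ℕ) : ℝ) = j - 1 := by rw [Nat.cast_sub (by omega)]; simp
    have y0 : a + ((j + 1 : ℕ) : ℝ) * h = y - 0 * h := by rw [hy]; ring
    have y1 : a + (j : ℝ) * h = y - 1 * h := by rw [hy]; push_cast; ring
    have y2 : a + ((j - 1 : ℕ) : ℝ) * h = y - 2 * h := by rw [hy, hj1]; push_cast; ring
    rw [P_eq hh0.ne', y0, y1, y2, ti, ti, ti]
    have : ∀ s, (tp (5 - α) ((y - s) / h - 1)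
        + b₂ α * (tp (5 - α) ((y - s) / h - 2) - 2 * tp (5 - α) ((y - s) / h - 1)
          + tp (5 - α) ((y - s) / h - 0))) * v 6 s
        = (1 - 2 * b₂ α) * (tp (5 - α) ((y - s) / h - 1) * v 6 s)
          + b₂ α * (tp (5 - α) ((y - s) / h - 2) * v 6 s)
          + b₂ α * (tp (5 - α) ((y - s) / h - 0) * v 6 s) := fun s => by ring
    simp only [this]
    rw [intervalIntegral.integral_add (((hint 1).const_mul _).add ((hint 2).const_mul _))
      ((hint 0).const_mul _), intervalIntegral.integral_add ((hint 1).const_mul _)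
      ((hint 2).const_mul _)]
    simp only [intervalIntegral.integral_const_mul]
    ring
  have hintP : IntervalIntegrable (fun s => (tp (5 - α) ((y - s) / h - 1)
        + b₂ α * (tp (5 - α) ((y - s) / h - 2) - 2 * tp (5 - α) ((y - s) / h - 1)
          + tp (5 - α) ((y - s) / h - 0))) * v 6 s) MeasureTheory.volume a b := by
    apply ContinuousOn.intervalIntegrable
    rw [uIcc_of_le hab.le]
    refine ContinuousOn.mul (Continuous.continuousOn ?_) hv.cont
    have := fun c : ℝ => (continuous_tp hp5).comp (show Continuous fun s => (y - s) / h - c by fun_prop)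
    exact (this 1).add (continuous_const.mul (((this 2).sub (continuous_const.mul (this 1))).add
      (this 0)))
  rw [e, leftD_tpInt (by norm_num) hab.le hh0 hv.cont, hP, ← mul_sub,
    ← intervalIntegral.integral_sub hintw hintP]
  have hK : ∀ s, wsum α 5 (j + 2) ((y - s) / h) * v 6 s - (tp (5 - α) ((y - s) / h - 1)
        + b₂ α * (tp (5 - α) ((y - s) / h - 2) - 2 * tp (5 - α) ((y - s) / h - 1)
          + tp (5 - α) ((y - s) / h - 0))) * v 6 s = peanoKernel α j ((y - s) / h) * v 6 s := by
    intro s; unfold peanoKernel; rw [sub_zero]; ring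
  have hintK : IntervalIntegrable (fun s => peanoKernel α j ((y - s) / h) * v 6 s)
      MeasureTheory.volume a b := (hintw.sub hintP).congr
        fun s _ => hK s
  simp only [hK]
  rw [← intervalIntegral.integral_add_adjacent_intervals (b := y)
    (hintK.mono_set (by rw [uIcc_of_le hab.le, uIcc_of_le hya]; exact Icc_subset_Icc_right hyb))
    (hintK.mono_set (by rw [uIcc_of_le hab.le, uIcc_of_le hyb]; exact Icc_subset_Icc_left hya))]
  have hz : ∫ s in y..b, peanoKernel α j ((y - s) / h) * v 6 s = 0 := by
    rw [intervalIntegral.integral_congr (g := fun _ => (0 : ℝ)), intervalIntegral.integral_zero]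
    intro s hs
    rw [uIcc_of_le hyb] at hs
    simp only
    rw [peanoKernel_of_nonpos h2 _ (div_nonpos_of_nonpos_of_nonneg (by linarith [hs.1]) hh0.le),
      zero_mul]
  rw [hz, add_zero, abs_mul, abs_of_pos (Real.rpow_pos_of_pos hh0 _)]
  have hmain : ‖∫ s in a..y, peanoKernel α j ((y - s) / h) * v 6 s‖
      ≤ ∫ s in a..y, C * B * h ^ (α - 1) * (y - s) ^ (1 - α) := by
    refine intervalIntegral.norm_integral_le_of_norm_le hya ?_ ?_
    · refine Filter.Eventually.of_forall fun s hs => ?_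
      rcases hs.2.eq_or_lt with rfl | hsy
      -- At s = y the majorant is zero, since `0 ^ (1 - α) = 0` for real powers; the kernel vanishes
      -- there as well.
      · rw [sub_self, zero_div, peanoKernel_of_nonpos h2 _ le_rfl, zero_mul, norm_zero,
          Real.zero_rpow (by linarith), mul_zero]
      · have hz0 : 0 < (y - s) / h := div_pos (by linarith) hh0
        have hzj : (y - s) / h ≤ (j + 2 : ℕ) := by
          rw [div_le_iff₀ hh0]
          have : y = a + (j + 1) * h := by rw [hy]; push_cast; ring
          push_cast
          nlinarith [hs.1]
        rw [norm_mul]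
        calc _ ≤ C * ((y - s) / h) ^ (1 - α) * B :=
              mul_le_mul (hw j _ hz0 hzj) (hB s ⟨hs.1.le, hs.2.trans hyb⟩) (abs_nonneg _)
                (by positivity)
          _ = _ := by
              rw [Real.div_rpow (by linarith) hh0.le, show α - 1 = -(1 - α) by ring,
                Real.rpow_neg hh0.le]
              ring
    · have := intervalIntegrable_sub_rpow (a := a) (z := y) (p := 2 - α) hα2
      rw [show 2 - α - 1 = 1 - α by ring] at this
      exact this.const_mul _
  have hI : ∫ s in a..y, (y - s) ^ (1 - α) = (y - a) ^ (2 - α) / (2 - α) := by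
    rw [intervalIntegral.integral_comp_sub_left (fun x => x ^ (1 - α)) y, sub_self,
      integral_rpow (Or.inl (by linarith)), show 1 - α + 1 = 2 - α by ring,
      Real.zero_rpow hα2.ne', sub_zero]
  rw [intervalIntegral.integral_const_mul, hI, Real.norm_eq_abs] at hmain
  calc _ ≤ h ^ (5 - α) * (C * B * h ^ (α - 1) * ((y - a) ^ (2 - α) / (2 - α))) := by gcongr
    _ ≤ h ^ (5 - α) * (C * B * h ^ (α - 1) * ((b - a) ^ (2 - α) / (2 - α))) := by
        gcongr
    _ = C * ((b - a) ^ (2 - α) / (2 - α)) * B * (h ^ (5 - α) * h ^ (α - 1)) := by ring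
    _ = _ := by
        rw [← Real.rpow_add hh0, show 5 - α + (α - 1) = (4 : ℕ) by push_cast; ring,
          Real.rpow_natCast]

end FracDiffusion
namespace FracDiffusion

/-! Two-sided operators. -/

/-- The chain of derivatives of the reflected function `x ↦ v (a + b - x)`. -/
noncomputable def reflect (a b : ℝ) (v : ℕ → ℝ → ℝ) (i : ℕ) (x : ℝ) : ℝ := (-1) ^ i * v i (a + b - x)

theorem add_sub_mem_Icc {a b x : ℝ} (hx : x ∈ Icc a b) : a + b - x ∈ Icc a b :=
  ⟨by linarith [hx.2], by linarith [hx.1]⟩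

theorem IsChain.reflect {a b : ℝ} {m : ℕ} {v : ℕ → ℝ → ℝ} (h : IsChain a b m v) :
    IsChain a b m (reflect a b v) := by
  constructor
  · intro i hi x hx
    have h1 := h.deriv i hi _ (add_sub_mem_Icc hx)
    have h2 : HasDerivWithinAt (fun x => a + b - x) (-1) (Icc a b) x :=
      ((hasDerivAt_id x).const_sub (a + b)).hasDerivWithinAt
    have h3 := (h1.comp x h2 fun _ hy => add_sub_mem_Icc hy).const_mul ((-1) ^ i)
    refine h3.congr_deriv ?_
    unfold FracDiffusion.reflect
    rw [pow_succ]; ring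
  · exact continuousOn_const.mul
      (h.cont.comp (by fun_prop) fun _ hy => add_sub_mem_Icc hy)

theorem reflect_bound {a b B : ℝ} {m : ℕ} {v : ℕ → ℝ → ℝ} (hB : ∀ x ∈ Icc a b, |v m x| ≤ B) :
    ∀ x ∈ Icc a b, |reflect a b v m x| ≤ B := by
  intro x hx
  unfold reflect
  rw [abs_mul, abs_pow, abs_neg, abs_one, one_pow, one_mul]
  exact hB _ (add_sub_mem_Icc hx)

theorem reflect_zero {a b : ℝ} {m : ℕ} {v : ℕ → ℝ → ℝ} (h0 : ∀ i < m, v i b = 0) :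
    ∀ i < m, reflect a b v i a = 0 := by
  intro i hi
  unfold reflect
  rw [add_sub_cancel_left, h0 i hi, mul_zero]

theorem rightRL_eq_leftRL {α b : ℝ} (h1 : 1 < α) (h2 : α < 2) (a : ℝ) (v : ℝ → ℝ) (x : ℝ) :
    rightRL b α v x = leftRL a α (fun s => v (a + b - s)) (a + b - x) := by
  unfold rightRL leftRL
  rw [floor_eq_one h1 h2]
  congr 1
  · norm_num
  · have e : (fun z => ∫ s in z..b, (s - z) ^ (((1 + 1 : ℕ) : ℝ) - α - 1) * v s)
        = fun z => (fun z => ∫ s in a..z, (z - s) ^ (((1 + 1 : ℕ) : ℝ) - α - 1) * v (a + b - s))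
          (a + b - z) := by
      ext z
      have := intervalIntegral.integral_comp_sub_left (a := a) (b := a + b - z)
        (fun s => (s - z) ^ (((1 + 1 : ℕ) : ℝ) - α - 1) * v s) (a + b)
      simp only [sub_sub_cancel, add_sub_cancel_left] at this
      rw [← this]
      congr 1; ext s
      rw [show a + b - s - z = a + b - z - s by ring]
    have h := congrFun (iteratedDeriv_comp_const_sub (n := 1 + 1) (s := a + b) (f := fun z => ∫ s in a..z,
      (z - s) ^ (((1 + 1 : ℕ) : ℝ) - α - 1) * v (a + b - s))) x
    rw [e]
    refine h.trans ?_
    norm_num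

/-- The two-sided derivative `K₁ D_left + K₂ D_right` in terms of the sixth derivative `q`. -/
noncomputable def fracOp (a b α K₁ K₂ : ℝ) (q : ℝ → ℝ) (x : ℝ) : ℝ :=
  K₁ * tpInt a b (5 - α) q x + K₂ * tpInt a b (5 - α) (fun s => q (a + b - s)) (a + b - x)

/-- A zero coefficient removes both a term and the end conditions that the term would need. `fracOp`
is continuous up to the end points, where `P` samples it. -/
theorem RL_eq_fracOp {α a b K₁ K₂ : ℝ} (h1 : 1 < α) (h2 : α < 2) {v : ℕ → ℝ → ℝ}
    (hv : IsChain a b 6 v) (ha : K₁ ≠ 0 → ∀ i < 6, v i a = 0) (hb : K₂ ≠ 0 → ∀ i < 6, v i b = 0)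
    {x : ℝ} (hx : x ∈ Ioo a b) :
    K₁ * leftRL a α (v 0) x + K₂ * rightRL b α (v 0) x = fracOp a b α K₁ K₂ (v 6) x := by
  unfold fracOp
  congr 1
  · rcases eq_or_ne K₁ 0 with rfl | hK
    · simp
    · rw [leftRL_eq_tpInt h1 h2 hv (ha hK) hx]
  · rcases eq_or_ne K₂ 0 with rfl | hK
    · simp
    · rw [rightRL_eq_leftRL h1 h2 a]
      have := leftRL_eq_tpInt h1 h2 hv.reflect (reflect_zero (hb hK))
        (x := a + b - x) ⟨by linarith [hx.2], by linarith [hx.1]⟩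
      unfold reflect at this
      norm_num at this
      rw [this]

theorem rightD_eq_leftD_reflect {α a b : ℝ} {M j : ℕ} (v : ℕ → ℝ → ℝ) (hj : j ∈ Finset.Ioo 0 M) :
    rightD α ((b - a) / M) M (fun i => v 0 (a + i * ((b - a) / M))) j
      = leftD α ((b - a) / M) (fun i => reflect a b v 0 (a + i * ((b - a) / M))) (M - j) := by
  rw [rightD_eq_leftD α _ _ hj]
  simp at hj
  refine leftD_congr (M := M) (by simp; omega) fun i hi => ?_
  have hM : (M : ℝ) ≠ 0 := by
    have : M ≠ 0 := by omega
    exact_mod_cast this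
  unfold reflect
  rw [pow_zero, one_mul, Nat.cast_sub hi]
  congr 1
  field_simp
  ring

theorem P_reflect {α h : ℝ} {M j : ℕ} (hh : h ≠ 0) {u v : ℕ → ℝ} (hj : j ∈ Finset.Ioo 0 M)
    (huv : ∀ i ≤ M, u i = v (M - i)) : P α h u j = P α h v (M - j) := by
  simp at hj
  rw [P_eq hh, P_eq hh, huv _ (by omega), huv _ (by omega), huv _ (by omega),
    show M - (j - 1) = M - j + 1 by omega, show M - (j + 1) = M - j - 1 by omega]
  ring

theorem deltaFrac_bound {α a b : ℝ} (h1 : 1 < α) (h2 : α < 2) (hab : a < b) (K₁ K₂ : ℝ) :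
    ∃ C, 0 ≤ C ∧ ∀ (M : ℕ) (v : ℕ → ℝ → ℝ) (B : ℝ), IsChain a b 3 v →
      (K₁ ≠ 0 → ∀ i < 3, v i a = 0) → (K₂ ≠ 0 → ∀ i < 3, v i b = 0) →
      (∀ x ∈ Icc a b, |v 3 x| ≤ B) → ∀ j ∈ Finset.Ioo 0 M,
        |deltaFrac α K₁ K₂ ((b - a) / M) M (fun i => v 0 (a + i * ((b - a) / M))) j| ≤ C * B := by
  obtain ⟨C, hC, H⟩ := leftD_bound h1 h2 hab
  refine ⟨|K₁| * C + |K₂| * C, by positivity, fun M v B hv ha hb hB j hj => ?_⟩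
  have hj' : M - j ∈ Finset.Ioo 0 M := by simp at hj ⊢; omega
  unfold deltaFrac
  rw [add_mul]
  refine (abs_add_le _ _).trans (add_le_add ?_ ?_)
  · rcases eq_or_ne K₁ 0 with rfl | hK
    · simp
    · rw [abs_mul, mul_assoc]
      exact mul_le_mul_of_nonneg_left (H M v B hv (ha hK) hB j hj) (abs_nonneg _)
  · rcases eq_or_ne K₂ 0 with rfl | hK
    · simp
    · rw [abs_mul, mul_assoc, rightD_eq_leftD_reflect v hj]
      exact mul_le_mul_of_nonneg_left (H M _ B hv.reflect (reflect_zero (hb hK))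
        (reflect_bound hB) _ hj') (abs_nonneg _)

theorem P_add_mul (α h k l : ℝ) (u v : ℕ → ℝ) (j : ℕ) :
    P α h (fun i => k * u i + l * v i) j = k * P α h u j + l * P α h v j := by
  unfold P; ring

theorem deltaFrac_consistency {α a b : ℝ} (h1 : 1 < α) (h2 : α < 2) (hab : a < b) (K₁ K₂ : ℝ) :
    ∃ C, 0 ≤ C ∧ ∀ (M : ℕ) (v : ℕ → ℝ → ℝ) (B : ℝ), IsChain a b 6 v →
      (K₁ ≠ 0 → ∀ i < 6, v i a = 0) → (K₂ ≠ 0 → ∀ i < 6, v i b = 0) →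
      (∀ x ∈ Icc a b, |v 6 x| ≤ B) → ∀ j ∈ Finset.Ioo 0 M,
        |deltaFrac α K₁ K₂ ((b - a) / M) M (fun i => v 0 (a + i * ((b - a) / M))) j
          - P α ((b - a) / M) (fun i => fracOp a b α K₁ K₂ (v 6) (a + i * ((b - a) / M))) j|
        ≤ C * B * ((b - a) / M) ^ 4 := by
  obtain ⟨C, hC, H⟩ := leftD_consistency h1 h2 hab
  refine ⟨|K₁| * C + |K₂| * C, by positivity, fun M v B hv ha hb hB j hj => ?_⟩
  have hj' : M - j ∈ Finset.Ioo 0 M := by simp at hj ⊢; omega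
  have hM : (M : ℝ) ≠ 0 := by
    have : M ≠ 0 := by simp at hj; omega
    exact_mod_cast this
  have hh : (b - a) / M ≠ 0 := div_ne_zero (sub_pos.2 hab).ne' hM
  unfold deltaFrac fracOp
  rw [P_add_mul, add_sub_add_comm, ← mul_sub, ← mul_sub, add_mul, add_mul]
  refine (abs_add_le _ _).trans (add_le_add ?_ ?_)
  · rcases eq_or_ne K₁ 0 with rfl | hK
    · simp
    · rw [abs_mul, mul_assoc |K₁|, mul_assoc |K₁|]
      exact mul_le_mul_of_nonneg_left (H M v B hv (ha hK) hB j hj) (abs_nonneg _)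
  · rcases eq_or_ne K₂ 0 with rfl | hK
    · simp
    · rw [abs_mul, mul_assoc |K₂|, mul_assoc |K₂|, rightD_eq_leftD_reflect v hj,
        P_reflect (v := fun i => tpInt a b (5 - α) (reflect a b v 6) (a + i * ((b - a) / M))) hh hj]
      · exact mul_le_mul_of_nonneg_left (H M _ B hv.reflect (reflect_zero (hb hK))
          (reflect_bound hB) _ hj') (abs_nonneg _)
      · intro i hi
        rw [Nat.cast_sub hi]
        have e : reflect a b v 6 = fun s => v 6 (a + b - s) := by
          ext s; unfold reflect; norm_num
        rw [e]
        congr 1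
        field_simp
        ring

/-- Dominated convergence with a constant majorant; it lets the differential equation pass to the
boundary nodes. -/
theorem continuousOn_tpInt {X : Type*} [TopologicalSpace X] [FirstCountableTopology X] {S : Set X}
    {a b p B : ℝ} (hp : 0 < p) (hab : a ≤ b) {x : X → ℝ} {q : X → ℝ → ℝ} (hx : ContinuousOn x S)
    (hxb : ∀ r ∈ S, x r ≤ b) (hq : ∀ r ∈ S, ContinuousOn (q r) (Icc a b))
    (hqr : ∀ s ∈ Icc a b, ContinuousOn (fun r => q r s) S)
    (hB : ∀ r ∈ S, ∀ s ∈ Icc a b, |q r s| ≤ B) :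
    ContinuousOn (fun r => tpInt a b p (q r) (x r)) S := by
  intro r₀ hr₀
  unfold tpInt
  refine intervalIntegral.continuousWithinAt_of_dominated_interval
    (bound := fun _ => tp p (b - a) * B) ?_ ?_ intervalIntegrable_const ?_
  · filter_upwards [self_mem_nhdsWithin] with r hr
    exact (intervalIntegrable_tp_mul hp hab (hq r hr)).def'.aestronglyMeasurable
  · filter_upwards [self_mem_nhdsWithin] with r hr
    refine Filter.Eventually.of_forall fun s hs => ?_
    rw [uIoc_of_le hab] at hs
    have hs' : s ∈ Icc a b := ⟨hs.1.le, hs.2⟩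
    rw [Real.norm_eq_abs, abs_mul, abs_of_nonneg (tp_nonneg hp)]
    exact mul_le_mul (tp_mono hp (by linarith [hxb r hr, hs.1])) (hB r hr s hs') (abs_nonneg _)
      (tp_nonneg hp)
  · refine Filter.Eventually.of_forall fun s hs => ?_
    rw [uIoc_of_le hab] at hs
    have hs' : s ∈ Icc a b := ⟨hs.1.le, hs.2⟩
    exact ((continuous_tp hp).continuousAt.comp_continuousWithinAt
      ((hx r₀ hr₀).sub continuousWithinAt_const)).mul (hqr s hs' r₀ hr₀)

theorem continuousOn_fracOp {X : Type*} [TopologicalSpace X] [FirstCountableTopology X] {S : Set X}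
    {a b α K₁ K₂ B : ℝ} (hα : α < 2) (hab : a ≤ b) {x : X → ℝ} {q : X → ℝ → ℝ}
    (hx : ContinuousOn x S) (hxab : ∀ r ∈ S, x r ∈ Icc a b)
    (hq : ∀ r ∈ S, ContinuousOn (q r) (Icc a b))
    (hqr : ∀ s ∈ Icc a b, ContinuousOn (fun r => q r s) S)
    (hB : ∀ r ∈ S, ∀ s ∈ Icc a b, |q r s| ≤ B) :
    ContinuousOn (fun r => fracOp a b α K₁ K₂ (q r) (x r)) S := by
  have hp : 0 < 5 - α := by linarith
  refine (continuousOn_const.mul (continuousOn_tpInt hp hab hx (fun r hr => (hxab r hr).2) hq hqr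
    hB)).add (continuousOn_const.mul (continuousOn_tpInt (B := B) hp hab (continuousOn_const.sub hx)
    (fun r hr => (add_sub_mem_Icc (hxab r hr)).2) ?_ ?_ ?_))
  · exact fun r hr => (hq r hr).comp (by fun_prop) fun _ hy => add_sub_mem_Icc hy
  · exact fun s hs => hqr _ (add_sub_mem_Icc hs)
  · exact fun r hr s hs => hB r hr _ (add_sub_mem_Icc hs)

end FracDiffusion
namespace FracDiffusion

/-! Derivatives of the zero extension. -/

namespace Data

/-- The set on which the zero extension is smooth. -/
def domain (D : Data) : Set (ℝ × ℝ × ℝ) :=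
  extInterval D.Kx₁ D.Kx₂ D.a D.b ×ˢ extInterval D.Ky₁ D.Ky₂ D.c D.d ×ˢ Icc 0 D.T

def box (D : Data) : Set (ℝ × ℝ × ℝ) := Icc D.a D.b ×ˢ Icc D.c D.d ×ˢ Icc 0 D.T

end Data

theorem Icc_subset_extInterval (K₁ K₂ a b : ℝ) : Icc a b ⊆ extInterval K₁ K₂ a b :=
  fun _ hx => ⟨fun _ => hx.1, fun _ => hx.2⟩

theorem uniqueDiffOn_extInterval (K₁ K₂ : ℝ) {a b : ℝ} (hab : a < b) :
    UniqueDiffOn ℝ (extInterval K₁ K₂ a b) := by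
  apply uniqueDiffOn_convex
  · intro x hx y hy s t hs ht hst
    simp only [extInterval, mem_ofPred_eq, smul_eq_mul] at *
    refine ⟨fun h => ?_, fun h => ?_⟩
    · have := hx.1 h
      have := hy.1 h
      have : a = s * a + t * a := by rw [← add_mul, hst, one_mul]
      nlinarith
    · have := hx.2 h
      have := hy.2 h
      have : b = s * b + t * b := by rw [← add_mul, hst, one_mul]
      nlinarith
  · refine Set.Nonempty.mono (interior_mono (Icc_subset_extInterval K₁ K₂ a b)) ?_
    rw [interior_Icc]
    exact nonempty_Ioo.2 hab

namespace Data

variable (D : Data)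

theorem box_subset_domain : D.box ⊆ D.domain :=
  prod_mono (Icc_subset_extInterval _ _ _ _) (prod_mono (Icc_subset_extInterval _ _ _ _) le_rfl)

theorem isCompact_box : IsCompact D.box := isCompact_Icc.prod (isCompact_Icc.prod isCompact_Icc)

theorem uniqueDiffOn_domain : UniqueDiffOn ℝ D.domain :=
  (uniqueDiffOn_extInterval _ _ D.hab).prod
    ((uniqueDiffOn_extInterval _ _ D.hcd).prod (uniqueDiffOn_Icc D.hT))

/-- Directional derivative within the domain. -/
noncomputable def pderiv (e : ℝ × ℝ × ℝ) (H : ℝ × ℝ × ℝ → ℝ) (p : ℝ × ℝ × ℝ) : ℝ :=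
  fderivWithin ℝ H D.domain p e

noncomputable abbrev dx : (ℝ × ℝ × ℝ → ℝ) → ℝ × ℝ × ℝ → ℝ := D.pderiv (1, 0, 0)

noncomputable abbrev dy : (ℝ × ℝ × ℝ → ℝ) → ℝ × ℝ × ℝ → ℝ := D.pderiv (0, 1, 0)

noncomputable abbrev dt : (ℝ × ℝ × ℝ → ℝ) → ℝ × ℝ × ℝ → ℝ := D.pderiv (0, 0, 1)

/-- Functions of class `C^n` on the domain which vanish off the rectangle. -/
structure IsSmooth (n : ℕ) (H : ℝ × ℝ × ℝ → ℝ) : Prop where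
  contDiffOn : ContDiffOn ℝ n H D.domain
  eq_zero : ∀ p ∈ D.domain, ¬(p.1 ∈ Icc D.a D.b ∧ p.2.1 ∈ Icc D.c D.d) → H p = 0

variable {D} {n : ℕ} {H : ℝ × ℝ × ℝ → ℝ}

theorem IsSmooth.mono (hH : D.IsSmooth n H) {m : ℕ} (hm : m ≤ n) : D.IsSmooth m H :=
  ⟨hH.contDiffOn.of_le (by exact_mod_cast hm), hH.eq_zero⟩

/-- The vanishing condition is inherited because the complement of the closed rectangle is open: H
is zero on a relative neighbourhood of each such point. -/
theorem IsSmooth.pderiv (hH : D.IsSmooth (n + 1) H) (e : ℝ × ℝ × ℝ) :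
    D.IsSmooth n (D.pderiv e H) := by
  refine ⟨(hH.contDiffOn.fderivWithin D.uniqueDiffOn_domain
    (by push_cast; exact le_rfl)).clm_apply contDiffOn_const, fun p hp hpb => ?_⟩
  have hcl : IsClosed {p : ℝ × ℝ × ℝ | p.1 ∈ Icc D.a D.b ∧ p.2.1 ∈ Icc D.c D.d} :=
    (isClosed_Icc.preimage continuous_fst).inter
      (isClosed_Icc.preimage (continuous_fst.comp continuous_snd))
  have h0 : H =ᶠ[nhdsWithin p D.domain] fun _ => 0 := by
    filter_upwards [self_mem_nhdsWithin, mem_nhdsWithin_of_mem_nhds (hcl.isOpen_compl.mem_nhds hpb)]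
      with q hq hqb using hH.eq_zero q hq hqb
  unfold Data.pderiv
  rw [h0.fderivWithin_eq (hH.eq_zero p hp hpb)]
  simp

theorem IsSmooth.iterate_pderiv {e : ℝ × ℝ × ℝ} {i : ℕ} :
    ∀ {n : ℕ}, D.IsSmooth (n + i) H → D.IsSmooth n ((D.pderiv e)^[i] H) := by
  induction i with
  | zero => exact fun h => h
  | succ i ih =>
    intro n h
    rw [Function.iterate_succ_apply']
    exact (ih (n := n + 1) (by rwa [add_assoc, add_comm 1])).pderiv e

theorem IsSmooth.continuousOn (hH : D.IsSmooth n H) : ContinuousOn H D.domain :=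
  hH.contDiffOn.continuousOn

theorem IsSmooth.continuousOn_box (hH : D.IsSmooth n H) : ContinuousOn H D.box :=
  hH.continuousOn.mono D.box_subset_domain

theorem IsSmooth.exists_bound (hH : D.IsSmooth n H) :
    ∃ B, 0 ≤ B ∧ ∀ x ∈ Icc D.a D.b, ∀ y ∈ Icc D.c D.d, ∀ t ∈ Icc 0 D.T, |H (x, y, t)| ≤ B := by
  obtain ⟨B, hB⟩ := D.isCompact_box.exists_bound_of_continuousOn hH.continuousOn_box
  exact ⟨max B 0, le_max_right _ _, fun x hx y hy t ht =>
    (hB (x, y, t) ⟨hx, hy, ht⟩).trans (le_max_left _ _)⟩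

theorem IsSmooth.hasDerivWithinAt (hH : D.IsSmooth (n + 1) H) {e : ℝ × ℝ × ℝ}
    {γ : ℝ → ℝ × ℝ × ℝ} {I : Set ℝ} (hγ : ∀ r, HasDerivAt γ e r) (hI : ∀ r ∈ I, γ r ∈ D.box) {r : ℝ}
    (hr : r ∈ I) : HasDerivWithinAt (fun r => H (γ r)) (D.pderiv e H (γ r)) I r := by
  have h1 := (hH.contDiffOn.differentiableOn (by simp) (γ r)
    (D.box_subset_domain (hI r hr))).hasFDerivWithinAt
  exact h1.comp_hasDerivWithinAt r (hγ r).hasDerivWithinAt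
    fun s hs => D.box_subset_domain (hI s hs)

theorem hasDerivAt_lineX (y t r : ℝ) : HasDerivAt (fun x : ℝ => (x, y, t)) (1, 0, 0) r :=
  (hasDerivAt_id r).prodMk ((hasDerivAt_const r y).prodMk (hasDerivAt_const r t))

theorem hasDerivAt_lineY (x t r : ℝ) : HasDerivAt (fun y : ℝ => (x, y, t)) (0, 1, 0) r :=
  (hasDerivAt_const r x).prodMk ((hasDerivAt_id r).prodMk (hasDerivAt_const r t))

theorem hasDerivAt_lineT (x y r : ℝ) : HasDerivAt (fun t : ℝ => (x, y, t)) (0, 0, 1) r :=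
  (hasDerivAt_const r x).prodMk ((hasDerivAt_const r y).prodMk (hasDerivAt_id r))

theorem IsSmooth.iterate_hasDerivWithinAt {m i : ℕ} (hH : D.IsSmooth (n + m) H) (hi : i < m)
    {e : ℝ × ℝ × ℝ} {γ : ℝ → ℝ × ℝ × ℝ} {I : Set ℝ} (hγ : ∀ r, HasDerivAt γ e r)
    (hI : ∀ r ∈ I, γ r ∈ D.box) {r : ℝ} (hr : r ∈ I) :
    HasDerivWithinAt (fun r => (D.pderiv e)^[i] H (γ r)) ((D.pderiv e)^[i + 1] H (γ r)) I r := by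
  rw [Function.iterate_succ_apply']
  refine IsSmooth.hasDerivWithinAt (n := 0) ?_ hγ hI hr
  exact IsSmooth.iterate_pderiv (hH.mono (by omega))

theorem IsSmooth.isChain {m : ℕ} (hH : D.IsSmooth (n + m) H) {a b : ℝ} {e : ℝ × ℝ × ℝ}
    {γ : ℝ → ℝ × ℝ × ℝ} (hγ : ∀ r, HasDerivAt γ e r) (hI : ∀ r ∈ Icc a b, γ r ∈ D.box) :
    IsChain a b m fun i r => (D.pderiv e)^[i] H (γ r) :=
  ⟨fun _ hi _ hx => hH.iterate_hasDerivWithinAt hi hγ hI hx,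
    (hH.iterate_pderiv (e := e)).continuousOn_box.comp
      (fun r _ => (hγ r).continuousAt.continuousWithinAt) hI⟩

theorem IsSmooth.isChain_x {m : ℕ} (hH : D.IsSmooth (n + m) H) {y t : ℝ} (hy : y ∈ Icc D.c D.d)
    (ht : t ∈ Icc 0 D.T) : IsChain D.a D.b m fun i x => D.dx^[i] H (x, y, t) :=
  hH.isChain (hasDerivAt_lineX y t) fun _ hr => ⟨hr, hy, ht⟩

theorem IsSmooth.isChain_y {m : ℕ} (hH : D.IsSmooth (n + m) H) {x t : ℝ} (hx : x ∈ Icc D.a D.b)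
    (ht : t ∈ Icc 0 D.T) : IsChain D.c D.d m fun i y => D.dy^[i] H (x, y, t) :=
  hH.isChain (hasDerivAt_lineY x t) fun _ hr => ⟨hx, hr, ht⟩

/-- A side carrying a fractional derivative is approached from outside the rectangle, inside the
prolonged domain, where H vanishes. Applied to iterated derivatives, this supplies the zero end
values used by the fractional integrals. -/
theorem eq_zero_of_tendsto {l : Filter ℝ} [l.NeBot] {γ : ℝ → ℝ × ℝ × ℝ} {p : ℝ × ℝ × ℝ}
    (hH : D.IsSmooth n H) (hp : p ∈ D.domain) (hγ : Filter.Tendsto γ l (nhds p))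
    (h0 : ∀ᶠ r in l, γ r ∈ D.domain ∧ ¬((γ r).1 ∈ Icc D.a D.b ∧ (γ r).2.1 ∈ Icc D.c D.d)) :
    H p = 0 := by
  have h1 := (hH.continuousOn p hp).tendsto.comp
    (tendsto_nhdsWithin_iff.2 ⟨hγ, h0.mono fun _ h => h.1⟩)
  refine tendsto_nhds_unique h1 (tendsto_const_nhds.congr' ?_)
  filter_upwards [h0] with r hr using (hH.eq_zero _ hr.1 hr.2).symm

theorem IsSmooth.zero_a (hH : D.IsSmooth n H) (hK : D.Kx₁ ≠ 0) {y t : ℝ} (hy : y ∈ Icc D.c D.d)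
    (ht : t ∈ Icc 0 D.T) : H (D.a, y, t) = 0 := by
  refine eq_zero_of_tendsto (l := nhdsWithin D.a (Iio D.a)) hH
    (D.box_subset_domain ⟨left_mem_Icc.2 D.hab.le, hy, ht⟩)
    ((hasDerivAt_lineX y t D.a).continuousAt.tendsto.mono_left nhdsWithin_le_nhds) ?_
  filter_upwards [self_mem_nhdsWithin] with r hr
  exact ⟨⟨⟨fun h => absurd h hK, fun _ => (hr.trans D.hab).le⟩, Icc_subset_extInterval _ _ _ _ hy,
    ht⟩, fun h => absurd h.1.1 (not_le.2 hr)⟩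

theorem IsSmooth.zero_b (hH : D.IsSmooth n H) (hK : D.Kx₂ ≠ 0) {y t : ℝ} (hy : y ∈ Icc D.c D.d)
    (ht : t ∈ Icc 0 D.T) : H (D.b, y, t) = 0 := by
  refine eq_zero_of_tendsto (l := nhdsWithin D.b (Ioi D.b)) hH
    (D.box_subset_domain ⟨right_mem_Icc.2 D.hab.le, hy, ht⟩)
    ((hasDerivAt_lineX y t D.b).continuousAt.tendsto.mono_left nhdsWithin_le_nhds) ?_
  filter_upwards [self_mem_nhdsWithin] with r hr
  exact ⟨⟨⟨fun _ => (D.hab.trans hr).le, fun h => absurd h hK⟩, Icc_subset_extInterval _ _ _ _ hy,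
    ht⟩, fun h => absurd h.1.2 (not_le.2 hr)⟩

theorem IsSmooth.zero_c (hH : D.IsSmooth n H) (hK : D.Ky₁ ≠ 0) {x t : ℝ} (hx : x ∈ Icc D.a D.b)
    (ht : t ∈ Icc 0 D.T) : H (x, D.c, t) = 0 := by
  refine eq_zero_of_tendsto (l := nhdsWithin D.c (Iio D.c)) hH
    (D.box_subset_domain ⟨hx, left_mem_Icc.2 D.hcd.le, ht⟩)
    ((hasDerivAt_lineY x t D.c).continuousAt.tendsto.mono_left nhdsWithin_le_nhds) ?_
  filter_upwards [self_mem_nhdsWithin] with r hr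
  exact ⟨⟨Icc_subset_extInterval _ _ _ _ hx, ⟨fun h => absurd h hK, fun _ => (hr.trans D.hcd).le⟩,
    ht⟩, fun h => absurd h.2.1 (not_le.2 hr)⟩

theorem IsSmooth.zero_d (hH : D.IsSmooth n H) (hK : D.Ky₂ ≠ 0) {x t : ℝ} (hx : x ∈ Icc D.a D.b)
    (ht : t ∈ Icc 0 D.T) : H (x, D.d, t) = 0 := by
  refine eq_zero_of_tendsto (l := nhdsWithin D.d (Ioi D.d)) hH
    (D.box_subset_domain ⟨hx, right_mem_Icc.2 D.hcd.le, ht⟩)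
    ((hasDerivAt_lineY x t D.d).continuousAt.tendsto.mono_left nhdsWithin_le_nhds) ?_
  filter_upwards [self_mem_nhdsWithin] with r hr
  exact ⟨⟨Icc_subset_extInterval _ _ _ _ hx, ⟨fun _ => (D.hcd.trans hr).le, fun h => absurd h hK⟩,
    ht⟩, fun h => absurd h.2.2 (not_le.2 hr)⟩

end Data

theorem SufficientlySmooth.isSmooth {D : Data} {u : ℝ → ℝ → ℝ → ℝ} (hu : SufficientlySmooth D u) :
    D.IsSmooth 7 (zeroExt D u) :=
  ⟨hu, fun _ _ hp => if_neg hp⟩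

/-! ### The differential equation in terms of the zero extension. -/

theorem zeroExt_apply {D : Data} (u : ℝ → ℝ → ℝ → ℝ) {x y : ℝ} (hx : x ∈ Icc D.a D.b)
    (hy : y ∈ Icc D.c D.d) (t : ℝ) : zeroExt D u (x, y, t) = u x y t :=
  if_pos ⟨hx, hy⟩

theorem leftRL_congr {a b α : ℝ} {v w : ℝ → ℝ} (h : EqOn v w (Icc a b)) {x : ℝ}
    (hx : x ∈ Ioo a b) : leftRL a α v x = leftRL a α w x := by
  unfold leftRL
  congr 1
  refine Filter.EventuallyEq.iteratedDeriv_eq _ ?_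
  filter_upwards [Icc_mem_nhds hx.1 hx.2] with z hz
  refine intervalIntegral.integral_congr fun s hs => ?_
  rw [uIcc_of_le hz.1] at hs
  rw [h ⟨hs.1, hs.2.trans hz.2⟩]

theorem rightRL_congr {a b α : ℝ} {v w : ℝ → ℝ} (h : EqOn v w (Icc a b)) {x : ℝ}
    (hx : x ∈ Ioo a b) : rightRL b α v x = rightRL b α w x := by
  unfold rightRL
  congr 1
  refine Filter.EventuallyEq.iteratedDeriv_eq _ ?_
  filter_upwards [Icc_mem_nhds hx.1 hx.2] with z hz
  refine intervalIntegral.integral_congr fun s hs => ?_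
  rw [uIcc_of_le hz.2] at hs
  rw [h ⟨hz.1.trans hs.1, hs.2⟩]

namespace Data

variable (D : Data)

/-- The diffusion term in the first variable. -/
noncomputable def diffX (H : ℝ × ℝ × ℝ → ℝ) (p : ℝ × ℝ × ℝ) : ℝ :=
  fracOp D.a D.b D.α D.Kx₁ D.Kx₂ (fun s => D.dx^[6] H (s, p.2.1, p.2.2)) p.1

/-- The diffusion term in the second variable. -/
noncomputable def diffY (H : ℝ × ℝ × ℝ → ℝ) (p : ℝ × ℝ × ℝ) : ℝ :=
  fracOp D.c D.d D.β D.Ky₁ D.Ky₂ (fun s => D.dy^[6] H (p.1, s, p.2.2)) p.2.1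

variable {D} {H : ℝ × ℝ × ℝ → ℝ}

theorem continuousOn_diffX (hH : D.IsSmooth 6 H) : ContinuousOn (D.diffX H) D.box := by
  have hq : D.IsSmooth 0 (D.dx^[6] H) := IsSmooth.iterate_pderiv hH
  obtain ⟨B, -, hB⟩ := hq.exists_bound
  refine continuousOn_fracOp (B := B) D.hα₂ D.hab.le continuousOn_fst (fun p hp => hp.1)
    (fun p hp => ?_) (fun s hs => ?_) fun p hp s hs => hB s hs _ hp.2.1 _ hp.2.2
  · exact hq.continuousOn_box.comp (by fun_prop) fun s hs => ⟨hs, hp.2.1, hp.2.2⟩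
  · exact hq.continuousOn_box.comp (by fun_prop) fun p hp => ⟨hs, hp.2.1, hp.2.2⟩

theorem continuousOn_diffY (hH : D.IsSmooth 6 H) : ContinuousOn (D.diffY H) D.box := by
  have hq : D.IsSmooth 0 (D.dy^[6] H) := IsSmooth.iterate_pderiv hH
  obtain ⟨B, -, hB⟩ := hq.exists_bound
  refine continuousOn_fracOp (B := B) D.hβ₂ D.hcd.le (by fun_prop) (fun p hp => hp.2.1)
    (fun p hp => ?_) (fun s hs => ?_) fun p hp s hs => hB _ hp.1 s hs _ hp.2.2
  · exact hq.continuousOn_box.comp (by fun_prop) fun s hs => ⟨hp.1, hs, hp.2.2⟩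
  · exact hq.continuousOn_box.comp (by fun_prop) fun p hp => ⟨hp.1, hs, hp.2.2⟩

theorem IsSmooth.iterate_dx_zero {m : ℕ} (hH : D.IsSmooth (n + m) H) {y t : ℝ}
    (hy : y ∈ Icc D.c D.d) (ht : t ∈ Icc 0 D.T) :
    (D.Kx₁ ≠ 0 → ∀ i < m, D.dx^[i] H (D.a, y, t) = 0) ∧
      (D.Kx₂ ≠ 0 → ∀ i < m, D.dx^[i] H (D.b, y, t) = 0) := by
  have h : ∀ i < m, D.IsSmooth 0 (D.dx^[i] H) := fun i hi =>
    IsSmooth.iterate_pderiv (hH.mono (by omega))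
  exact ⟨fun hK i hi => (h i hi).zero_a hK hy ht, fun hK i hi => (h i hi).zero_b hK hy ht⟩

theorem IsSmooth.iterate_dy_zero {m : ℕ} (hH : D.IsSmooth (n + m) H) {x t : ℝ}
    (hx : x ∈ Icc D.a D.b) (ht : t ∈ Icc 0 D.T) :
    (D.Ky₁ ≠ 0 → ∀ i < m, D.dy^[i] H (x, D.c, t) = 0) ∧
      (D.Ky₂ ≠ 0 → ∀ i < m, D.dy^[i] H (x, D.d, t) = 0) := by
  have h : ∀ i < m, D.IsSmooth 0 (D.dy^[i] H) := fun i hi =>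
    IsSmooth.iterate_pderiv (hH.mono (by omega))
  exact ⟨fun hK i hi => (h i hi).zero_c hK hx ht, fun hK i hi => (h i hi).zero_d hK hx ht⟩

/-- The differential equation holds up to the lateral boundary. -/
theorem f_eq {u : ℝ → ℝ → ℝ → ℝ} (hu : IsSolution D u) (hsmooth : SufficientlySmooth D u)
    {x y t : ℝ} (hx : x ∈ Icc D.a D.b) (hy : y ∈ Icc D.c D.d) (ht : t ∈ Ioc 0 D.T) :
    D.f x y t = D.dt (zeroExt D u) (x, y, t) - D.diffX (zeroExt D u) (x, y, t)
      - D.diffY (zeroExt D u) (x, y, t) := by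
  have hZ := hsmooth.isSmooth
  have hZ6 : D.IsSmooth 6 (zeroExt D u) := hZ.mono (by norm_num)
  have hsub : Icc D.a D.b ×ˢ Icc D.c D.d ×ˢ Ioc 0 D.T ⊆ D.box :=
    prod_mono le_rfl (prod_mono le_rfl Ioc_subset_Icc_self)
  have key : EqOn (fun p : ℝ × ℝ × ℝ => D.f p.1 p.2.1 p.2.2)
      (fun p => D.dt (zeroExt D u) p - D.diffX (zeroExt D u) p - D.diffY (zeroExt D u) p)
      (Icc D.a D.b ×ˢ Icc D.c D.d ×ˢ Ioc 0 D.T) := by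
    -- The equation is known only in the open rectangle, whereas P_x P_y f also reads f at boundary
    -- nodes; continuity of both sides bridges the gap.
    refine Set.EqOn.of_subset_closure (s := Ioo D.a D.b ×ˢ Ioo D.c D.d ×ˢ Ioc 0 D.T) ?_ D.hf ?_ ?_ ?_
    · rintro ⟨x, y, t⟩ ⟨hx, hy, ht⟩
      have hx' := Ioo_subset_Icc_self hx
      have hy' := Ioo_subset_Icc_self hy
      have ht' := Ioc_subset_Icc_self ht
      simp only at hx hy ht hx' hy' ht' ⊢
      have h1 := hu.equation x hx y hy t ht
      have h2 : HasDerivWithinAt (fun r => u x y r) (D.dt (zeroExt D u) (x, y, t)) (Icc 0 D.T) t :=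
        (IsSmooth.hasDerivWithinAt (n := 6) hZ (hasDerivAt_lineT x y) (I := Icc 0 D.T)
          (fun r hr => ⟨hx', hy', hr⟩) ht').congr_of_mem
          (fun r _ => (zeroExt_apply u hx' hy' r).symm) ht'
      have h3 := (uniqueDiffOn_Icc D.hT t ht').eq_deriv _ h1 h2
      have ex : EqOn (fun z => u z y t) (fun z => zeroExt D u (z, y, t)) (Icc D.a D.b) :=
        fun z hz => (zeroExt_apply u hz hy' t).symm
      have ey : EqOn (fun z => u x z t) (fun z => zeroExt D u (x, z, t)) (Icc D.c D.d) :=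
        fun z hz => (zeroExt_apply u hx' hz t).symm
      rw [leftRL_congr ex hx, rightRL_congr ex hx, leftRL_congr ey hy, rightRL_congr ey hy] at h3
      have zx := IsSmooth.iterate_dx_zero (n := 1) (m := 6) hZ hy' ht'
      have zy := IsSmooth.iterate_dy_zero (n := 1) (m := 6) hZ hx' ht'
      have rx := RL_eq_fracOp D.hα₁ D.hα₂ (IsSmooth.isChain_x (n := 1) (m := 6) hZ hy' ht')
        zx.1 zx.2 hx
      have ry := RL_eq_fracOp D.hβ₁ D.hβ₂ (IsSmooth.isChain_y (n := 1) (m := 6) hZ hx' ht')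
        zy.1 zy.2 hy
      simp only [Function.iterate_zero, id] at rx ry
      unfold diffX diffY
      simp only
      rw [← rx, ← ry, ← h3]
      ring
    · exact (((IsSmooth.pderiv (n := 6) hZ _).continuousOn_box.sub (continuousOn_diffX hZ6)).sub
        (continuousOn_diffY hZ6)).mono hsub
    · exact prod_mono Ioo_subset_Icc_self (prod_mono Ioo_subset_Icc_self le_rfl)
    · rw [closure_prod_eq, closure_prod_eq, closure_Ioo D.hab.ne, closure_Ioo D.hcd.ne]
      exact prod_mono le_rfl (prod_mono le_rfl subset_closure)
  exact key (x := (x, y, t)) ⟨hx, hy, ht⟩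

end Data

end FracDiffusion
namespace FracDiffusion

/-! The local truncation error. -/

theorem IsChain.add {a b : ℝ} {m : ℕ} {v w : ℕ → ℝ → ℝ} (hv : IsChain a b m v)
    (hw : IsChain a b m w) : IsChain a b m fun i x => v i x + w i x :=
  ⟨fun i hi x hx => (hv.deriv i hi x hx).add (hw.deriv i hi x hx), hv.cont.add hw.cont⟩

theorem IsChain.sub {a b : ℝ} {m : ℕ} {v w : ℕ → ℝ → ℝ} (hv : IsChain a b m v)
    (hw : IsChain a b m w) : IsChain a b m fun i x => v i x - w i x :=
  ⟨fun i hi x hx => (hv.deriv i hi x hx).sub (hw.deriv i hi x hx), hv.cont.sub hw.cont⟩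

theorem IsChain.const_mul {a b : ℝ} {m : ℕ} {v : ℕ → ℝ → ℝ} (hv : IsChain a b m v) (c : ℝ) :
    IsChain a b m fun i x => c * v i x :=
  ⟨fun i hi x hx => (hv.deriv i hi x hx).const_mul c, continuousOn_const.mul hv.cont⟩

/-- Makes the one-dimensional bound in x applicable to x ↦ δ_y H(x, ·), as the mixed term δ_x δ_y
requires. -/
theorem IsChain.deltaFrac {a b α K₁ K₂ h : ℝ} {m M j : ℕ} {v : ℕ → ℕ → ℝ → ℝ}
    (hv : ∀ k ≤ M, IsChain a b m (v k)) (hj : j ∈ Finset.Ioo 0 M) :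
    IsChain a b m fun i x => deltaFrac α K₁ K₂ h M (fun k => v k i x) j := by
  have hj' : 0 < j ∧ j < M := by simpa using hj
  constructor
  · intro i hi x hx
    refine HasDerivWithinAt.add (HasDerivWithinAt.const_mul _ (HasDerivWithinAt.const_mul _
      (HasDerivWithinAt.fun_sum fun k hk => HasDerivWithinAt.const_mul _ ?_)))
      (HasDerivWithinAt.const_mul _ (HasDerivWithinAt.const_mul _
      (HasDerivWithinAt.fun_sum fun k hk => HasDerivWithinAt.const_mul _ ?_)))
    · exact (hv _ (by omega)).deriv i hi x hx
    · simp at hk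
      exact (hv _ (by omega)).deriv i hi x hx
  · refine ContinuousOn.add (continuousOn_const.mul (continuousOn_const.mul
      (continuousOn_finsetSum _ fun k hk => continuousOn_const.mul ?_)))
      (continuousOn_const.mul (continuousOn_const.mul
      (continuousOn_finsetSum _ fun k hk => continuousOn_const.mul ?_)))
    · exact (hv _ (by omega)).cont
    · simp at hk
      exact (hv _ (by omega)).cont

theorem abs_sub_le_of_chain {I : Set ℝ} (hI : Convex ℝ I) {B : ℝ} {f : ℕ → ℝ → ℝ}
    (hf : ∀ i < 1, ∀ x ∈ I, HasDerivWithinAt (f i) (f (i + 1) x) I x)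
    (hB : ∀ x ∈ I, |f 1 x| ≤ B) {m r : ℝ} (hr : 0 ≤ r) (h1 : m + r ∈ I) (h0 : m - r ∈ I) :
    |f 0 (m + r) - f 0 (m - r)| ≤ 2 * B * r := by
  have := taylor_chain hI hf hB h1 h0
  rw [show m + r - (m - r) = 2 * r by ring, abs_of_nonneg (show 0 ≤ 2 * r by linarith)] at this
  simp at this
  linarith

theorem abs_second_diff_le_of_chain {I : Set ℝ} (hI : Convex ℝ I) {B : ℝ} {f : ℕ → ℝ → ℝ}
    (hf : ∀ i < 2, ∀ x ∈ I, HasDerivWithinAt (f i) (f (i + 1) x) I x)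
    (hB : ∀ x ∈ I, |f 2 x| ≤ B) {m r : ℝ} (hm : m ∈ I) (h1 : m + r ∈ I) (h0 : m - r ∈ I) :
    |f 0 (m + r) + f 0 (m - r) - 2 * f 0 m| ≤ 2 * B * r ^ 2 := by
  have e1 := taylor_chain hI hf hB h1 hm
  have e0 := taylor_chain hI hf hB h0 hm
  simp only [add_sub_cancel_left, sub_sub_cancel_left, Finset.sum_range_succ, Finset.sum_range_zero,
    abs_neg, sq_abs, Nat.factorial, pow_zero, pow_one] at e1 e0
  norm_num at e1 e0
  rw [abs_le] at *
  constructor <;> linarith [e1.1, e1.2, e0.1, e0.2]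

theorem abs_central_diff_le_of_chain {I : Set ℝ} (hI : Convex ℝ I) {B : ℝ} {f : ℕ → ℝ → ℝ}
    (hf : ∀ i < 3, ∀ x ∈ I, HasDerivWithinAt (f i) (f (i + 1) x) I x)
    (hB : ∀ x ∈ I, |f 3 x| ≤ B) {m r : ℝ} (hr : 0 ≤ r) (hm : m ∈ I) (h1 : m + r ∈ I)
    (h0 : m - r ∈ I) : |f 0 (m + r) - f 0 (m - r) - 2 * r * f 1 m| ≤ 2 * B * r ^ 3 := by
  have e1 := taylor_chain hI hf hB h1 hm
  have e0 := taylor_chain hI hf hB h0 hm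
  simp only [add_sub_cancel_left, sub_sub_cancel_left, Finset.sum_range_succ, Finset.sum_range_zero,
    abs_neg, abs_of_nonneg hr, Nat.factorial, pow_zero, pow_one] at e1 e0
  norm_num at e1 e0
  rw [abs_le] at *
  constructor <;> linarith [e1.1, e1.2, e0.1, e0.2]

namespace Data

variable {D : Data} {H : ℝ × ℝ × ℝ → ℝ}

/-- The closed interval of radius `r` about the time `m` is admissible. -/
structure IsTimeStep (D : Data) (m r : ℝ) : Prop where
  nonneg : 0 ≤ r
  mid : m ∈ Icc 0 D.T
  right : m + r ∈ Icc 0 D.T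
  left : m - r ∈ Icc 0 D.T

theorem IsSmooth.chain_t {n : ℕ} (hH : D.IsSmooth n H) {x y : ℝ} (hx : x ∈ Icc D.a D.b)
    (hy : y ∈ Icc D.c D.d) : ∀ i < n, ∀ t ∈ Icc 0 D.T, HasDerivWithinAt
      (fun t => D.dt^[i] H (x, y, t)) (D.dt^[i + 1] H (x, y, t)) (Icc 0 D.T) t :=
  fun _ hi _ ht => IsSmooth.iterate_hasDerivWithinAt (n := 0) (by rwa [zero_add]) hi
    (hasDerivAt_lineT x y) (fun _ hr => ⟨hx, hy, hr⟩) ht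

theorem IsSmooth.exists_bound_iterate_dt {n : ℕ} (hH : D.IsSmooth n H) :
    ∃ B, 0 ≤ B ∧ ∀ x ∈ Icc D.a D.b, ∀ y ∈ Icc D.c D.d, ∀ t ∈ Icc 0 D.T,
      |D.dt^[n] H (x, y, t)| ≤ B :=
  IsSmooth.exists_bound (n := 0) (IsSmooth.iterate_pderiv (by rwa [zero_add]))

/-! ### Time differences and spatial consistency of smooth functions on the grid. -/

theorem IsSmooth.time_diff (hH : D.IsSmooth 1 H) :
    ∃ B, 0 ≤ B ∧ ∀ x ∈ Icc D.a D.b, ∀ y ∈ Icc D.c D.d, ∀ m r, D.IsTimeStep m r →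
      |H (x, y, m + r) - H (x, y, m - r)| ≤ B * r := by
  obtain ⟨B, hB, h⟩ := hH.exists_bound_iterate_dt
  exact ⟨2 * B, by positivity, fun x hx y hy m r hr => abs_sub_le_of_chain (convex_Icc 0 D.T)
    (hH.chain_t hx hy) (h x hx y hy) hr.nonneg hr.right hr.left⟩

theorem IsSmooth.second_time_diff (hH : D.IsSmooth 2 H) :
    ∃ B, 0 ≤ B ∧ ∀ x ∈ Icc D.a D.b, ∀ y ∈ Icc D.c D.d, ∀ m r, D.IsTimeStep m r →
      |H (x, y, m + r) + H (x, y, m - r) - 2 * H (x, y, m)| ≤ B * r ^ 2 := by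
  obtain ⟨B, hB, h⟩ := hH.exists_bound_iterate_dt
  exact ⟨2 * B, by positivity, fun x hx y hy m r hr => abs_second_diff_le_of_chain
    (convex_Icc 0 D.T) (hH.chain_t hx hy) (h x hx y hy) hr.mid hr.right hr.left⟩

theorem IsSmooth.central_time_diff (hH : D.IsSmooth 3 H) :
    ∃ B, 0 ≤ B ∧ ∀ x ∈ Icc D.a D.b, ∀ y ∈ Icc D.c D.d, ∀ m r, D.IsTimeStep m r →
      |H (x, y, m + r) - H (x, y, m - r) - 2 * r * D.dt H (x, y, m)| ≤ B * r ^ 3 := by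
  obtain ⟨B, hB, h⟩ := hH.exists_bound_iterate_dt
  exact ⟨2 * B, by positivity, fun x hx y hy m r hr => abs_central_diff_le_of_chain
    (convex_Icc 0 D.T) (hH.chain_t hx hy) (h x hx y hy) hr.nonneg hr.mid hr.right hr.left⟩

theorem add_mul_div_mem_Icc {a b : ℝ} (hab : a ≤ b) {M i : ℕ} (hi : i ≤ M) :
    a + i * ((b - a) / M) ∈ Icc a b := by
  have h1 : (i : ℝ) / M ≤ 1 := div_le_one_of_le₀ (by exact_mod_cast hi) (Nat.cast_nonneg _)
  have h0 : 0 ≤ (i : ℝ) / M := by positivity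
  have e : (i : ℝ) * ((b - a) / M) = i / M * (b - a) := by ring
  rw [e]
  constructor <;> nlinarith

theorem x_mem (D : Data) {Mx i : ℕ} (hi : i ≤ Mx) : D.x Mx i ∈ Icc D.a D.b :=
  add_mul_div_mem_Icc D.hab.le hi

theorem y_mem (D : Data) {My i : ℕ} (hi : i ≤ My) : D.y My i ∈ Icc D.c D.d :=
  add_mul_div_mem_Icc D.hcd.le hi

/-- Grid values at time `t`. -/
noncomputable def grid (D : Data) (Mx My : ℕ) (H : ℝ × ℝ × ℝ → ℝ) (t : ℝ) (j s : ℕ) : ℝ :=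
  H (D.x Mx j, D.y My s, t)

/-- The second time difference is again a chain in x with zero end values, and its third
x-derivative is O(r²): three derivatives in x and two in t. -/
theorem IsSmooth.deltaX_second_time_diff (hH : D.IsSmooth 5 H) :
    ∃ C, 0 ≤ C ∧ ∀ Mx, ∀ j ∈ Finset.Ioo 0 Mx, ∀ y ∈ Icc D.c D.d, ∀ m r, D.IsTimeStep m r →
      |deltaFrac D.α D.Kx₁ D.Kx₂ (D.hx Mx) Mx (fun i => H (D.x Mx i, y, m + r)
        + H (D.x Mx i, y, m - r) - 2 * H (D.x Mx i, y, m)) j| ≤ C * r ^ 2 := by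
  obtain ⟨C, hC, h1⟩ := deltaFrac_bound D.hα₁ D.hα₂ D.hab D.Kx₁ D.Kx₂
  obtain ⟨B, hB, h2⟩ := IsSmooth.second_time_diff (H := D.dx^[3] H)
    (IsSmooth.iterate_pderiv (n := 2) hH)
  refine ⟨C * B, by positivity, fun Mx j hj y hy m r hr => ?_⟩
  have c := fun t ht => IsSmooth.isChain_x (n := 2) (m := 3) hH hy (t := t) ht
  have z := fun t ht => IsSmooth.iterate_dx_zero (n := 2) (m := 3) hH hy (t := t) ht
  rw [mul_assoc]
  refine h1 Mx _ (B * r ^ 2) (((c _ hr.right).add (c _ hr.left)).sub ((c _ hr.mid).const_mul 2))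
    (fun hK i hi => ?_) (fun hK i hi => ?_) (fun x hx => h2 x hx y hy m r hr) j hj
  · simp only [(z _ hr.right).1 hK i hi, (z _ hr.left).1 hK i hi, (z _ hr.mid).1 hK i hi]; simp
  · simp only [(z _ hr.right).2 hK i hi, (z _ hr.left).2 hK i hi, (z _ hr.mid).2 hK i hi]; simp

theorem IsSmooth.deltaY_second_time_diff (hH : D.IsSmooth 5 H) :
    ∃ C, 0 ≤ C ∧ ∀ My, ∀ s ∈ Finset.Ioo 0 My, ∀ x ∈ Icc D.a D.b, ∀ m r, D.IsTimeStep m r →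
      |deltaFrac D.β D.Ky₁ D.Ky₂ (D.hy My) My (fun k => H (x, D.y My k, m + r)
        + H (x, D.y My k, m - r) - 2 * H (x, D.y My k, m)) s| ≤ C * r ^ 2 := by
  obtain ⟨C, hC, h1⟩ := deltaFrac_bound D.hβ₁ D.hβ₂ D.hcd D.Ky₁ D.Ky₂
  obtain ⟨B, hB, h2⟩ := IsSmooth.second_time_diff (H := D.dy^[3] H)
    (IsSmooth.iterate_pderiv (n := 2) hH)
  refine ⟨C * B, by positivity, fun My s hs x hx m r hr => ?_⟩
  have c := fun t ht => IsSmooth.isChain_y (n := 2) (m := 3) hH hx (t := t) ht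
  have z := fun t ht => IsSmooth.iterate_dy_zero (n := 2) (m := 3) hH hx (t := t) ht
  rw [mul_assoc]
  refine h1 My _ (B * r ^ 2) (((c _ hr.right).add (c _ hr.left)).sub ((c _ hr.mid).const_mul 2))
    (fun hK i hi => ?_) (fun hK i hi => ?_) (fun y hy => h2 x hx y hy m r hr) s hs
  · simp only [(z _ hr.right).1 hK i hi, (z _ hr.left).1 hK i hi, (z _ hr.mid).1 hK i hi]; simp
  · simp only [(z _ hr.right).2 hK i hi, (z _ hr.left).2 hK i hi, (z _ hr.mid).2 hK i hi]; simp

theorem IsSmooth.deltaY_time_diff (hH : D.IsSmooth 4 H) :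
    ∃ C, 0 ≤ C ∧ ∀ My, ∀ s ∈ Finset.Ioo 0 My, ∀ x ∈ Icc D.a D.b, ∀ m r, D.IsTimeStep m r →
      |deltaFrac D.β D.Ky₁ D.Ky₂ (D.hy My) My (fun k => H (x, D.y My k, m + r)
        - H (x, D.y My k, m - r)) s| ≤ C * r := by
  obtain ⟨C, hC, h1⟩ := deltaFrac_bound D.hβ₁ D.hβ₂ D.hcd D.Ky₁ D.Ky₂
  obtain ⟨B, hB, h2⟩ := IsSmooth.time_diff (H := D.dy^[3] H) (IsSmooth.iterate_pderiv (n := 1) hH)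
  refine ⟨C * B, by positivity, fun My s hs x hx m r hr => ?_⟩
  have c := fun t ht => IsSmooth.isChain_y (n := 1) (m := 3) hH hx (t := t) ht
  have z := fun t ht => IsSmooth.iterate_dy_zero (n := 1) (m := 3) hH hx (t := t) ht
  rw [mul_assoc]
  refine h1 My _ (B * r) ((c _ hr.right).sub (c _ hr.left))
    (fun hK i hi => ?_) (fun hK i hi => ?_) (fun y hy => h2 x hx y hy m r hr) s hs
  · simp only [(z _ hr.right).1 hK i hi, (z _ hr.left).1 hK i hi, sub_zero]
  · simp only [(z _ hr.right).2 hK i hi, (z _ hr.left).2 hK i hi, sub_zero]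

/-- Two nested uses of the C³ bound and one time derivative: 3 + 3 + 1 = 7, the most demanding term
of the residual. -/
theorem IsSmooth.deltaX_deltaY_time_diff (hH : D.IsSmooth 7 H) :
    ∃ C, 0 ≤ C ∧ ∀ Mx My, ∀ j ∈ Finset.Ioo 0 Mx, ∀ s ∈ Finset.Ioo 0 My, ∀ m r, D.IsTimeStep m r →
      |deltaFrac D.α D.Kx₁ D.Kx₂ (D.hx Mx) Mx (fun i => deltaFrac D.β D.Ky₁ D.Ky₂ (D.hy My) My
        (fun k => H (D.x Mx i, D.y My k, m + r) - H (D.x Mx i, D.y My k, m - r)) s) j|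
        ≤ C * r := by
  obtain ⟨C, hC, h1⟩ := deltaFrac_bound D.hα₁ D.hα₂ D.hab D.Kx₁ D.Kx₂
  obtain ⟨B, hB, h2⟩ := IsSmooth.deltaY_time_diff (H := D.dx^[3] H)
    (IsSmooth.iterate_pderiv (n := 4) hH)
  refine ⟨C * B, by positivity, fun Mx My j hj s hs m r hr => ?_⟩
  have c := fun t ht (k : ℕ) (hk : k ≤ My) =>
    IsSmooth.isChain_x (n := 4) (m := 3) hH (D.y_mem hk) (t := t) ht
  have z := fun t ht (k : ℕ) (hk : k ≤ My) =>
    IsSmooth.iterate_dx_zero (n := 4) (m := 3) hH (D.y_mem hk) (t := t) ht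
  have h0 : deltaFrac D.β D.Ky₁ D.Ky₂ (D.hy My) My (fun _ => 0) s = 0 :=
    map_zero (deltaₗ D.β D.Ky₁ D.Ky₂ (D.hy My) My s)
  rw [mul_assoc]
  refine h1 Mx _ (B * r) (IsChain.deltaFrac (fun k hk => (c _ hr.right k hk).sub
    (c _ hr.left k hk)) hs) (fun hK i hi => ?_) (fun hK i hi => ?_)
    (fun x hx => h2 My s hs x hx m r hr) j hj
  · rw [← h0]
    refine deltaFrac_congr hs fun k hk => ?_
    rw [(z _ hr.right k hk).1 hK i hi, (z _ hr.left k hk).1 hK i hi, sub_zero]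
  · rw [← h0]
    refine deltaFrac_congr hs fun k hk => ?_
    rw [(z _ hr.right k hk).2 hK i hi, (z _ hr.left k hk).2 hK i hi, sub_zero]

theorem IsSmooth.deltaX_consistency (hH : D.IsSmooth 6 H) :
    ∃ C, 0 ≤ C ∧ ∀ Mx, ∀ j ∈ Finset.Ioo 0 Mx, ∀ y ∈ Icc D.c D.d, ∀ t ∈ Icc 0 D.T,
      |P D.α (D.hx Mx) (fun i => D.diffX H (D.x Mx i, y, t)) j
        - deltaFrac D.α D.Kx₁ D.Kx₂ (D.hx Mx) Mx (fun i => H (D.x Mx i, y, t)) j|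
        ≤ C * D.hx Mx ^ 4 := by
  obtain ⟨C, hC, h1⟩ := deltaFrac_consistency D.hα₁ D.hα₂ D.hab D.Kx₁ D.Kx₂
  obtain ⟨B, hB, h2⟩ := IsSmooth.exists_bound (H := D.dx^[6] H)
    (IsSmooth.iterate_pderiv (n := 0) hH)
  refine ⟨C * B, by positivity, fun Mx j hj y hy t ht => ?_⟩
  have z := IsSmooth.iterate_dx_zero (n := 0) (m := 6) hH hy ht
  rw [abs_sub_comm]
  exact h1 Mx _ B (IsSmooth.isChain_x (n := 0) (m := 6) hH hy ht) z.1 z.2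
    (fun x hx => h2 x hx y hy t ht) j hj

theorem IsSmooth.deltaY_consistency (hH : D.IsSmooth 6 H) :
    ∃ C, 0 ≤ C ∧ ∀ My, ∀ s ∈ Finset.Ioo 0 My, ∀ x ∈ Icc D.a D.b, ∀ t ∈ Icc 0 D.T,
      |P D.β (D.hy My) (fun k => D.diffY H (x, D.y My k, t)) s
        - deltaFrac D.β D.Ky₁ D.Ky₂ (D.hy My) My (fun k => H (x, D.y My k, t)) s|
        ≤ C * D.hy My ^ 4 := by
  obtain ⟨C, hC, h1⟩ := deltaFrac_consistency D.hβ₁ D.hβ₂ D.hcd D.Ky₁ D.Ky₂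
  obtain ⟨B, hB, h2⟩ := IsSmooth.exists_bound (H := D.dy^[6] H)
    (IsSmooth.iterate_pderiv (n := 0) hH)
  refine ⟨C * B, by positivity, fun My s hs x hx t ht => ?_⟩
  have z := IsSmooth.iterate_dy_zero (n := 0) (m := 6) hH hx ht
  rw [abs_sub_comm]
  exact h1 My _ B (IsSmooth.isChain_y (n := 0) (m := 6) hH hx ht) z.1 z.2
    (fun y hy => h2 x hx y hy t ht) s hs

end Data

end FracDiffusion
namespace FracDiffusion

/-! Tensor products of functionals and the residual of the scheme. -/

/-- Successive application of a functional in the second and in the first index. -/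
def mixed (L L' : (ℕ → ℝ) →ₗ[ℝ] ℝ) : (ℕ → ℕ → ℝ) →ₗ[ℝ] ℝ where
  toFun V := L fun i => L' (V i)
  map_add' V W := by
    rw [← map_add]; congr 1; ext i; exact map_add L' _ _
  map_smul' c V := by
    rw [← map_smul]; congr 1; ext i; exact map_smul L' _ _

theorem mixed_apply (L L' : (ℕ → ℝ) →ₗ[ℝ] ℝ) (V : ℕ → ℕ → ℝ) :
    mixed L L' V = L fun i => L' (V i) := rfl

/-- Exchanges the order of application, so that in the residual the averaging functional can be put
outermost and removed by its sup bound. -/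
theorem mixed_P (L : (ℕ → ℝ) →ₗ[ℝ] ℝ) (α h : ℝ) (s : ℕ) (V : ℕ → ℕ → ℝ) :
    mixed L (Pₗ α h s) V = Pₗ α h s fun k => L fun i => V i k := by
  have e : (fun i => Pₗ α h s (V i)) = (fun i => V i s)
      + (h ^ 2 * b₂ α / h ^ 2) • ((fun i => V i (s - 1)) - (2 : ℝ) • (fun i => V i s)
        + fun i => V i (s + 1)) := by
    ext i
    simp only [Pₗ, P, LinearMap.coe_mk, AddHom.coe_mk, Pi.add_apply, Pi.smul_apply, Pi.sub_apply,
      smul_eq_mul]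
    ring
  rw [mixed_apply, e]
  simp only [map_add, map_sub, map_smul, smul_eq_mul, Pₗ, P, LinearMap.coe_mk, AddHom.coe_mk]
  ring

/-- A functional which only sees the nodes `0, …, M`. -/
def IsLocal (M : ℕ) (L : (ℕ → ℝ) →ₗ[ℝ] ℝ) : Prop :=
  ∀ u v : ℕ → ℝ, (∀ i ≤ M, u i = v i) → L u = L v

theorem isLocal_P (α h : ℝ) {M j : ℕ} (hj : j ∈ Finset.Ioo 0 M) : IsLocal M (Pₗ α h j) :=
  fun _ _ huv => P_congr hj fun i hi => huv i hi

theorem isLocal_delta (α K₁ K₂ h : ℝ) {M j : ℕ} (hj : j ∈ Finset.Ioo 0 M) :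
    IsLocal M (deltaₗ α K₁ K₂ h M j) := fun _ _ huv => deltaFrac_congr hj fun i hi => huv i hi

theorem mixed_congr {Mx My : ℕ} {L L' : (ℕ → ℝ) →ₗ[ℝ] ℝ} (hL : IsLocal Mx L) (hL' : IsLocal My L')
    {V W : ℕ → ℕ → ℝ} (h : ∀ i ≤ Mx, ∀ k ≤ My, V i k = W i k) : mixed L L' V = mixed L L' W :=
  hL _ _ fun i hi => hL' _ _ fun k hk => h i hi k hk

/-- For grid functions with zero boundary values, restriction to the interior is invisible to local
functionals; this links the scheme to the operators of the stability theorem. -/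
theorem gridX_gridY_toInterior {Mx My j s : ℕ} {L L' : ℕ → (ℕ → ℝ) →ₗ[ℝ] ℝ}
    (hL : IsLocal Mx (L j)) (hL' : IsLocal My (L' s)) (hj : j ∈ Finset.Ioo 0 Mx)
    (hs : s ∈ Finset.Ioo 0 My) {V : ℕ → ℕ → ℝ}
    (hV : ∀ i ≤ Mx, ∀ k ≤ My, i = 0 ∨ i = Mx ∨ k = 0 ∨ k = My → V i k = 0) :
    (gridX Mx My L (gridY Mx My L' (toInterior Mx My V)) : ℕ → ℕ → ℝ) j s
      = mixed (L j) (L' s) V := by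
  rw [gridX_apply _ _ hj, mixed_apply]
  refine hL _ _ fun i hi => ?_
  rw [gridY_apply _ _ _ hs]
  refine hL' _ _ fun k hk => ?_
  by_cases hik : i ∈ Finset.Ioo 0 Mx ∧ k ∈ Finset.Ioo 0 My
  · exact toInterior_apply V hik.1 hik.2
  · rw [InteriorGrid.apply_eq_zero _ hik, hV i hi k hk]
    simp at hik
    omega

namespace Data

variable (D : Data) (Mx My : ℕ)

noncomputable abbrev pX (j : ℕ) : (ℕ → ℝ) →ₗ[ℝ] ℝ := Pₗ D.α (D.hx Mx) j

noncomputable abbrev pY (s : ℕ) : (ℕ → ℝ) →ₗ[ℝ] ℝ := Pₗ D.β (D.hy My) s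

noncomputable abbrev dX (j : ℕ) : (ℕ → ℝ) →ₗ[ℝ] ℝ := deltaₗ D.α D.Kx₁ D.Kx₂ (D.hx Mx) Mx j

noncomputable abbrev dY (s : ℕ) : (ℕ → ℝ) →ₗ[ℝ] ℝ := deltaₗ D.β D.Ky₁ D.Ky₂ (D.hy My) My s

theorem opX_opY_apply (r : ℝ) (V : ℕ → ℕ → ℝ) (j s : ℕ) :
    D.opX Mx r (D.opY My r V) j s = mixed (D.pX Mx j) (D.pY My s) V
      + r * mixed (D.pX Mx j) (D.dY My s) V + r * mixed (D.dX Mx j) (D.pY My s) V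
      + r ^ 2 * mixed (D.dX Mx j) (D.dY My s) V := by
  have h1 : D.opX Mx r (D.opY My r V) j s
      = (D.pX Mx j + r • D.dX Mx j) ((fun i => D.pY My s (V i)) + r • fun i => D.dY My s (V i)) :=
    rfl
  rw [h1]
  simp only [LinearMap.add_apply, LinearMap.smul_apply, map_add, map_smul, smul_eq_mul, mixed_apply]
  ring

theorem inX_inY_P_apply (V : ℕ → ℕ → ℝ) (j s : ℕ) :
    inX (P D.α (D.hx Mx)) (inY (P D.β (D.hy My)) V) j s = mixed (D.pX Mx j) (D.pY My s) V := rfl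

variable {D Mx My} {H : ℝ × ℝ × ℝ → ℝ}

theorem hx_pos (hM : 0 < Mx) : 0 < D.hx Mx := div_pos (sub_pos.2 D.hab) (by exact_mod_cast hM)

theorem hy_pos (hM : 0 < My) : 0 < D.hy My := div_pos (sub_pos.2 D.hcd) (by exact_mod_cast hM)

theorem abs_pX_le {B : ℝ} {j : ℕ} {v : ℕ → ℝ} (hj : j ∈ Finset.Ioo 0 Mx)
    (hB : ∀ i ≤ Mx, |v i| ≤ B) : |D.pX Mx j v| ≤ B :=
  abs_P_le D.hα₁ D.hα₂ (hx_pos (by simp at hj; omega)).ne' hj hB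

theorem abs_pY_le {B : ℝ} {s : ℕ} {v : ℕ → ℝ} (hs : s ∈ Finset.Ioo 0 My)
    (hB : ∀ i ≤ My, |v i| ≤ B) : |D.pY My s v| ≤ B :=
  abs_P_le D.hβ₁ D.hβ₂ (hy_pos (by simp at hs; omega)).ne' hs hB

/-- The right hand side obtained by inserting a smooth function into the equation. -/
noncomputable def source (D : Data) (H : ℝ × ℝ × ℝ → ℝ) (p : ℝ × ℝ × ℝ) : ℝ :=
  D.dt H p - D.diffX H p - D.diffY H p

/-- The residual of a smooth function in one step of the scheme. -/
noncomputable def residual (D : Data) (Mx My : ℕ) (H : ℝ × ℝ × ℝ → ℝ) (m r : ℝ) (j s : ℕ) : ℝ :=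
  D.opX Mx (-r) (D.opY My (-r) (D.grid Mx My H (m + r))) j s
    - D.opX Mx r (D.opY My r (D.grid Mx My H (m - r))) j s
    - 2 * r * inX (P D.α (D.hx Mx)) (inY (P D.β (D.hy My)) (D.grid Mx My (D.source H) m)) j s

/-- The terms are, in order: the central time difference against ∂_t, averaging in time under δ_y
and under δ_x, the splitting error r² δ_x δ_y, and the consistency errors in x and in y. Here m is
the half-step time and 2r = τ. -/
theorem residual_eq (m r : ℝ) (j s : ℕ) :
    D.residual Mx My H m r j s
      = mixed (D.pX Mx j) (D.pY My s) (fun i k => D.grid Mx My H (m + r) i k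
          - D.grid Mx My H (m - r) i k - 2 * r * D.grid Mx My (D.dt H) m i k)
        - r * mixed (D.pX Mx j) (D.dY My s) (fun i k => D.grid Mx My H (m + r) i k
          + D.grid Mx My H (m - r) i k - 2 * D.grid Mx My H m i k)
        - r * D.pY My s (fun k => D.dX Mx j fun i => D.grid Mx My H (m + r) i k
          + D.grid Mx My H (m - r) i k - 2 * D.grid Mx My H m i k)
        + r ^ 2 * mixed (D.dX Mx j) (D.dY My s) (fun i k => D.grid Mx My H (m + r) i k
          - D.grid Mx My H (m - r) i k)
        + 2 * r * D.pY My s (fun k => D.pX Mx j (fun i => D.grid Mx My (D.diffX H) m i k)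
          - D.dX Mx j fun i => D.grid Mx My H m i k)
        + 2 * r * D.pX Mx j (fun i => D.pY My s (fun k => D.grid Mx My (D.diffY H) m i k)
          - D.dY My s fun k => D.grid Mx My H m i k) := by
  set V := D.grid Mx My H (m + r)
  set W := D.grid Mx My H (m - r)
  set U := D.grid Mx My H m
  set A := D.grid Mx My (D.diffX H) m
  set B := D.grid Mx My (D.diffY H) m
  set F := D.grid Mx My (D.dt H) m
  have e0 : D.grid Mx My (D.source H) m = F - A - B := rfl
  have e1 : (fun i k => V i k - W i k - 2 * r * F i k) = V - W - (2 * r) • F := rfl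
  have e2 : (fun i k => V i k + W i k - 2 * U i k) = V + W - (2 : ℝ) • U := rfl
  have e3 : (fun i k => V i k - W i k) = V - W := rfl
  have e4 : D.pY My s (fun k => D.pX Mx j (fun i => A i k) - D.dX Mx j fun i => U i k)
      = mixed (D.pX Mx j) (D.pY My s) A - mixed (D.dX Mx j) (D.pY My s) U := by
    rw [mixed_P, mixed_P, ← map_sub]; rfl
  have e5 : D.pX Mx j (fun i => D.pY My s (fun k => B i k) - D.dY My s fun k => U i k)
      = mixed (D.pX Mx j) (D.pY My s) B - mixed (D.pX Mx j) (D.dY My s) U := by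
    rw [mixed_apply, mixed_apply, ← map_sub]; rfl
  have e6 : D.pY My s (fun k => D.dX Mx j fun i => V i k + W i k - 2 * U i k)
      = mixed (D.dX Mx j) (D.pY My s) (V + W - (2 : ℝ) • U) := by
    rw [mixed_P]; rfl
  unfold residual
  rw [opX_opY_apply, opX_opY_apply, inX_inY_P_apply, e0, e1, e2, e3, e4, e5, e6]
  simp only [map_add, map_sub, map_smul, smul_eq_mul]
  ring

/-- Every term carries a factor r, extracted as the time step 2r; the averaging functionals cost
nothing in the sup norm. -/
theorem IsSmooth.residual_bound (hH : D.IsSmooth 7 H) :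
    ∃ C, 0 ≤ C ∧ ∀ Mx My, ∀ j ∈ Finset.Ioo 0 Mx, ∀ s ∈ Finset.Ioo 0 My, ∀ m r, D.IsTimeStep m r →
      |D.residual Mx My H m r j s| ≤ 2 * r * (C * (r ^ 2 + D.hx Mx ^ 4 + D.hy My ^ 4)) := by
  obtain ⟨C₁, h1, H1⟩ := (hH.mono (show 3 ≤ 7 by norm_num)).central_time_diff
  obtain ⟨C₂, h2, H2⟩ := (hH.mono (show 5 ≤ 7 by norm_num)).deltaY_second_time_diff
  obtain ⟨C₃, h3, H3⟩ := (hH.mono (show 5 ≤ 7 by norm_num)).deltaX_second_time_diff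
  obtain ⟨C₄, h4, H4⟩ := hH.deltaX_deltaY_time_diff
  obtain ⟨C₅, h5, H5⟩ := (hH.mono (show 6 ≤ 7 by norm_num)).deltaX_consistency
  obtain ⟨C₆, h6, H6⟩ := (hH.mono (show 6 ≤ 7 by norm_num)).deltaY_consistency
  refine ⟨C₁ + C₂ + C₃ + C₄ + C₅ + C₆, by positivity, fun Mx My j hj s hs m r hr => ?_⟩
  have hr0 := hr.nonneg
  have hx0 : 0 ≤ D.hx Mx ^ 4 := by positivity
  have hy0 : 0 ≤ D.hy My ^ 4 := by positivity
  rw [residual_eq]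
  have b1 : |mixed (D.pX Mx j) (D.pY My s) (fun i k => D.grid Mx My H (m + r) i k
      - D.grid Mx My H (m - r) i k - 2 * r * D.grid Mx My (D.dt H) m i k)| ≤ C₁ * r ^ 3 :=
    abs_pX_le hj fun i hi => abs_pY_le hs fun k hk =>
      H1 _ (D.x_mem hi) _ (D.y_mem hk) m r hr
  have b2 : |mixed (D.pX Mx j) (D.dY My s) (fun i k => D.grid Mx My H (m + r) i k
      + D.grid Mx My H (m - r) i k - 2 * D.grid Mx My H m i k)| ≤ C₂ * r ^ 2 :=
    abs_pX_le hj fun i hi => H2 My s hs _ (D.x_mem hi) m r hr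
  have b3 : |D.pY My s (fun k => D.dX Mx j fun i => D.grid Mx My H (m + r) i k
      + D.grid Mx My H (m - r) i k - 2 * D.grid Mx My H m i k)| ≤ C₃ * r ^ 2 :=
    abs_pY_le hs fun k hk => H3 Mx j hj _ (D.y_mem hk) m r hr
  have b4 : |mixed (D.dX Mx j) (D.dY My s) (fun i k => D.grid Mx My H (m + r) i k
      - D.grid Mx My H (m - r) i k)| ≤ C₄ * r := H4 Mx My j hj s hs m r hr
  have b5 : |D.pY My s (fun k => D.pX Mx j (fun i => D.grid Mx My (D.diffX H) m i k)
      - D.dX Mx j fun i => D.grid Mx My H m i k)| ≤ C₅ * D.hx Mx ^ 4 :=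
    abs_pY_le hs fun k hk => H5 Mx j hj _ (D.y_mem hk) m hr.mid
  have b6 : |D.pX Mx j (fun i => D.pY My s (fun k => D.grid Mx My (D.diffY H) m i k)
      - D.dY My s fun k => D.grid Mx My H m i k)| ≤ C₆ * D.hy My ^ 4 :=
    abs_pX_le hj fun i hi => H6 My s hs _ (D.x_mem hi) m hr.mid
  refine (abs_add_le _ _).trans ((add_le_add_left ((abs_add_le _ _).trans (add_le_add_left
    ((abs_add_le _ _).trans (add_le_add_left ((abs_sub _ _).trans (add_le_add_left
    (abs_sub _ _) _)) _)) _)) _).trans ?_)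
  have hr2 : 0 ≤ r ^ 2 := sq_nonneg r
  simp only [abs_mul, abs_of_nonneg hr0, abs_of_nonneg hr2, abs_of_pos (two_pos (α := ℝ))]
  calc _ ≤ C₁ * r ^ 3 + r * (C₂ * r ^ 2) + r * (C₃ * r ^ 2) + r ^ 2 * (C₄ * r)
        + 2 * r * (C₅ * D.hx Mx ^ 4) + 2 * r * (C₆ * D.hy My ^ 4) := by gcongr
    _ ≤ 2 * r * ((C₁ + C₂ + C₃ + C₄) * r ^ 2 + C₅ * D.hx Mx ^ 4 + C₆ * D.hy My ^ 4) := by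
        have : 0 ≤ (C₁ + C₂ + C₃ + C₄) * r ^ 2 * r := by positivity
        linarith
    _ ≤ _ := by
        refine mul_le_mul_of_nonneg_left ?_ (by positivity)
        have : 0 ≤ (C₅ + C₆) * r ^ 2 + (C₁ + C₂ + C₃ + C₄ + C₆) * D.hx Mx ^ 4
          + (C₁ + C₂ + C₃ + C₄ + C₅) * D.hy My ^ 4 := by positivity
        linarith

end Data

end FracDiffusion
namespace FracDiffusion

/-! The error equation. -/

namespace Data

variable {D : Data} {u : ℝ → ℝ → ℝ → ℝ} {Mx My N : ℕ} {U : ℕ → ℕ → ℕ → ℝ}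

/-- The error of the scheme, in terms of the zero extension. -/
noncomputable def error (D : Data) (u : ℝ → ℝ → ℝ → ℝ) (Mx My N : ℕ) (U : ℕ → ℕ → ℕ → ℝ) (n : ℕ) :
    ℕ → ℕ → ℝ := D.grid Mx My (zeroExt D u) (D.t N n) - U n

theorem t_mem_Icc {n : ℕ} (hn : n ≤ N) : D.t N n ∈ Icc 0 D.T := by
  have := add_mul_div_mem_Icc D.hT.le hn
  rwa [zero_add, sub_zero] at this

theorem t_pos (hN : 0 < N) {n : ℕ} (hn : 0 < n) : 0 < D.t N n :=
  mul_pos (by exact_mod_cast hn) (div_pos D.hT (by exact_mod_cast hN))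

theorem τ_pos (hN : 0 < N) : 0 < D.τ N := div_pos D.hT (by exact_mod_cast hN)

theorem t_succ (n : ℕ) : D.t N (n + 1) = D.t N n + D.τ N := by
  unfold t; push_cast; ring

theorem isTimeStep (hN : 0 < N) {n : ℕ} (hn : n < N) :
    D.IsTimeStep ((D.t N n + D.t N (n + 1)) / 2) (D.τ N / 2) := by
  have h0 := t_mem_Icc (D := D) hn.le
  have h1 := t_mem_Icc (D := D) hn
  have e := t_succ (D := D) (N := N) n
  refine ⟨(half_pos (τ_pos hN)).le, ⟨?_, ?_⟩, ?_, ?_⟩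
  · linarith [h0.1, h1.1]
  · linarith [h0.2, h1.2]
  · rwa [show (D.t N n + D.t N (n + 1)) / 2 + D.τ N / 2 = D.t N (n + 1) by rw [e]; ring]
  · rwa [show (D.t N n + D.t N (n + 1)) / 2 - D.τ N / 2 = D.t N n by rw [e]; ring]

theorem x_zero : D.x Mx 0 = D.a := by simp [x]

theorem x_last (hM : 0 < Mx) : D.x Mx Mx = D.b := by
  have : (Mx : ℝ) ≠ 0 := by exact_mod_cast hM.ne'
  unfold x hx; field_simp; ring

theorem y_zero : D.y My 0 = D.c := by simp [y]

theorem y_last (hM : 0 < My) : D.y My My = D.d := by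
  have : (My : ℝ) ≠ 0 := by exact_mod_cast hM.ne'
  unfold y hy; field_simp; ring

theorem grid_zeroExt (u : ℝ → ℝ → ℝ → ℝ) {i k : ℕ} (hi : i ≤ Mx) (hk : k ≤ My) (t : ℝ) :
    D.grid Mx My (zeroExt D u) t i k = u (D.x Mx i) (D.y My k) t :=
  zeroExt_apply u (D.x_mem hi) (D.y_mem hk) t

theorem error_zero (hu : IsSolution D u) (hU : IsSchemeSolution D Mx My N U) {i k : ℕ}
    (hi : i ≤ Mx) (hk : k ≤ My) : D.error u Mx My N U 0 i k = 0 := by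
  have ht : D.t N 0 = 0 := by simp [t]
  unfold error
  rw [Pi.sub_apply, Pi.sub_apply, grid_zeroExt u hi hk, ht,
    hu.initial _ (D.x_mem hi) _ (D.y_mem hk), hU.initial i hi k hk, sub_self]

theorem error_boundary (hMx : 0 < Mx) (hMy : 0 < My) (hN : 0 < N) (hu : IsSolution D u)
    (hU : IsSchemeSolution D Mx My N U) {n : ℕ} (hn : n ≤ N) :
    ∀ i ≤ Mx, ∀ k ≤ My, i = 0 ∨ i = Mx ∨ k = 0 ∨ k = My → D.error u Mx My N U n i k = 0 := by
  intro i hi k hk hik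
  rcases Nat.eq_zero_or_pos n with rfl | hn0
  · exact error_zero hu hU hi hk
  unfold error
  rw [Pi.sub_apply, Pi.sub_apply, grid_zeroExt u hi hk, hU.boundary n hn0 hn i hi k hk hik,
    hu.boundary _ (D.x_mem hi) _ (D.y_mem hk) _ ⟨t_pos hN hn0, (t_mem_Icc hn).2⟩, sub_self]
  rcases hik with rfl | rfl | rfl | rfl
  · exact Or.inl x_zero
  · exact Or.inr (Or.inl (x_last hMx))
  · exact Or.inr (Or.inr (Or.inl y_zero))
  · exact Or.inr (Or.inr (Or.inr (y_last hMy)))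

/-- At every node, boundary nodes included, f at the half step equals the source computed from the
zero extension; subtracting the scheme from the definition of the residual then leaves the error
equation. -/
theorem error_step_apply (hN : 0 < N) (hu : IsSolution D u) (hsmooth : SufficientlySmooth D u)
    (hU : IsSchemeSolution D Mx My N U) {n : ℕ} (hn : n < N) {j s : ℕ} (hj : j ∈ Finset.Ioo 0 Mx)
    (hs : s ∈ Finset.Ioo 0 My) :
    D.opX Mx (-(D.τ N / 2)) (D.opY My (-(D.τ N / 2)) (D.error u Mx My N U (n + 1))) j s
      = D.opX Mx (D.τ N / 2) (D.opY My (D.τ N / 2) (D.error u Mx My N U n)) j s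
        + D.residual Mx My (zeroExt D u) ((D.t N n + D.t N (n + 1)) / 2) (D.τ N / 2) j s := by
  have e := t_succ (D := D) (N := N) n
  have hm := isTimeStep (D := D) hN hn
  have h1 := hU.step n hn j hj s hs
  have hf : mixed (D.pX Mx j) (D.pY My s) (D.fHalf Mx My N n) = mixed (D.pX Mx j) (D.pY My s)
      (D.grid Mx My (D.source (zeroExt D u)) ((D.t N n + D.t N (n + 1)) / 2)) := by
    refine mixed_congr (isLocal_P _ _ hj) (isLocal_P _ _ hs) fun i hi k hk => ?_
    refine f_eq hu hsmooth (D.x_mem hi) (D.y_mem hk) ⟨?_, hm.mid.2⟩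
    have := t_pos (D := D) hN (Nat.succ_pos n)
    have := (t_mem_Icc (D := D) hn.le).1
    linarith
  unfold residual
  rw [show (D.t N n + D.t N (n + 1)) / 2 + D.τ N / 2 = D.t N (n + 1) by rw [e]; ring,
    show (D.t N n + D.t N (n + 1)) / 2 - D.τ N / 2 = D.t N n by rw [e]; ring]
  rw [inX_inY_P_apply, opX_opY_apply, opX_opY_apply] at h1 ⊢
  rw [opX_opY_apply, opX_opY_apply, ← hf]
  unfold error
  simp only [map_sub]
  linear_combination -h1

theorem gridNorm_eq (hMx : 0 < Mx) (hMy : 0 < My) (V : ℕ → ℕ → ℝ) :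
    D.gridNorm Mx My V = √(D.hx Mx * D.hy My)
      * √(gridIp Mx My (toInterior Mx My V) (toInterior Mx My V)) := by
  unfold gridNorm
  rw [← Real.sqrt_mul (mul_pos (hx_pos hMx) (hy_pos hMy)).le, gridIp_apply]
  congr 2
  refine Finset.sum_congr rfl fun j hj => Finset.sum_congr rfl fun s hs => ?_
  rw [toInterior_apply V hj hs, sq]

theorem error_bound (hMx : 0 < Mx) (hMy : 0 < My) (hN : 0 < N) (hu : IsSolution D u)
    (hsmooth : SufficientlySmooth D u) (hU : IsSchemeSolution D Mx My N U) {ρ : ℝ} (hρ : 0 ≤ ρ)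
    (hR : ∀ n < N, ∀ j ∈ Finset.Ioo 0 Mx, ∀ s ∈ Finset.Ioo 0 My,
      |D.residual Mx My (zeroExt D u) ((D.t N n + D.t N (n + 1)) / 2) (D.τ N / 2) j s|
        ≤ D.τ N * ρ) {n : ℕ} (hn : n ≤ N) :
    D.gridNorm Mx My (D.error u Mx My N U n) ≤ 9 * D.T * √((D.b - D.a) * (D.d - D.c)) * ρ := by
  have hτ := (τ_pos (D := D) hN).le
  have key := scheme_stability D.hα₁ D.hα₂ D.hβ₁ D.hβ₂ (hx_pos (D := D) hMx)
    (hy_pos (D := D) hMy) (half_pos (τ_pos (D := D) hN)).le D.hKx₁ D.hKx₂ D.hKy₁ D.hKy₂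
    (mul_nonneg hτ hρ)
    (E := fun n => toInterior Mx My (D.error u Mx My N U n))
    (R := fun n => toInterior Mx My (D.residual Mx My (zeroExt D u)
      ((D.t N n + D.t N (n + 1)) / 2) (D.τ N / 2))) (N := N) (n := n)
    ?_ ?_ rfl rfl rfl rfl ?_ hn
  · rw [gridNorm_eq hMx hMy]
    have hMx' : (0 : ℝ) < Mx := by exact_mod_cast hMx
    have hMy' : (0 : ℝ) < My := by exact_mod_cast hMy
    have hhx := hx_pos (D := D) hMx
    have hhy := hy_pos (D := D) hMy
    calc _ ≤ √(D.hx Mx * D.hy My) * (3 ^ 2 * (n * (√(Mx * My) * (D.τ N * ρ)))) := by gcongr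
      _ = 9 * D.t N n * (√(D.hx Mx * D.hy My) * √(Mx * My)) * ρ := by unfold t; ring
      -- The cell size times the number of cells is the area of the rectangle, and nτ = t_n ≤ T, so
      -- no power of the mesh sizes is lost.
      _ = 9 * D.t N n * √((D.b - D.a) * (D.d - D.c)) * ρ := by
          rw [← Real.sqrt_mul (by positivity), show D.hx Mx * D.hy My * (Mx * My)
            = (D.b - D.a) * (D.d - D.c) by unfold hx hy; field_simp]
      _ ≤ _ := by
          have := (t_mem_Icc (D := D) hn).2
          gcongr
  · ext j s
    by_cases h : j ∈ Finset.Ioo 0 Mx ∧ s ∈ Finset.Ioo 0 My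
    · rw [toInterior_apply _ h.1 h.2]
      have h' := h
      simp at h'
      exact error_zero hu hU (by omega) (by omega)
    · exact InteriorGrid.apply_eq_zero _ h
  · intro n hn j hj s hs
    rw [toInterior_apply _ hj hs]
    exact hR n hn j hj s hs
  · intro n hn
    ext j s
    by_cases h : j ∈ Finset.Ioo 0 Mx ∧ s ∈ Finset.Ioo 0 My
    · obtain ⟨hj, hs⟩ := h
      have h1 := error_boundary hMx hMy hN hu hU (n := n + 1) hn
      have h0 := error_boundary hMx hMy hN hu hU hn.le
      have px := isLocal_P D.α (D.hx Mx) hj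
      have py := isLocal_P D.β (D.hy My) hs
      have dx := isLocal_delta D.α D.Kx₁ D.Kx₂ (D.hx Mx) hj
      have dy := isLocal_delta D.β D.Ky₁ D.Ky₂ (D.hy My) hs
      simp only [Submodule.coe_add, Submodule.coe_sub, Submodule.coe_smul, Pi.add_apply,
        Pi.sub_apply, Pi.smul_apply, smul_eq_mul]
      rw [gridX_gridY_toInterior px py hj hs h1, gridX_gridY_toInterior px dy hj hs h1,
        gridX_gridY_toInterior dx py hj hs h1, gridX_gridY_toInterior dx dy hj hs h1,
        gridX_gridY_toInterior px py hj hs h0, gridX_gridY_toInterior px dy hj hs h0,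
        gridX_gridY_toInterior dx py hj hs h0, gridX_gridY_toInterior dx dy hj hs h0,
        toInterior_apply _ hj hs]
      have := error_step_apply hN hu hsmooth hU hn hj hs
      rw [opX_opY_apply, opX_opY_apply] at this
      linear_combination this
    · rw [InteriorGrid.apply_eq_zero _ h, InteriorGrid.apply_eq_zero _ h]

end Data

end FracDiffusion
-- The convergence theorem.
theorem mainTheorem5 (D : FracDiffusion.Data) (u : ℝ → ℝ → ℝ → ℝ)
    (hu : FracDiffusion.IsSolution D u) (hsmooth : FracDiffusion.SufficientlySmooth D u) :
    ∃ C : ℝ, 0 < C ∧ ∀ Mx My N : ℕ, 0 < Mx → 0 < My → 0 < N →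
      ∀ U : ℕ → ℕ → ℕ → ℝ, FracDiffusion.IsSchemeSolution D Mx My N U →
        ∀ n ≤ N,
          D.gridNorm Mx My (fun j s => u (D.x Mx j) (D.y My s) (D.t N n) - U n j s)
            ≤ C * ((D.τ N) ^ 2 + (D.hx Mx) ^ 4 + (D.hy My) ^ 4) := by
  obtain ⟨C, hC, H⟩ := hsmooth.isSmooth.residual_bound
  have hT := D.hT
  -- The summand 1 only secures strict positivity, since C may be zero.
  refine ⟨9 * D.T * √((D.b - D.a) * (D.d - D.c)) * C + 1, by positivity, ?_⟩
  intro Mx My N hMx hMy hN U hU n hn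
  have hτ := FracDiffusion.Data.τ_pos (D := D) hN
  set ε := D.τ N ^ 2 + D.hx Mx ^ 4 + D.hy My ^ 4 with hε
  have hε0 : 0 ≤ ε := by positivity
  have e : D.gridNorm Mx My (fun j s => u (D.x Mx j) (D.y My s) (D.t N n) - U n j s)
      = D.gridNorm Mx My (D.error u Mx My N U n) := by
    unfold FracDiffusion.Data.gridNorm
    congr 2
    refine Finset.sum_congr rfl fun j hj => Finset.sum_congr rfl fun s hs => ?_
    rw [FracDiffusion.Data.error, Pi.sub_apply, Pi.sub_apply, FracDiffusion.Data.grid_zeroExt u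
      (Finset.mem_Ioo.1 hj).2.le (Finset.mem_Ioo.1 hs).2.le]
  rw [e]
  refine (FracDiffusion.Data.error_bound hMx hMy hN hu hsmooth hU (ρ := C * ε) (by positivity)
    (fun k hk j hj s hs => ?_) hn).trans ?_
  · refine (H Mx My j hj s hs _ _ (FracDiffusion.Data.isTimeStep hN hk)).trans ?_
    -- The residual bound is used with r = τ/2, so its prefactor 2r is τ; afterwards (τ/2)² ≤ τ².
    rw [mul_div_cancel₀ _ (two_ne_zero' ℝ)]
    refine mul_le_mul_of_nonneg_left (mul_le_mul_of_nonneg_left ?_ hC) hτ.le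
    rw [hε]
    gcongr
    linarith
  · linarith
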